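/- Let $N\ge 3$ and let $\mathbb{F}O_N$ be the orthogonal free quantum group: its Hopf $*$-algebra is generated by self-adjoint elements $u_{ij}$ ($1\le i,j\le N$) such that the matrix $u=(u_{ij})$ satisfies $uu^*=u^*u=1$, with coproduct $\Delta(u_{ij})=\sum_s u_{is}\otimes u_{sj}$. Let $h$ be its Haar state and $H$ the Hilbert space obtained by completion for the scalar product $(x\mid y)=h(x^*y)$ (linear in $y$). Let $H_1=\mathbb{C}^N$ with canonical basis $(e_s)$ and $t=\sum_s e_s\otimes e_s$. For $k\in\mathbb{N}$ let $H_k\subset H_1^{\otimes k}$ be the subspace of the irreducible corepresentation $u_k$, i.e. the space of vectors killed by all maps $\mathrm{id}\otimes t^*\otimes\mathrm{id}$ contracting two neighbouring legs; let $P_k$ be the orthogonal projection onto $H_k$, $d_k=\dim H_k$, and identify $B(H_k)$ with $P_kB(H_1^{\otimes k})P_k$. For $X\in B(H_k)$ put $u_k(X)=(\mathrm{id}\otimes\mathrm{Tr})(u^{\otimes k}(1\otimes X))$, let $\chi_k=u_k(P_k)$ be the $k$-th irreducible character, and let $p_k$ be the orthogonal projection of $H$ onto $u_k(B(H_k))$.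 For $k\ge 1$ let $$B(H_k)^{\circ\circ}=\{X\in B(H_k)\mid (\mathrm{Tr}_1\otimes\mathrm{id})(X)=0=(\mathrm{id}\otimes\mathrm{Tr}_1)(X)\},$$ where $\mathrm{Tr}_1$ is the trace of $B(H_1)$ on the first, respectively last, leg, and let $\rho(X)=(P_k\otimes t^*)(\mathrm{id}_1\otimes X\otimes \mathrm{id}_1)(t\otimes P_k)$ be the rotation operator on $B(H_k)$. Theorem. Let $n>k>0$ be integers, let $X\in B(H_k)^{\circ\circ}$ and $\mu\in\mathbb{C}$ with $\rho(X)=\mu X$, and put $x=u_k(X)$ (for instance, $x$ a unit vector in a basis of $u_k(B(H_k)^{\circ\circ})$ coming from eigenvectors of $\rho$). For $i,j\in\mathbb{N}$ put $x_{i,j}=p_{i+k+j}(\chi_i x\chi_j)\in H$, and for $m\ge k$ and $0\le i,p\le m-k$ let $$G_{m;i,p}=(x_{i,m-k-i}\mid x_{p,m-k-p})$$ be the entries of the $m$-th diagonal block of the Gram matrix of $(x_{i,j})_{i,j}$. Then for all $0\le i<n-k$ and $0\le p\le n-k$, $$G_{n;i,p}=\delta_{p<n-k}\,(1-A^n_p)\,G_{n-1;i,p}+\delta_{p>0}\,B^n_p\,G_{n-1;i,p-1}+\delta_{p>1}\,C^n_p\,G_{n-1;i,p-2},$$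 where $\delta_{\mathcal P}$ is $1$ if $\mathcal P$ holds and $0$ otherwise (a term with $\delta_{\mathcal P}=0$ is omitted), and $$A^n_p=\frac{d_{p+k}d_{p+k-1}}{d_nd_{n-1}},\qquad B^n_p=2(-1)^k\,\mathrm{Re}(\mu)\,\frac{d_{p+k-1}d_{p-1}}{d_nd_{n-1}},\qquad C^n_p=-\frac{d_{p-1}d_{p-2}}{d_nd_{n-1}}.$$ -/

import Mathlib

noncomputable section

namespace FreeOrth

open scoped TensorProduct ComplexOrder InnerProductSpace

/-- The defining relations `u uᵗ = 1` and `uᵗ u = 1` between the self-adjoint generators `u i j`. -/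
inductive Rel (N : ℕ) :
    FreeAlgebra ℂ (Fin N × Fin N) → FreeAlgebra ℂ (Fin N × Fin N) → Prop
  | row (i j : Fin N) :
      Rel N (∑ s, FreeAlgebra.ι ℂ (i, s) * FreeAlgebra.ι ℂ (j, s)) (if i = j then 1 else 0)
  | col (i j : Fin N) :
      Rel N (∑ s, FreeAlgebra.ι ℂ (s, i) * FreeAlgebra.ι ℂ (s, j)) (if i = j then 1 else 0)

/-- The Hopf `*`-algebra of the orthogonal free quantum group: the dense `*`-subalgebra of
`A_o(N)` generated by the `u i j`. -/
def Pol (N : ℕ) : Type := RingQuot (Rel N)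

instance (N : ℕ) : Ring (Pol N) := inferInstanceAs (Ring (RingQuot (Rel N)))

instance (N : ℕ) : Algebra ℂ (Pol N) := inferInstanceAs (Algebra ℂ (RingQuot (Rel N)))

/-- The quotient map from the free algebra. -/
def polMk (N : ℕ) : FreeAlgebra ℂ (Fin N × Fin N) →ₐ[ℂ] Pol N := RingQuot.mkAlgHom ℂ (Rel N)

/-- The canonical generators. -/
def u {N : ℕ} (i j : Fin N) : Pol N := polMk N (FreeAlgebra.ι ℂ (i, j))

theorem u_row {N : ℕ} (i j : Fin N) :
    ∑ s, u i s * u j s = if i = j then (1 : Pol N) else 0 := by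
  have h : polMk N _ = polMk N _ := RingQuot.mkAlgHom_rel ℂ (Rel.row i j)
  rw [map_sum] at h
  simp only [map_mul] at h
  rw [apply_ite (polMk N), map_one, map_zero] at h
  exact h

theorem u_col {N : ℕ} (i j : Fin N) :
    ∑ s, u s i * u s j = if i = j then (1 : Pol N) else 0 := by
  have h : polMk N _ = polMk N _ := RingQuot.mkAlgHom_rel ℂ (Rel.col i j)
  rw [map_sum] at h
  simp only [map_mul] at h
  rw [apply_ite (polMk N), map_one, map_zero] at h
  exact h

theorem polMk_surjective (N : ℕ) : Function.Surjective (polMk N) :=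
  RingQuot.mkAlgHom_surjective ℂ (Rel N)

theorem pol_induction {N : ℕ} {motive : Pol N → Prop}
    (scalar : ∀ r : ℂ, motive (algebraMap ℂ (Pol N) r)) (gen : ∀ i j, motive (u i j))
    (mul : ∀ x y, motive x → motive y → motive (x * y))
    (add : ∀ x y, motive x → motive y → motive (x + y)) (x : Pol N) : motive x := by
  obtain ⟨y, rfl⟩ := polMk_surjective N x
  induction y using FreeAlgebra.induction with
  | grade0 r => simpa using scalar r
  | grade1 x => exact gen x.1 x.2
  | mul a b ha hb => simpa using mul _ _ ha hb
  | add a b ha hb => simpa using add _ _ ha hb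

theorem lift_rel {N : ℕ} {B : Type*} [Ring B] [Algebra ℂ B] (f : Fin N → Fin N → B)
    (hr : ∀ i j, ∑ s, f i s * f j s = if i = j then 1 else 0)
    (hc : ∀ i j, ∑ s, f s i * f s j = if i = j then 1 else 0)
    ⦃x y : FreeAlgebra ℂ (Fin N × Fin N)⦄ (h : Rel N x y) :
    FreeAlgebra.lift ℂ (fun p => f p.1 p.2) x = FreeAlgebra.lift ℂ (fun p => f p.1 p.2) y := by
  cases h with
  | row i j =>
    simp only [map_sum, map_mul, FreeAlgebra.lift_ι_apply, hr]
    split_ifs <;> simp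
  | col i j =>
    simp only [map_sum, map_mul, FreeAlgebra.lift_ι_apply, hc]
    split_ifs <;> simp

/-- Lift of a map on generators to an algebra homomorphism. -/
def polLift {N : ℕ} {B : Type*} [Ring B] [Algebra ℂ B] (f : Fin N → Fin N → B)
    (hr : ∀ i j, ∑ s, f i s * f j s = if i = j then 1 else 0)
    (hc : ∀ i j, ∑ s, f s i * f s j = if i = j then 1 else 0) : Pol N →ₐ[ℂ] B :=
  RingQuot.liftAlgHom ℂ ⟨FreeAlgebra.lift ℂ fun p => f p.1 p.2, lift_rel f hr hc⟩

theorem polLift_u {N : ℕ} {B : Type*} [Ring B] [Algebra ℂ B] (f : Fin N → Fin N → B)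
    (hr : ∀ i j, ∑ s, f i s * f j s = if i = j then 1 else 0)
    (hc : ∀ i j, ∑ s, f s i * f s j = if i = j then 1 else 0) (i j : Fin N) :
    polLift f hr hc (u i j) = f i j := by
  have := RingQuot.liftAlgHom_mkAlgHom_apply ℂ (FreeAlgebra.lift ℂ fun p => f p.1 p.2)
    (s := Rel N) (lift_rel f hr hc) (FreeAlgebra.ι ℂ (i, j))
  rw [FreeAlgebra.lift_ι_apply] at this
  exact this

/-- The coproduct, `Δ (u i j) = ∑ s, u i s ⊗ u s j`. -/
def comul (N : ℕ) : Pol N →ₐ[ℂ] Pol N ⊗[ℂ] Pol N :=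
  polLift (fun i j => ∑ s, u i s ⊗ₜ[ℂ] u s j)
    (by
      intro i j
      simp only [Finset.sum_mul_sum, Algebra.TensorProduct.tmul_mul_tmul]
      rw [Finset.sum_comm]
      have : ∀ y : Fin N, ∑ x : Fin N, ∑ t : Fin N,
          (u i y * u j t) ⊗ₜ[ℂ] (u y x * u t x) = (u i y * u j y) ⊗ₜ[ℂ] (1 : Pol N) := by
        intro y
        rw [Finset.sum_comm]
        simp_rw [← TensorProduct.tmul_sum, u_row, TensorProduct.tmul_ite]
        simp
      simp_rw [this, ← TensorProduct.sum_tmul, u_row]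
      split_ifs <;> simp [Algebra.TensorProduct.one_def])
    (by
      intro i j
      simp only [Finset.sum_mul_sum, Algebra.TensorProduct.tmul_mul_tmul]
      rw [Finset.sum_comm]
      have : ∀ y : Fin N, ∑ x : Fin N, ∑ t : Fin N,
          (u x y * u x t) ⊗ₜ[ℂ] (u y i * u t j) = (1 : Pol N) ⊗ₜ[ℂ] (u y i * u y j) := by
        intro y
        rw [Finset.sum_comm]
        simp_rw [← TensorProduct.sum_tmul, u_col, TensorProduct.ite_tmul]
        simp
      simp_rw [this, ← TensorProduct.tmul_sum, u_col]
      split_ifs <;> simp [Algebra.TensorProduct.one_def])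

theorem comul_u {N : ℕ} (i j : Fin N) :
    comul N (u i j) = ∑ s, u i s ⊗ₜ[ℂ] u s j := polLift_u _ _ _ i j

/-- The conjugate-linear anti-automorphism fixing the generators. -/
def starHom (N : ℕ) : Pol N →+* (Pol N)ᵐᵒᵖ :=
  let alg : Algebra ℂ (Pol N)ᵐᵒᵖ :=
    RingHom.toAlgebra' ((algebraMap ℂ (Pol N)ᵐᵒᵖ).comp (starRingEnd ℂ))
      (fun c x => Algebra.commutes (starRingEnd ℂ c) x)
  (@polLift N (Pol N)ᵐᵒᵖ _ alg (fun i j => MulOpposite.op (u i j))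
    (by
      intro i j
      simp_rw [← MulOpposite.op_mul, ← Finset.op_sum, u_row]
      simp only [eq_comm (a := j)]
      split_ifs <;> simp)
    (by
      intro i j
      simp_rw [← MulOpposite.op_mul, ← Finset.op_sum, u_col]
      simp only [eq_comm (a := j)]
      split_ifs <;> simp)).toRingHom

theorem starHom_u {N : ℕ} (i j : Fin N) : starHom N (u i j) = MulOpposite.op (u i j) := by
  let alg : Algebra ℂ (Pol N)ᵐᵒᵖ :=
    RingHom.toAlgebra' ((algebraMap ℂ (Pol N)ᵐᵒᵖ).comp (starRingEnd ℂ))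
      (fun c x => Algebra.commutes (starRingEnd ℂ c) x)
  exact @polLift_u N (Pol N)ᵐᵒᵖ _ alg _ _ _ i j

theorem starHom_algebraMap {N : ℕ} (r : ℂ) :
    starHom N (algebraMap ℂ (Pol N) r) = MulOpposite.op (algebraMap ℂ (Pol N) (star r)) := by
  let alg : Algebra ℂ (Pol N)ᵐᵒᵖ :=
    RingHom.toAlgebra' ((algebraMap ℂ (Pol N)ᵐᵒᵖ).comp (starRingEnd ℂ))
      (fun c x => Algebra.commutes (starRingEnd ℂ c) x)
  exact (@polLift N (Pol N)ᵐᵒᵖ _ alg _ _ _).commutes' r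

instance (N : ℕ) : StarRing (Pol N) where
  star x := (starHom N x).unop
  star_involutive x := by
    refine pol_induction (motive := fun x => (starHom N (starHom N x).unop).unop = x)
      ?_ ?_ ?_ ?_ x
    · intro r
      simp [starHom_algebraMap]
    · intro i j
      simp [starHom_u]
    · intro x y hx hy
      simp [hx, hy]
    · intro x y hx hy
      simp [hx, hy]
  star_mul x y := by simp
  star_add x y := by simp

theorem star_def {N : ℕ} (x : Pol N) : star x = (starHom N x).unop := rfl

instance (N : ℕ) : StarModule ℂ (Pol N) where
  star_smul r x := by
    rw [Algebra.smul_def, star_mul, star_def (algebraMap ℂ (Pol N) r), starHom_algebraMap,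
      MulOpposite.unop_op, Algebra.smul_def, Algebra.commutes]

@[simp]
theorem star_u {N : ℕ} (i j : Fin N) : star (u i j) = u i j := by
  rw [star_def, starHom_u, MulOpposite.unop_op]


/-! ### Existence and uniqueness of the Haar state -/

/-- Words of length `k`. -/
def words (N : ℕ) : ℕ → Finset (List (Fin N))
  | 0 => {[]}
  | k + 1 => (Finset.univ ×ˢ words N k).map
      ⟨fun p : Fin N × List (Fin N) => p.1 :: p.2, fun p q h => by
        obtain ⟨h1, h2⟩ := List.cons.inj h; exact Prod.ext h1 h2⟩

theorem sum_words_zero {N : ℕ} {M : Type*} [AddCommMonoid M] (f : List (Fin N) → M) :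
    ∑ w ∈ words N 0, f w = f [] := by simp [words]

theorem sum_words_succ {N : ℕ} {M : Type*} [AddCommMonoid M] (k : ℕ) (f : List (Fin N) → M) :
    ∑ w ∈ words N (k + 1), f w = ∑ s, ∑ w ∈ words N k, f (s :: w) := by
  rw [words, Finset.sum_map, Finset.sum_product]
  rfl

theorem mem_words {N k : ℕ} {w : List (Fin N)} : w ∈ words N k ↔ w.length = k := by
  induction k generalizing w with
  | zero => simp [words]
  | succ k ih =>
    cases w with
    | nil => simp [words]
    | cons a w =>
      rw [words, Finset.mem_map, List.length_cons, Nat.succ_inj, ← ih]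
      constructor
      · rintro ⟨p, hp, h⟩
        obtain ⟨-, rfl⟩ := List.cons.inj h
        exact (Finset.mem_product.1 hp).2
      · intro h
        exact ⟨(a, w), Finset.mem_product.2 ⟨Finset.mem_univ _, h⟩, rfl⟩

theorem sum_words_add {N : ℕ} {M : Type*} [AddCommMonoid M] (i j : ℕ) (f : List (Fin N) → M) :
    ∑ w ∈ words N (i + j), f w = ∑ a ∈ words N i, ∑ b ∈ words N j, f (a ++ b) := by
  induction i generalizing f with
  | zero => simp [sum_words_zero]
  | succ i ih =>
    rw [Nat.succ_add, sum_words_succ, sum_words_succ]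
    refine Finset.sum_congr rfl fun s _ => ?_
    rw [ih]
    rfl

theorem sum_words_reverse {N : ℕ} {M : Type*} [AddCommMonoid M] (k : ℕ) (f : List (Fin N) → M) :
    ∑ w ∈ words N k, f w.reverse = ∑ w ∈ words N k, f w :=
  Finset.sum_nbij' List.reverse List.reverse
    (fun a ha => by rw [mem_words] at *; simpa using ha)
    (fun a ha => by rw [mem_words] at *; simpa using ha)
    (by simp) (by simp) (by simp)

/-- The coefficient `u_{a₁ b₁} ⋯ u_{aₖ bₖ}` (zero if the lengths differ). -/
def lcoef {N : ℕ} : List (Fin N) → List (Fin N) → Pol N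
  | [], [] => 1
  | a :: as, b :: bs => u a b * lcoef as bs
  | _, _ => 0

@[simp] theorem lcoef_nil {N : ℕ} : lcoef ([] : List (Fin N)) [] = 1 := rfl

@[simp] theorem lcoef_cons {N : ℕ} (a b : Fin N) (as bs : List (Fin N)) :
    lcoef (a :: as) (b :: bs) = u a b * lcoef as bs := rfl

theorem lcoef_of_ne {N : ℕ} {a b : List (Fin N)} (h : a.length ≠ b.length) : lcoef a b = 0 := by
  induction a generalizing b with
  | nil => cases b with
    | nil => simp at h
    | cons _ _ => rfl
  | cons x a ih => cases b with
    | nil => rfl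
    | cons y b => rw [lcoef_cons, ih (by simpa using h), mul_zero]

theorem lcoef_append {N : ℕ} {a b : List (Fin N)} (h : a.length = b.length)
    (c d : List (Fin N)) : lcoef (a ++ c) (b ++ d) = lcoef a b * lcoef c d := by
  induction a generalizing b with
  | nil => cases b with
    | nil => simp
    | cons _ _ => simp at h
  | cons x a ih => cases b with
    | nil => simp at h
    | cons y b =>
      rw [List.cons_append, List.cons_append, lcoef_cons, lcoef_cons, ih (by simpa using h),
        mul_assoc]

theorem star_lcoef {N : ℕ} (a b : List (Fin N)) :
    star (lcoef a b) = lcoef a.reverse b.reverse := by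
  induction a generalizing b with
  | nil => cases b with
    | nil => simp
    | cons _ _ => rw [lcoef_of_ne (by simp), lcoef_of_ne (by simp), star_zero]
  | cons x a ih => cases b with
    | nil => rw [lcoef_of_ne (by simp), lcoef_of_ne (by simp), star_zero]
    | cons y b =>
      by_cases h : a.length = b.length
      · rw [List.reverse_cons, List.reverse_cons, lcoef_append (by simpa using h), lcoef_cons,
          star_mul, ih, star_u, lcoef_cons, lcoef_nil, mul_one]
      · rw [lcoef_of_ne (by simpa using h), lcoef_of_ne (by simpa using h), star_zero]

theorem lcoef_unitary {N : ℕ} {k : ℕ} {a c : List (Fin N)} (ha : a ∈ words N k)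
    (hc : c ∈ words N k) :
    ∑ b ∈ words N k, lcoef a b * star (lcoef c b) = if a = c then 1 else 0 := by
  induction k generalizing a c with
  | zero =>
    rw [mem_words, List.length_eq_zero_iff] at ha hc
    subst ha hc
    simp [sum_words_zero]
  | succ k ih =>
    rw [mem_words] at ha hc
    obtain ⟨x, a, rfl⟩ := List.exists_cons_of_length_eq_add_one ha
    obtain ⟨y, c, rfl⟩ := List.exists_cons_of_length_eq_add_one hc
    have ha' : a ∈ words N k := mem_words.2 (by simpa using ha)
    have hc' : c ∈ words N k := mem_words.2 (by simpa using hc)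
    rw [sum_words_succ]
    simp only [lcoef_cons, star_mul, star_u]
    have : ∀ s : Fin N, ∑ w ∈ words N k, u x s * lcoef a w * (star (lcoef c w) * u y s)
        = (if a = c then u x s * u y s else 0) := by
      intro s
      simp only [mul_assoc]
      rw [← Finset.mul_sum]
      simp only [← mul_assoc]
      rw [← Finset.sum_mul, ih ha' hc']
      split_ifs <;> simp
    simp only [this]
    by_cases h : a = c
    · simp [h, u_row]
    · simp [h]

theorem lcoef_unitary' {N : ℕ} {k : ℕ} {a c : List (Fin N)} (ha : a ∈ words N k)
    (hc : c ∈ words N k) :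
    ∑ b ∈ words N k, star (lcoef b a) * lcoef b c = if a = c then 1 else 0 := by
  induction k generalizing a c with
  | zero =>
    rw [mem_words, List.length_eq_zero_iff] at ha hc
    subst ha hc
    simp [sum_words_zero]
  | succ k ih =>
    rw [mem_words] at ha hc
    obtain ⟨x, a, rfl⟩ := List.exists_cons_of_length_eq_add_one ha
    obtain ⟨y, c, rfl⟩ := List.exists_cons_of_length_eq_add_one hc
    have ha' : a ∈ words N k := mem_words.2 (by simpa using ha)
    have hc' : c ∈ words N k := mem_words.2 (by simpa using hc)
    rw [sum_words_succ, Finset.sum_comm]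
    simp only [lcoef_cons, star_mul, star_u]
    have : ∀ w : List (Fin N), ∑ s : Fin N, star (lcoef w a) * u s x * (u s y * lcoef w c)
        = (if x = y then star (lcoef w a) * lcoef w c else 0) := by
      intro w
      simp only [mul_assoc]
      rw [← Finset.mul_sum]
      simp only [← mul_assoc]
      rw [← Finset.sum_mul, u_col]
      split_ifs <;> simp
    simp only [this]
    by_cases h : x = y
    · simp [h, ih ha' hc']
    · simp [h]

theorem comul_lcoef {N : ℕ} {k : ℕ} {a c : List (Fin N)} (ha : a ∈ words N k)
    (hc : c ∈ words N k) :
    comul N (lcoef a c) = ∑ b ∈ words N k, lcoef a b ⊗ₜ[ℂ] lcoef b c := by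
  induction k generalizing a c with
  | zero =>
    rw [mem_words, List.length_eq_zero_iff] at ha hc
    subst ha hc
    simp [sum_words_zero, Algebra.TensorProduct.one_def]
  | succ k ih =>
    rw [mem_words] at ha hc
    obtain ⟨x, a, rfl⟩ := List.exists_cons_of_length_eq_add_one ha
    obtain ⟨y, c, rfl⟩ := List.exists_cons_of_length_eq_add_one hc
    rw [sum_words_succ, lcoef_cons, map_mul, comul_u, ih (mem_words.2 (by simpa using ha))
      (mem_words.2 (by simpa using hc)), Finset.sum_mul_sum]
    simp

/-- Linear functionals on `Pol N` are determined by the words. -/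
theorem span_lcoef (N : ℕ) (x : Pol N) :
    x ∈ Submodule.span ℂ {y : Pol N | ∃ k, ∃ a ∈ words N k, ∃ b ∈ words N k, y = lcoef a b} := by
  refine pol_induction ?_ ?_ ?_ ?_ x
  · intro r
    rw [Algebra.algebraMap_eq_smul_one]
    exact Submodule.smul_mem _ _ (Submodule.subset_span
      ⟨0, [], by simp [mem_words], [], by simp [mem_words], rfl⟩)
  · intro i j
    exact Submodule.subset_span ⟨1, [i], by simp [mem_words], [j], by simp [mem_words], by simp⟩
  · intro x y hx hy
    refine Submodule.span_induction ?_ (by simp) (fun p q _ _ hp hq => ?_)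
      (fun r p _ hp => ?_) hx
    · rintro p ⟨k, a, ha, b, hb, rfl⟩
      refine Submodule.span_induction ?_ (by simp) (fun p q _ _ hp hq => ?_)
        (fun r p _ hp => ?_) hy
      · rintro q ⟨l, c, hc, d, hd, rfl⟩
        rw [mem_words] at ha hb hc hd
        exact Submodule.subset_span ⟨k + l, a ++ c, mem_words.2 (by simp [ha, hc]), b ++ d,
          mem_words.2 (by simp [hb, hd]), (lcoef_append (ha.trans hb.symm) c d).symm⟩
      · rw [mul_add]; exact Submodule.add_mem _ hp hq
      · rw [mul_smul_comm]; exact Submodule.smul_mem _ _ hp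
    · rw [add_mul]; exact Submodule.add_mem _ hp hq
    · rw [smul_mul_assoc]; exact Submodule.smul_mem _ _ hp
  · intro x y hx hy
    exact Submodule.add_mem _ hx hy

/-- The vector `v` on words of length `k` is invariant under the `k`-th tensor power of `u`. -/
def IsFixed {N : ℕ} (k : ℕ) (v : List (Fin N) → ℂ) : Prop :=
  ∀ a ∈ words N k, ∑ b ∈ words N k, v b • lcoef a b = v a • (1 : Pol N)

theorem exists_fixed_kernel (N k : ℕ) : ∃ q : List (Fin N) → List (Fin N) → ℂ,
    (∀ c ∈ words N k, IsFixed k (fun b => q b c)) ∧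
    (∀ a ∈ words N k, ∀ b ∈ words N k, star (q a b) = q b a) ∧
    (∀ v, IsFixed k v → ∀ a ∈ words N k, ∑ b ∈ words N k, q a b * v b = v a) := by
  classical
  let F : Submodule ℂ (EuclideanSpace ℂ (words N k)) :=
    { carrier := {v | ∀ a : words N k, ∑ b, v b • lcoef a.1 b.1 = v a • (1 : Pol N)}
      add_mem' := by
        intro v w hv hw a
        simp only [PiLp.add_apply, add_smul, Finset.sum_add_distrib, hv a, hw a]
      zero_mem' := by intro a; simp
      smul_mem' := by
        intro r v hv a
        have := hv a
        simp only [PiLp.smul_apply, smul_eq_mul, mul_smul, ← Finset.smul_sum, this] }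
  let e : List (Fin N) → EuclideanSpace ℂ (words N k) := fun b =>
    if h : b ∈ words N k then EuclideanSpace.single ⟨b, h⟩ 1 else 0
  have he : ∀ (v : EuclideanSpace ℂ (words N k)) (a : List (Fin N)) (h : a ∈ words N k), inner ℂ (e a) v = v ⟨a, h⟩ := by
    intro v a h
    simp [e, h, EuclideanSpace.inner_single_left]
  refine ⟨fun a b => inner ℂ (e a) (F.starProjection (e b)), ?_, ?_, ?_⟩
  · intro c hc a ha
    have h1 : F.starProjection (e c) ∈ F := Submodule.starProjection_apply_mem F (e c)
    have h2 := h1 ⟨a, ha⟩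
    rw [← Finset.sum_coe_sort]
    simp only [he _ _ ha]
    rw [← h2]
    refine Finset.sum_congr rfl fun b _ => ?_
    rw [he _ _ b.2]
  · intro a _ b _
    change (starRingEnd ℂ) _ = _
    rw [inner_conj_symm, Submodule.inner_starProjection_left_eq_right]
  · intro v hv a ha
    let w : EuclideanSpace ℂ (words N k) := WithLp.toLp 2 fun b => v b.1
    have hw : w ∈ F := by
      intro a
      have := hv a.1 a.2
      rw [← Finset.sum_coe_sort] at this
      exact this
    have hws : w = ∑ b : words N k, v b.1 • e b.1 := by
      ext a
      simp [w, e, Finset.sum_apply, Pi.single_apply]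
    have h1 : F.starProjection w = w := Submodule.starProjection_eq_self_iff.2 hw
    have h2 : inner ℂ (e a) (F.starProjection w) = v a := by rw [h1, he _ _ ha]
    rw [← h2]
    conv_rhs => rw [hws]
    rw [map_sum, inner_sum, ← Finset.sum_coe_sort]
    refine Finset.sum_congr rfl fun b _ => ?_
    rw [map_smul, inner_smul_right, mul_comm]

/-- `q` is, in each degree, the matrix of the orthogonal projection onto the fixed vectors. -/
structure IsKernel {N : ℕ} (q : List (Fin N) → List (Fin N) → ℂ) : Prop where
  zero : ∀ a b, a.length ≠ b.length → q a b = 0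
  fixed : ∀ k, ∀ c ∈ words N k, IsFixed k (fun b => q b c)
  conj : ∀ a b, star (q a b) = q b a
  absorb : ∀ k v, IsFixed k v → ∀ a ∈ words N k, ∑ b ∈ words N k, q a b * v b = v a

theorem exists_isKernel (N : ℕ) : ∃ q : List (Fin N) → List (Fin N) → ℂ, IsKernel q := by
  choose q h1 h2 h3 using exists_fixed_kernel N
  have key : ∀ k, ∀ a ∈ words N k, ∀ b ∈ words N k,
      (if a.length = b.length then q a.length a b else 0) = q k a b := by
    intro k a ha b hb
    rw [mem_words] at ha hb
    rw [if_pos (ha.trans hb.symm), ha]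
  refine ⟨fun a b => if a.length = b.length then q a.length a b else 0, ?_, ?_, ?_, ?_⟩
  · intro a b h
    simp [h]
  · intro k c hc a ha
    simp only [key k a ha c hc]
    rw [← h1 k c hc a ha]
    exact Finset.sum_congr rfl fun b hb => by rw [key k b hb c hc]
  · intro a b
    by_cases h : a.length = b.length
    · simp only [h, if_true]
      exact h2 _ a (mem_words.2 h) b (mem_words.2 rfl)
    · simp [h, Ne.symm h]
  · intro k v hv a ha
    rw [← h3 k v hv a ha]
    exact Finset.sum_congr rfl fun b hb => by rw [key k a ha b hb]

namespace IsKernel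

variable {N : ℕ} {q : List (Fin N) → List (Fin N) → ℂ}

theorem nil (hq : IsKernel q) : q [] [] = 1 := by
  have := hq.absorb 0 (fun _ => 1) (by
    intro a ha
    rw [mem_words, List.length_eq_zero_iff] at ha
    simp [sum_words_zero, ha]) [] (by simp [mem_words])
  simpa [sum_words_zero] using this

theorem row (hq : IsKernel q) {k : ℕ} {a c : List (Fin N)} (ha : a ∈ words N k)
    (hc : c ∈ words N k) :
    ∑ b ∈ words N k, q a b • lcoef b c = q a c • (1 : Pol N) := by
  have h1 : ∀ b' ∈ words N k,
      ∑ b ∈ words N k, q a b • star (lcoef b' b) = q a b' • (1 : Pol N) := by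
    intro b' hb'
    have := congrArg star (hq.fixed k a ha b' hb')
    simpa [star_sum, hq.conj] using this
  calc ∑ b ∈ words N k, q a b • lcoef b c
      = ∑ b' ∈ words N k, (q a b' • (1 : Pol N)) * lcoef b' c := by simp
    _ = ∑ b' ∈ words N k, (∑ b ∈ words N k, q a b • star (lcoef b' b)) * lcoef b' c :=
        Finset.sum_congr rfl fun b' hb' => by rw [h1 b' hb']
    _ = ∑ b ∈ words N k, q a b • ∑ b' ∈ words N k, star (lcoef b' b) * lcoef b' c := by
        simp only [Finset.sum_mul, Finset.smul_sum, smul_mul_assoc]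
        rw [Finset.sum_comm]
    _ = ∑ b ∈ words N k, q a b • (if b = c then (1 : Pol N) else 0) :=
        Finset.sum_congr rfl fun b hb => by rw [lcoef_unitary' hb hc]
    _ = q a c • (1 : Pol N) := by
        simp [hc]

theorem rev (hq : IsKernel q) (a b : List (Fin N)) : star (q a.reverse b.reverse) = q a b := by
  by_cases hl : a.length = b.length
  swap
  · rw [hq.zero _ _ hl, hq.zero _ _ (by simpa using hl), star_zero]
  obtain ⟨k, hk⟩ : ∃ k, a.length = k := ⟨_, rfl⟩
  have ha : a ∈ words N k := mem_words.2 hk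
  have hb : b ∈ words N k := mem_words.2 (hl ▸ hk)
  have hrev : ∀ {c : List (Fin N)}, c ∈ words N k → c.reverse ∈ words N k := by
    intro c hc
    rw [mem_words] at *
    simpa using hc
  let q' : List (Fin N) → List (Fin N) → ℂ := fun a b => star (q a.reverse b.reverse)
  have hfix : ∀ c ∈ words N k, IsFixed k (fun b => q' b c) := by
    intro c hc a ha
    have := congrArg star (hq.fixed k c.reverse (hrev hc) a.reverse (hrev ha))
    simp only [star_sum, star_smul, star_lcoef, star_one, List.reverse_reverse] at this
    rw [← this, ← sum_words_reverse]
    simp [q']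
  have h1 : ∀ a ∈ words N k, ∀ c ∈ words N k, ∑ b ∈ words N k, q a b * q' b c = q' a c :=
    fun a ha c hc => hq.absorb k _ (hfix c hc) a ha
  have h2 : ∑ b' ∈ words N k, q' a b' * q b' b = q a b := by
    have := congrArg star (h1 a.reverse (hrev ha) b.reverse (hrev hb))
    simp only [star_sum, star_mul', q', star_star, List.reverse_reverse] at this
    rw [← this, ← sum_words_reverse]
    simp [q']
  have h3 : ∑ b' ∈ words N k, q' a b' * q b' b = q' a b := by
    have := congrArg star (h1 b hb a ha)
    simp only [star_sum, star_mul', hq.conj, q'] at this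
    have h4 : ∀ x y, star (q' x y) = q' y x := by
      intro x y
      simp only [q', hq.conj]
    simp only [q', ← hq.conj b.reverse a.reverse, star_star]
    rw [← this]
    refine Finset.sum_congr rfl fun c _ => ?_
    rw [mul_comm, ← hq.conj c.reverse a.reverse, star_star]
  rw [← h2, h3]

theorem sum_words_two {M : Type*} [AddCommMonoid M] (i j : ℕ) (f : List (Fin N) → M) :
    ∑ w ∈ words N (i + (j + 2)), f w
      = ∑ a ∈ words N i, ∑ s, ∑ t, ∑ b ∈ words N j, f (a ++ s :: t :: b) := by
  rw [sum_words_add]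
  simp only [sum_words_succ]

theorem contract (hq : IsKernel q) {a₁ a₂ b₁ b₂ : List (Fin N)} (r r' : Fin N)
    (h₁ : a₁.length = b₁.length) (h₂ : a₂.length = b₂.length) :
    ∑ s, q (a₁ ++ r :: r' :: a₂) (b₁ ++ s :: s :: b₂)
      = if r = r' then q (a₁ ++ a₂) (b₁ ++ b₂) else 0 := by
  obtain ⟨i, hi⟩ : ∃ i, a₁.length = i := ⟨_, rfl⟩
  obtain ⟨j, hj⟩ : ∃ j, a₂.length = j := ⟨_, rfl⟩
  have hb₁ : b₁.length = i := h₁ ▸ hi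
  have hb₂ : b₂.length = j := h₂ ▸ hj
  have mw : ∀ {k} {w : List (Fin N)}, w ∈ words N k → w.length = k := fun h => mem_words.1 h
  have hA : a₁ ++ r :: r' :: a₂ ∈ words N (i + (j + 2)) := by
    rw [mem_words]; simp [hi, hj]
  have hB : b₁ ++ b₂ ∈ words N (i + j) := by rw [mem_words]; simp [hb₁, hb₂]
  set A := a₁ ++ r :: r' :: a₂ with hAdef
  set B := b₁ ++ b₂ with hBdef
  -- the insertion of the cup vector into a column of `q`
  let v : List (Fin N) → ℂ := fun w =>
    match w.drop i with
    | s :: t :: c => if s = t then q (w.take i ++ c) B else 0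
    | _ => 0
  have hv : ∀ c₁ c₂ : List (Fin N), c₁.length = i → ∀ s t,
      v (c₁ ++ s :: t :: c₂) = if s = t then q (c₁ ++ c₂) B else 0 := by
    intro c₁ c₂ h s t
    simp only [v, List.drop_left' h, List.take_left' h]
  have hvfix : IsFixed (i + (j + 2)) v := by
    intro w hw
    have hw' := mw hw
    obtain ⟨c₁, s, t, c₂, rfl, hc₁⟩ : ∃ c₁ s t c₂, w = c₁ ++ s :: t :: c₂ ∧ c₁.length = i := by
      have hd : (w.drop i).length = j + 2 := by simp [hw']
      obtain ⟨s, w', hs⟩ := List.exists_cons_of_length_eq_add_one hd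
      rw [hs] at hd
      have hd' : w'.length = j + 1 := by simpa using hd
      obtain ⟨t, w'', ht⟩ := List.exists_cons_of_length_eq_add_one hd'
      refine ⟨w.take i, s, t, w'', ?_, by simp [hw']⟩
      rw [← ht, ← hs, List.take_append_drop]
    have hc₂ : c₂.length = j := by simp [hc₁] at hw'; omega
    rw [hv c₁ c₂ hc₁, sum_words_two]
    have step : ∀ d₁ ∈ words N i, ∑ x, ∑ y, ∑ d₂ ∈ words N j,
        v (d₁ ++ x :: y :: d₂) • lcoef (c₁ ++ s :: t :: c₂) (d₁ ++ x :: y :: d₂)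
        = if s = t then ∑ d₂ ∈ words N j, q (d₁ ++ d₂) B • lcoef (c₁ ++ c₂) (d₁ ++ d₂)
          else 0 := by
      intro d₁ hd₁
      have e1 : c₁.length = d₁.length := by rw [hc₁, mw hd₁]
      simp only [hv d₁ _ (mw hd₁), lcoef_append e1, lcoef_cons, ite_smul, zero_smul]
      have : ∀ x : Fin N, ∑ y, ∑ d₂ ∈ words N j, (if x = y then
          q (d₁ ++ d₂) B • (lcoef c₁ d₁ * (u s x * (u t y * lcoef c₂ d₂))) else 0)
          = ∑ d₂ ∈ words N j,
            q (d₁ ++ d₂) B • (lcoef c₁ d₁ * ((u s x * u t x) * lcoef c₂ d₂)) := by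
        intro x
        rw [Finset.sum_comm]
        simp [mul_assoc]
      simp only [this]
      rw [Finset.sum_comm]
      have : ∀ d₂, ∑ x, q (d₁ ++ d₂) B • (lcoef c₁ d₁ * ((u s x * u t x) * lcoef c₂ d₂))
          = q (d₁ ++ d₂) B • (lcoef c₁ d₁ * ((if s = t then 1 else 0) * lcoef c₂ d₂)) := by
        intro d₂
        rw [← Finset.smul_sum, ← Finset.mul_sum, ← Finset.sum_mul, u_row]
      simp only [this]
      split_ifs <;> simp
    rw [Finset.sum_congr rfl step]
    by_cases hst : s = t
    · simp only [hst, if_true]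
      rw [← sum_words_add i j (fun w => q w B • lcoef (c₁ ++ c₂) w)]
      exact hq.fixed (i + j) B hB (c₁ ++ c₂) (by rw [mem_words]; simp [hc₁, hc₂])
    · simp [hst]
  have E1 := hq.absorb _ v hvfix A hA
  rw [hv a₁ a₂ hi, sum_words_two] at E1
  -- contraction of a column of `q` by the cap
  let y : List (Fin N) → ℂ := fun c => ∑ s, q (c.take i ++ s :: s :: c.drop i) A
  have hy : ∀ c₁ c₂ : List (Fin N), c₁.length = i →
      y (c₁ ++ c₂) = ∑ s, q (c₁ ++ s :: s :: c₂) A := by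
    intro c₁ c₂ h
    simp only [y, List.drop_left' h, List.take_left' h]
  have hyfix : IsFixed (i + j) y := by
    intro w hw
    have hw' := mw hw
    obtain ⟨c₁, c₂, rfl, hc₁⟩ : ∃ c₁ c₂, w = c₁ ++ c₂ ∧ c₁.length = i :=
      ⟨w.take i, w.drop i, (List.take_append_drop _ _).symm, by simp [hw']⟩
    have hc₂ : c₂.length = j := by simp [hc₁] at hw'; omega
    rw [hy c₁ c₂ hc₁, Finset.sum_smul]
    have h1 : ∀ t : Fin N, q (c₁ ++ t :: t :: c₂) A • (1 : Pol N) = ∑ d₁ ∈ words N i, ∑ x, ∑ z,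
        ∑ d₂ ∈ words N j, q (d₁ ++ x :: z :: d₂) A •
          (lcoef c₁ d₁ * ((u t x * u t z) * lcoef c₂ d₂)) := by
      intro t
      rw [← hq.fixed _ A hA (c₁ ++ t :: t :: c₂) (by rw [mem_words]; simp [hc₁, hc₂]),
        sum_words_two]
      refine Finset.sum_congr rfl fun d₁ hd₁ => ?_
      have e1 : c₁.length = d₁.length := by rw [hc₁, mw hd₁]
      simp only [lcoef_append e1, lcoef_cons, mul_assoc]
    simp only [h1]
    rw [Finset.sum_comm, sum_words_add]
    refine Finset.sum_congr rfl fun d₁ hd₁ => ?_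
    have e1 : c₁.length = d₁.length := by rw [hc₁, mw hd₁]
    simp only [hy d₁ _ (mw hd₁), lcoef_append e1]
    rw [Finset.sum_comm]
    simp only [Finset.sum_smul]
    rw [Finset.sum_comm]
    refine Finset.sum_congr rfl fun x _ => ?_
    rw [Finset.sum_comm]
    have h2 : ∀ z : Fin N, ∑ t, ∑ d₂ ∈ words N j, q (d₁ ++ x :: z :: d₂) A •
          (lcoef c₁ d₁ * ((u t x * u t z) * lcoef c₂ d₂))
        = if x = z then ∑ d₂ ∈ words N j, q (d₁ ++ x :: z :: d₂) A •
          (lcoef c₁ d₁ * lcoef c₂ d₂) else 0 := by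
      intro z
      rw [Finset.sum_comm]
      have : ∀ d₂, ∑ t, q (d₁ ++ x :: z :: d₂) A •
          (lcoef c₁ d₁ * ((u t x * u t z) * lcoef c₂ d₂)) = q (d₁ ++ x :: z :: d₂) A •
          (lcoef c₁ d₁ * ((if x = z then 1 else 0) * lcoef c₂ d₂)) := by
        intro d₂
        rw [← Finset.smul_sum, ← Finset.mul_sum, ← Finset.sum_mul, u_col]
      simp only [this]
      split_ifs <;> simp
    simp only [h2]
    simp
  have E2 := congrArg star (hq.absorb _ y hyfix B hB)
  rw [hBdef, hy b₁ b₂ hb₁, sum_words_add] at E2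
  simp only [star_sum, hq.conj, star_mul'] at E2
  rw [← E2, ← E1]
  refine Finset.sum_congr rfl fun c₁ hc₁ => ?_
  simp only [hv c₁ _ (mw hc₁), mul_ite, mul_zero]
  have h3 : ∀ s : Fin N, ∑ t, ∑ c₂ ∈ words N j,
      (if s = t then q A (c₁ ++ s :: t :: c₂) * q (c₁ ++ c₂) B else 0)
      = ∑ c₂ ∈ words N j, q A (c₁ ++ s :: s :: c₂) * q (c₁ ++ c₂) B := by
    intro s
    rw [Finset.sum_comm]
    simp
  simp only [h3]
  rw [Finset.sum_comm]
  refine Finset.sum_congr rfl fun c₂ hc₂ => ?_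
  rw [hy c₁ c₂ (mw hc₁), star_sum, Finset.mul_sum]
  refine Finset.sum_congr rfl fun s _ => ?_
  rw [hq.conj, mul_comm]

end IsKernel

theorem basisFreeMonoid_eq {X : Type*} (w : FreeMonoid X) :
    FreeAlgebra.basisFreeMonoid ℂ X w = FreeMonoid.lift (FreeAlgebra.ι ℂ) w := by
  simp [FreeAlgebra.basisFreeMonoid, FreeAlgebra.equivMonoidAlgebraFreeMonoid]

theorem mk_monomial {N : ℕ} (w : List (Fin N × Fin N)) :
    polMk N (FreeMonoid.lift (FreeAlgebra.ι ℂ) (FreeMonoid.ofList w))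
      = lcoef (w.map Prod.fst) (w.map Prod.snd) := by
  induction w with
  | nil => simp
  | cons p w ih =>
    rw [FreeMonoid.ofList_cons, map_mul, map_mul, ih, FreeMonoid.lift_eval_of]
    rfl

theorem mk_eq_mk {N : ℕ} {x y : FreeAlgebra ℂ (Fin N × Fin N)} (h : polMk N x = polMk N y) :
    Relation.EqvGen (RingQuot.Rel (Rel N)) x y := by
  have h' : RingQuot.mkAlgHom ℂ (Rel N) x = RingQuot.mkAlgHom ℂ (Rel N) y := h
  simp only [RingQuot.mkAlgHom_def, RingQuot.mkRingHom_def] at h'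
  exact Quot.eqvGen_exact (congrArg RingQuot.toQuot h')

theorem IsKernel.exists_functional {N : ℕ} {q : List (Fin N) → List (Fin N) → ℂ}
    (hq : IsKernel q) :
    ∃ φ : Pol N →ₗ[ℂ] ℂ, ∀ a b, φ (lcoef a b) = q a b := by
  let m : FreeMonoid (Fin N × Fin N) →* FreeAlgebra ℂ (Fin N × Fin N) :=
    FreeMonoid.lift (FreeAlgebra.ι ℂ)
  let g : FreeAlgebra ℂ (Fin N × Fin N) →ₗ[ℂ] ℂ :=
    (FreeAlgebra.basisFreeMonoid ℂ (Fin N × Fin N)).constr ℂ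
      (fun w => q (w.toList.map Prod.fst) (w.toList.map Prod.snd))
  have hg : ∀ w : List (Fin N × Fin N), g (m (FreeMonoid.ofList w))
      = q (w.map Prod.fst) (w.map Prod.snd) := by
    intro w
    rw [← basisFreeMonoid_eq]
    simp [g]
  have ext_mono : ∀ f f' : FreeAlgebra ℂ (Fin N × Fin N) →ₗ[ℂ] ℂ,
      (∀ w, f (m (FreeMonoid.ofList w)) = f' (m (FreeMonoid.ofList w))) → f = f' := by
    intro f f' h
    refine (FreeAlgebra.basisFreeMonoid ℂ (Fin N × Fin N)).ext fun w => ?_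
    rw [basisFreeMonoid_eq]
    exact h w.toList
  have hgen : ∀ p : Fin N × Fin N, FreeAlgebra.ι ℂ p = m (FreeMonoid.ofList [p]) := by
    intro p
    simp [m]
  -- the relations are respected between monomials
  have hmono : ∀ x y, Rel N x y → ∀ c d : List (Fin N × Fin N),
      g (m (FreeMonoid.ofList c) * x * m (FreeMonoid.ofList d))
        = g (m (FreeMonoid.ofList c) * y * m (FreeMonoid.ofList d)) := by
    intro x y h c d
    have hsplit : ∀ p p' : Fin N × Fin N,
        m (FreeMonoid.ofList c) * (FreeAlgebra.ι ℂ p * FreeAlgebra.ι ℂ p') *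
          m (FreeMonoid.ofList d) = m (FreeMonoid.ofList (c ++ p :: p' :: d)) := by
      intro p p'
      rw [hgen, hgen, ← map_mul, ← map_mul, ← map_mul]
      exact congrArg (fun w => m (FreeMonoid.ofList w))
        (by simp : (c ++ ([p] ++ [p'])) ++ d = c ++ p :: p' :: d)
    have h0 : g (m (FreeMonoid.ofList c) * 1 * m (FreeMonoid.ofList d))
        = q (c.map Prod.fst ++ d.map Prod.fst) (c.map Prod.snd ++ d.map Prod.snd) := by
      rw [mul_one, ← map_mul, ← FreeMonoid.ofList_append, hg]
      simp
    cases h with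
    | row i j =>
      rw [Finset.mul_sum, Finset.sum_mul, map_sum]
      simp only [hsplit, hg, List.map_append, List.map_cons]
      rw [hq.contract i j (by simp) (by simp)]
      split_ifs
      · rw [h0]
      · simp
    | col i j =>
      rw [Finset.mul_sum, Finset.sum_mul, map_sum]
      simp only [hsplit, hg, List.map_append, List.map_cons]
      have := congrArg star (hq.contract (a₁ := c.map Prod.snd) (a₂ := d.map Prod.snd)
        (b₁ := c.map Prod.fst) (b₂ := d.map Prod.fst) i j (by simp) (by simp))
      simp only [star_sum, hq.conj] at this
      rw [this]
      split_ifs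
      · rw [h0, hq.conj]
      · simp
  have hall : ∀ x y, Rel N x y → ∀ c d, g (c * x * d) = g (c * y * d) := by
    intro x y h
    have h1 : ∀ c : List (Fin N × Fin N), ∀ d,
        g (m (FreeMonoid.ofList c) * x * d) = g (m (FreeMonoid.ofList c) * y * d) := by
      intro c d
      have := ext_mono (g ∘ₗ LinearMap.mulLeft ℂ (m (FreeMonoid.ofList c) * x))
        (g ∘ₗ LinearMap.mulLeft ℂ (m (FreeMonoid.ofList c) * y)) (fun w => hmono x y h c w)
      exact LinearMap.congr_fun this d
    intro c d
    have := ext_mono (g ∘ₗ LinearMap.mulRight ℂ (x * d)) (g ∘ₗ LinearMap.mulRight ℂ (y * d))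
      (fun w => by simpa [mul_assoc] using h1 w d)
    simpa [mul_assoc] using LinearMap.congr_fun this c
  have hrel : ∀ x y, RingQuot.Rel (Rel N) x y → ∀ c d, g (c * x * d) = g (c * y * d) := by
    intro x y h
    induction h with
    | of h => exact hall _ _ h
    | add_left _ ih =>
      intro c d
      simp only [mul_add, add_mul, map_add, ih c d]
    | @mul_left _ _ z _ ih =>
      intro c d
      have := ih c (z * d)
      simpa only [mul_assoc] using this
    | @mul_right z _ _ _ ih =>
      intro c d
      have := ih (c * z) d
      simpa only [mul_assoc] using this
  have heq : ∀ x y, Relation.EqvGen (RingQuot.Rel (Rel N)) x y → g x = g y := by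
    intro x y h
    induction h with
    | rel x y h => simpa using hrel x y h 1 1
    | refl => rfl
    | symm _ _ _ ih => exact ih.symm
    | trans _ _ _ _ _ ih ih' => exact ih.trans ih'
  have hsurj : Function.Surjective (polMk N).toLinearMap := polMk_surjective N
  have hker : LinearMap.ker (polMk N).toLinearMap ≤ LinearMap.ker g := by
    intro x hx
    rw [LinearMap.mem_ker] at hx ⊢
    rw [← map_zero g]
    exact heq x 0 (mk_eq_mk (by rw [map_zero]; exact hx))
  refine ⟨(LinearMap.ker (polMk N).toLinearMap).liftQ g hker ∘ₗ
    ((polMk N).toLinearMap.quotKerEquivOfSurjective hsurj).symm.toLinearMap, fun a b => ?_⟩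
  by_cases hl : a.length = b.length
  · have h1 : lcoef a b = (polMk N).toLinearMap (m (FreeMonoid.ofList (a.zip b))) := by
      rw [AlgHom.toLinearMap_apply, mk_monomial, List.map_fst_zip hl.le, List.map_snd_zip hl.ge]
    have h2 : ((polMk N).toLinearMap.quotKerEquivOfSurjective hsurj).symm (lcoef a b)
        = Submodule.Quotient.mk (m (FreeMonoid.ofList (a.zip b))) := by
      rw [LinearEquiv.symm_apply_eq, h1]
      rfl
    rw [LinearMap.comp_apply, LinearEquiv.coe_coe, h2, Submodule.liftQ_apply, hg,
      List.map_fst_zip hl.le, List.map_snd_zip hl.ge]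
  · rw [lcoef_of_ne hl, map_zero, hq.zero _ _ hl]

/-- A Hermitian matrix `K` with `K² = K Z` for some positive `Z` is positive. -/
theorem posSemidef_of_mul_self {n : Type*} [Fintype n] [DecidableEq n] {K Z : Matrix n n ℂ}
    (hK : K.IsHermitian) (hZ : Z.PosSemidef) (h : K * K = K * Z) : K.PosSemidef := by
  rw [hK.posSemidef_iff_eigenvalues_nonneg]
  intro i
  by_contra hneg
  change ¬ (0 ≤ hK.eigenvalues i) at hneg
  rw [not_le] at hneg
  set l := hK.eigenvalues i with hl
  set v : n → ℂ := (hK.eigenvectorBasis i).ofLp with hv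
  have hKv : K.mulVec v = (l : ℂ) • v := by
    have := hK.mulVec_eigenvectorBasis i
    rw [← hv, ← hl] at this
    rw [this]; rfl
  have hvK : Matrix.vecMul (star v) K = (l : ℂ) • star v := by
    have := congrArg star hKv
    rw [Matrix.star_mulVec, hK.eq] at this
    rw [this]
    simp
  have h1 : dotProduct (star v) ((K * K).mulVec v) = (l : ℂ) * ((l : ℂ) * dotProduct (star v) v) := by
    rw [← Matrix.mulVec_mulVec, hKv, Matrix.mulVec_smul, hKv, dotProduct_smul, dotProduct_smul]
    simp
  have h2 : dotProduct (star v) ((K * Z).mulVec v) = (l : ℂ) * dotProduct (star v) (Z.mulVec v) := by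
    rw [← Matrix.mulVec_mulVec, Matrix.dotProduct_mulVec, hvK, smul_dotProduct, smul_eq_mul]
  have hl0 : (l : ℂ) ≠ 0 := by exact_mod_cast hneg.ne
  have h3 : (l : ℂ) * dotProduct (star v) v = dotProduct (star v) (Z.mulVec v) := by
    rw [h] at h1
    exact mul_left_cancel₀ hl0 (h1.symm.trans h2)
  have h4 : 0 ≤ dotProduct (star v) (Z.mulVec v) := hZ.dotProduct_mulVec_nonneg v
  have h5 : dotProduct (star v) v = 1 := by
    have := (hK.eigenvectorBasis.orthonormal.1 i)
    have h6 : inner ℂ (hK.eigenvectorBasis i) (hK.eigenvectorBasis i) = (1 : ℂ) := by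
      rw [inner_self_eq_norm_sq_to_K, this]; simp
    rw [EuclideanSpace.inner_eq_star_dotProduct, dotProduct_comm] at h6
    exact h6
  rw [← h3, h5, mul_one] at h4
  have : (0 : ℝ) ≤ l := by exact_mod_cast h4
  linarith

/-- Positivity of an invariant functional on the coefficients of a finite unitary matrix. -/
theorem positive_of_invariant {ι A : Type*} [Fintype ι] [DecidableEq ι] [Ring A] [StarRing A]
    [Algebra ℂ A] (W : ι → ι → A) (φ : A →ₗ[ℂ] ℂ) (hφ : φ 1 = 1)
    (hW : ∀ a c, ∑ b, W a b * star (W c b) = if a = c then 1 else 0)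
    (hW' : ∀ a c, ∑ b, star (W b a) * W b c = if a = c then 1 else 0)
    (f : ι → ι → ι → ι → ℂ) (hf : ∀ a b c d, f a b c d = φ (star (W a b) * W c d))
    (H1 : ∀ a b c d, star (f a b c d) = f c d a b)
    (H2 : ∀ a b c d, star (f a b c d) = f b a d c)
    (I : ∀ a c s t, ∑ b, ∑ d, f a b c d • (star (W b s) * W d t) = f a s c t • (1 : A))
    (y : ι × ι → ℂ) :
    0 ≤ ∑ p : ι × ι, ∑ r : ι × ι, star (y p) * f p.1 p.2 r.1 r.2 * y r := by
  have comm : ∀ a c b' t, ∑ d, f a b' c d • W d t = ∑ s, f a s c t • W b' s := by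
    intro a c b' t
    have h1 : ∀ s, W b' s * ∑ b, ∑ d, f a b c d • (star (W b s) * W d t) = f a s c t • W b' s := by
      intro s; rw [I]; simp
    rw [← Finset.sum_congr rfl fun s _ => h1 s]
    simp only [Finset.mul_sum, mul_smul_comm]
    rw [Finset.sum_comm]
    have h2 : ∀ b, ∑ s, ∑ d, f a b c d • (W b' s * (star (W b s) * W d t))
        = if b' = b then ∑ d, f a b c d • W d t else 0 := by
      intro b
      rw [Finset.sum_comm]
      have : ∀ d, ∑ s, f a b c d • (W b' s * (star (W b s) * W d t))
          = f a b c d • ((if b' = b then 1 else 0) * W d t) := by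
        intro d
        rw [← Finset.smul_sum, ← hW b' b, Finset.sum_mul]
        simp only [mul_assoc]
      simp only [this]
      split_ifs <;> simp
    simp [h2]
  have E2 : ∀ p e a b c g, ∑ r, f p c e r * f a b r g = ∑ d, f a b c d * f p d e g := by
    intro p e a b c g
    have h := congrArg (fun x => φ (star (W a b) * x)) (comm p e c g)
    simp only [Finset.mul_sum, mul_smul_comm, map_sum, map_smul, smul_eq_mul, ← hf] at h
    rw [h]
    exact Finset.sum_congr rfl fun d _ => mul_comm _ _
  have idem : ∀ p e b d, ∑ a, ∑ c, f p a e c * f a b c d = f p b e d := by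
    intro p e b d
    have h : ∀ a, ∑ c, f p a e c * f a b c d
        = ∑ s, f p s e d * φ (star (W a b) * W a s) := by
      intro a
      have h := congrArg (fun x => φ (star (W a b) * x)) (comm p e a d)
      simp only [Finset.mul_sum, mul_smul_comm, map_sum, map_smul, smul_eq_mul] at h
      rw [← h]
      simp only [hf]
    simp only [h]
    rw [Finset.sum_comm]
    have h' : ∀ s, ∑ a, f p s e d * φ (star (W a b) * W a s)
        = if b = s then f p s e d else 0 := by
      intro s
      rw [← Finset.mul_sum, ← map_sum, hW']
      split_ifs <;> simp [hφ]
    simp [h']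
  let K : Matrix (ι × ι) (ι × ι) ℂ := fun p r => f p.1 p.2 r.1 r.2
  let B : Matrix ((ι × ι × ι) × ι) (ι × ι) ℂ := fun x r =>
    if x.2 = r.2 then f x.1.1 x.1.2.1 r.1 x.1.2.2 else 0
  have hK : K.IsHermitian := by
    ext p r
    exact H1 _ _ _ _
  have hBB : ∀ r e, (Matrix.conjTranspose B * B) r e
      = if r.2 = e.2 then ∑ c, f c c e.1 r.1 else 0 := by
    intro r e
    rw [Matrix.mul_apply, Fintype.sum_prod_type, Fintype.sum_prod_type]
    simp only [Matrix.conjTranspose_apply]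
    simp only [B]
    by_cases h : r.2 = e.2
    · simp only [h, if_true]
      refine Finset.sum_congr rfl fun c _ => ?_
      rw [← idem, Fintype.sum_prod_type]
      refine Finset.sum_congr rfl fun a _ => Finset.sum_congr rfl fun b _ => ?_
      rw [Finset.sum_eq_single e.2 (fun x _ hx => by simp [hx]) (by simp)]
      simp only [if_true, H2]
      exact mul_comm _ _
    · rw [if_neg h]
      refine Finset.sum_eq_zero fun c _ => Finset.sum_eq_zero fun a _ =>
        Finset.sum_eq_zero fun x _ => ?_
      by_cases h1 : x = r.2
      · rw [if_neg (fun h2 => h (h1.symm.trans h2)), mul_zero]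
      · rw [if_neg h1, star_zero, zero_mul]
  have hKK : K * K = K * (Matrix.conjTranspose B * B) := by
    ext p e
    rw [Matrix.mul_apply, Matrix.mul_apply, Fintype.sum_prod_type, Fintype.sum_prod_type]
    simp only [hBB, K]
    calc ∑ c, ∑ d, f p.1 p.2 c d * f c d e.1 e.2
        = ∑ c, ∑ r, f c c e.1 r * f p.1 p.2 r e.2 :=
          Finset.sum_congr rfl fun c _ => (E2 c e.1 p.1 p.2 c e.2).symm
      _ = ∑ r, ∑ c, f c c e.1 r * f p.1 p.2 r e.2 := Finset.sum_comm
      _ = _ := by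
          refine Finset.sum_congr rfl fun r _ => ?_
          simp [Finset.mul_sum, mul_comm]
  have hpos := posSemidef_of_mul_self hK (Matrix.posSemidef_conjTranspose_mul_self B) hKK
  have := hpos.dotProduct_mulVec_nonneg y
  simpa [dotProduct, Matrix.mulVec, Finset.mul_sum, K, mul_assoc] using this

/-- A Haar state: a positive unital functional `φ` which is invariant on both sides,
`(φ ⊗ id) Δ = φ(·) 1 = (id ⊗ φ) Δ`. -/
structure HaarState (N : ℕ) where
  /-- The underlying linear functional. -/
  toFun : Pol N →ₗ[ℂ] ℂ
  map_one : toFun 1 = 1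
  nonneg : ∀ x, 0 ≤ toFun (star x * x)
  left_inv : ∀ x, TensorProduct.lid ℂ (Pol N) (toFun.rTensor (Pol N) (comul N x)) = toFun x • 1
  right_inv : ∀ x, TensorProduct.rid ℂ (Pol N) (toFun.lTensor (Pol N) (comul N x)) = toFun x • 1

theorem HaarState.nonempty (N : ℕ) : Nonempty (HaarState N) := by
  classical
  obtain ⟨q, hq⟩ := exists_isKernel N
  obtain ⟨φ, hφ⟩ := hq.exists_functional
  have hone : φ 1 = 1 := by
    have := hφ [] []
    rwa [lcoef_nil, hq.nil] at this
  refine ⟨⟨φ, hone, ?_, ?_, ?_⟩⟩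
  · intro x
    -- `x` is a combination of coefficients of a finite direct sum of tensor powers of `u`
    obtain ⟨m, Y, hx⟩ : ∃ (m : ℕ) (Y : List (Fin N) → List (Fin N) → ℂ), x = ∑ k ∈ Finset.range m,
        ∑ a ∈ words N k, ∑ b ∈ words N k, Y a b • lcoef a b := by
      refine Submodule.span_induction (p := fun x _ => ∃ (m : ℕ)
        (Y : List (Fin N) → List (Fin N) → ℂ), x = ∑ k ∈ Finset.range m,
        ∑ a ∈ words N k, ∑ b ∈ words N k, Y a b • lcoef a b) ?_ ?_ ?_ ?_ (span_lcoef N x)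
      · rintro y ⟨k, a, ha, b, hb, rfl⟩
        refine ⟨k + 1, fun a' b' => if a' = a then (if b' = b then 1 else 0) else 0, ?_⟩
        rw [Finset.sum_eq_single k]
        · simp [ha, hb]
        · intro l _ hl
          refine Finset.sum_eq_zero fun c hc => Finset.sum_eq_zero fun d hd => ?_
          rw [mem_words] at ha hc
          have hca : c ≠ a := fun h => hl (by rw [← ha, ← hc, h])
          simp [hca]
        · simp
      · exact ⟨0, 0, by simp⟩
      · rintro y z _ _ ⟨m, Y, rfl⟩ ⟨n, Z, rfl⟩
        refine ⟨max m n, fun a b => (if a.length < m then Y a b else 0)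
          + (if a.length < n then Z a b else 0), ?_⟩
        have aux : ∀ (m : ℕ) (Y : List (Fin N) → List (Fin N) → ℂ) (M : ℕ), m ≤ M →
            ∑ k ∈ Finset.range m, ∑ a ∈ words N k, ∑ b ∈ words N k, Y a b • lcoef a b
            = ∑ k ∈ Finset.range M, ∑ a ∈ words N k, ∑ b ∈ words N k,
              (if a.length < m then Y a b else 0) • lcoef a b := by
          intro m Y M hM
          rw [← Finset.sum_subset (Finset.range_mono hM)]
          · refine Finset.sum_congr rfl fun k hk => Finset.sum_congr rfl fun a ha => ?_
            rw [mem_words] at ha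
            simp [ha, Finset.mem_range.1 hk]
          · intro k _ hk
            refine Finset.sum_eq_zero fun a ha => ?_
            rw [mem_words] at ha
            rw [Finset.mem_range] at hk
            simp [ha, hk]
        rw [aux m Y _ (le_max_left m n), aux n Z _ (le_max_right m n)]
        simp only [add_smul, Finset.sum_add_distrib]
      · rintro r y _ ⟨m, Y, rfl⟩
        exact ⟨m, fun a b => r * Y a b, by simp only [Finset.smul_sum, mul_smul]⟩
    let T : Finset (List (Fin N)) := (Finset.range m).biUnion (words N)
    have hT : ∀ {a}, a ∈ T ↔ a.length < m := by
      intro a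
      simp [T, mem_words]
    have sumT : ∀ {M : Type} [AddCommMonoid M] (k : ℕ) (_ : k < m) (g : List (Fin N) → M),
        (∀ b, b.length ≠ k → g b = 0) → ∑ b : T, g b.1 = ∑ b ∈ words N k, g b := by
      intro M _ k hk g hg
      rw [Finset.sum_coe_sort T g, ← Finset.sum_subset (s₁ := words N k)]
      · intro b hb
        rw [mem_words] at hb
        exact hT.2 (hb ▸ hk)
      · intro b _ hb
        exact hg b (fun h => hb (mem_words.2 h))
    let W : T → T → Pol N := fun a b => lcoef a.1 b.1
    have hW : ∀ a c : T, ∑ b, W a b * star (W c b) = if a = c then 1 else 0 := by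
      intro a c
      have h0 := sumT a.1.length (hT.1 a.2) (fun b => lcoef a.1 b * star (lcoef c.1 b))
        (fun b hb => by rw [lcoef_of_ne (Ne.symm hb), zero_mul])
      refine h0.trans ?_
      by_cases hl : c.1.length = a.1.length
      · rw [lcoef_unitary (mem_words.2 rfl) (mem_words.2 hl)]
        exact if_congr Subtype.ext_iff.symm rfl rfl
      · rw [if_neg (fun h => hl (by rw [h]))]
        refine Finset.sum_eq_zero fun b hb => ?_
        rw [mem_words] at hb
        rw [lcoef_of_ne (a := c.1) (b := b) (fun h => hl (h.trans hb)), star_zero, mul_zero]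
    have hW' : ∀ a c : T, ∑ b, star (W b a) * W b c = if a = c then 1 else 0 := by
      intro a c
      have h0 := sumT a.1.length (hT.1 a.2) (fun b => star (lcoef b a.1) * lcoef b c.1)
        (fun b hb => by rw [lcoef_of_ne hb, star_zero, zero_mul])
      refine h0.trans ?_
      by_cases hl : c.1.length = a.1.length
      · rw [lcoef_unitary' (mem_words.2 rfl) (mem_words.2 hl)]
        exact if_congr Subtype.ext_iff.symm rfl rfl
      · rw [if_neg (fun h => hl (by rw [h]))]
        refine Finset.sum_eq_zero fun b hb => ?_
        rw [mem_words] at hb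
        rw [lcoef_of_ne (a := b) (b := c.1) (fun h => hl (h.symm.trans hb)), mul_zero]
    have hprod : ∀ a b c d : List (Fin N), a.length = b.length →
        star (lcoef a b) * lcoef c d = lcoef (a.reverse ++ c) (b.reverse ++ d) := by
      intro a b c d h
      rw [star_lcoef, lcoef_append (by simpa using h)]
    let f : T → T → T → T → ℂ := fun a b c d => φ (star (W a b) * W c d)
    have hf0 : ∀ a b c d : T, a.1.length ≠ b.1.length → f a b c d = 0 := by
      intro a b c d h
      simp [f, W, lcoef_of_ne h]
    have hf0' : ∀ a b c d : T, c.1.length ≠ d.1.length → f a b c d = 0 := by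
      intro a b c d h
      simp [f, W, lcoef_of_ne h]
    have hfq : ∀ a b c d : T, a.1.length = b.1.length →
        f a b c d = q (a.1.reverse ++ c.1) (b.1.reverse ++ d.1) := by
      intro a b c d h
      simp only [f, W]
      rw [hprod _ _ _ _ h, hφ]
    have key := positive_of_invariant W φ hone hW hW' f (fun _ _ _ _ => rfl) ?_ ?_ ?_
      (fun p => Y p.1.1 p.2.1)
    · have hx' : x = ∑ p : T × T, Y p.1.1 p.2.1 • W p.1 p.2 := by
        rw [hx, Fintype.sum_prod_type, Finset.sum_coe_sort T
          (fun a => ∑ b : T, Y a b.1 • lcoef a b.1)]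
        rw [Finset.sum_biUnion]
        · refine Finset.sum_congr rfl fun k hk => Finset.sum_congr rfl fun a ha => ?_
          rw [mem_words] at ha
          exact (sumT k (Finset.mem_range.1 hk) (fun b => Y a b • lcoef a b) (fun b hb => by
            rw [lcoef_of_ne (by rw [ha]; exact Ne.symm hb), smul_zero])).symm
        · intro k _ l _ hkl
          rw [Function.onFun, Finset.disjoint_left]
          intro a ha hb
          rw [mem_words] at ha hb
          exact hkl (ha.symm.trans hb)
      have : φ (star x * x) = ∑ p : T × T, ∑ r : T × T,
          star (Y p.1.1 p.2.1) * f p.1 p.2 r.1 r.2 * Y r.1.1 r.2.1 := by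
        rw [hx']
        simp only [star_sum, star_smul, Finset.sum_mul_sum, map_sum, smul_mul_smul_comm, map_smul,
          smul_eq_mul, f]
        refine Finset.sum_congr rfl fun p _ => Finset.sum_congr rfl fun r _ => ?_
        ring
      rw [this]
      exact key
    · intro a b c d
      by_cases h : a.1.length = b.1.length
      · by_cases h' : c.1.length = d.1.length
        · rw [hfq _ _ _ _ h, hfq _ _ _ _ h', ← hq.rev (c.1.reverse ++ a.1)]
          simp
        · rw [hf0 _ _ _ _ h', hf0' _ _ _ _ h', star_zero]
      · rw [hf0 _ _ _ _ h, hf0' _ _ _ _ h, star_zero]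
    · intro a b c d
      by_cases h : a.1.length = b.1.length
      · rw [hfq _ _ _ _ h, hfq _ _ _ _ h.symm, hq.conj]
      · rw [hf0 _ _ _ _ h, hf0 _ _ _ _ (Ne.symm h), star_zero]
    · intro a c s t
      have h0 : ∀ b d : T, f a b c d • (star (W b s) * W d t)
          = (fun b' => (fun d' : List (Fin N) => φ (star (lcoef a.1 b') * lcoef c.1 d') •
            (star (lcoef b' s.1) * lcoef d' t.1)) d.1) b.1 := fun _ _ => rfl
      have h1 : ∀ b : T, ∑ d, f a b c d • (star (W b s) * W d t)
          = ∑ d ∈ words N c.1.length, φ (star (lcoef a.1 b.1) * lcoef c.1 d) •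
            (star (lcoef b.1 s.1) * lcoef d t.1) := by
        intro b
        exact sumT c.1.length (hT.1 c.2) (fun d' : List (Fin N) =>
          φ (star (lcoef a.1 b.1) * lcoef c.1 d') • (star (lcoef b.1 s.1) * lcoef d' t.1))
          (fun d hd => by
            rw [lcoef_of_ne (a := c.1) (b := d) (Ne.symm hd), mul_zero, map_zero, zero_smul])
      simp only [h1]
      rw [sumT a.1.length (hT.1 a.2) (fun b' => ∑ d ∈ words N c.1.length,
        φ (star (lcoef a.1 b') * lcoef c.1 d) • (star (lcoef b' s.1) * lcoef d t.1))
        (fun b hb => by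
          refine Finset.sum_eq_zero fun d _ => ?_
          rw [lcoef_of_ne (a := a.1) (b := b) (Ne.symm hb), star_zero, zero_mul, map_zero,
            zero_smul])]
      by_cases hs : a.1.length = s.1.length
      swap
      · rw [hf0 _ _ _ _ hs, zero_smul]
        refine Finset.sum_eq_zero fun b hb => Finset.sum_eq_zero fun d _ => ?_
        rw [mem_words] at hb
        rw [lcoef_of_ne (a := b) (b := s.1) (fun h => hs (hb.symm.trans h)), star_zero, zero_mul,
          smul_zero]
      by_cases ht : c.1.length = t.1.length
      swap
      · rw [hf0' _ _ _ _ ht, zero_smul]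
        refine Finset.sum_eq_zero fun b _ => Finset.sum_eq_zero fun d hd => ?_
        rw [mem_words] at hd
        rw [lcoef_of_ne (a := d) (b := t.1) (fun h => ht (hd.symm.trans h)), mul_zero, smul_zero]
      rw [hfq _ _ _ _ hs, ← hq.row (k := a.1.length + c.1.length)
        (mem_words.2 (by simp)) (mem_words.2 (by simp [hs, ht])), sum_words_add,
        ← sum_words_reverse]
      refine Finset.sum_congr rfl fun b hb => Finset.sum_congr rfl fun d hd => ?_
      rw [mem_words] at hb hd
      have hb' : a.1.length = b.reverse.length := by simp [hb]
      have hbs : b.reverse.length = s.1.length := hb'.symm.trans hs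
      rw [hprod _ _ _ _ hb', hφ, hprod _ _ _ _ hbs, List.reverse_reverse]
  · intro x
    have h : (TensorProduct.lid ℂ (Pol N)).toLinearMap ∘ₗ φ.rTensor (Pol N) ∘ₗ
        (comul N).toLinearMap = LinearMap.smulRight φ 1 := by
      refine LinearMap.ext_on_range (v := fun p : List (Fin N) × List (Fin N) => lcoef p.1 p.2)
        ?_ ?_
      · rw [eq_top_iff]
        rintro x -
        refine Submodule.span_mono ?_ (span_lcoef N x)
        rintro y ⟨k, a, _, b, _, rfl⟩
        exact ⟨(a, b), rfl⟩
      · rintro ⟨a, c⟩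
        by_cases hl : c.length = a.length
        · have := hq.row (mem_words.2 rfl) (mem_words.2 hl)
          simp [comul_lcoef (mem_words.2 rfl) (mem_words.2 hl), map_sum, hφ, this]
        · simp [lcoef_of_ne (Ne.symm hl)]
    exact LinearMap.congr_fun h x
  · intro x
    have h : (TensorProduct.rid ℂ (Pol N)).toLinearMap ∘ₗ φ.lTensor (Pol N) ∘ₗ
        (comul N).toLinearMap = LinearMap.smulRight φ 1 := by
      refine LinearMap.ext_on_range (v := fun p : List (Fin N) × List (Fin N) => lcoef p.1 p.2)
        ?_ ?_
      · rw [eq_top_iff]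
        rintro x -
        refine Submodule.span_mono ?_ (span_lcoef N x)
        rintro y ⟨k, a, _, b, _, rfl⟩
        exact ⟨(a, b), rfl⟩
      · rintro ⟨a, c⟩
        by_cases hl : c.length = a.length
        · have := hq.fixed _ c (mem_words.2 hl) a (mem_words.2 rfl)
          simp [comul_lcoef (mem_words.2 rfl) (mem_words.2 hl), map_sum, hφ, this]
        · simp [lcoef_of_ne (Ne.symm hl)]
    exact LinearMap.congr_fun h x

theorem HaarState.unique {N : ℕ} (φ ψ : HaarState N) : φ.toFun = ψ.toFun := by
  ext x
  have key : ∀ z : Pol N ⊗[ℂ] Pol N,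
      ψ.toFun (TensorProduct.lid ℂ (Pol N) (φ.toFun.rTensor (Pol N) z))
        = φ.toFun (TensorProduct.rid ℂ (Pol N) (ψ.toFun.lTensor (Pol N) z)) := by
    intro z
    induction z using TensorProduct.induction_on with
    | zero => simp
    | tmul a b => simp [mul_comm]
    | add a b ha hb => simp only [map_add, ha, hb]
  have := key (comul N x)
  rw [φ.left_inv, ψ.right_inv, map_smul, map_smul, φ.map_one, ψ.map_one] at this
  simpa using this

/-- The Haar state of the orthogonal free quantum group. -/
def haar (N : ℕ) : HaarState N := Classical.choice (HaarState.nonempty N)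

/-! ### The Hilbert space `H = ℓ²(𝔽O_N)` of the GNS representation -/

theorem HaarState.conj_symm {N : ℕ} (φ : HaarState N) (x y : Pol N) :
    star (φ.toFun (star y * x)) = φ.toFun (star x * y) := by
  have real : ∀ z, (φ.toFun (star z * z)).im = 0 := fun z => (Complex.nonneg_iff.1 (φ.nonneg z)).2.symm
  have h1 := real (x + y)
  have h2 := real (x + Complex.I • y)
  have hx := real x
  have hy := real y
  simp only [star_add, star_smul, add_mul, mul_add, smul_mul_assoc, mul_smul_comm, map_add,
    map_smul, smul_eq_mul, Complex.add_im, Complex.mul_im, Complex.mul_re, Complex.star_def,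
    Complex.conj_re, Complex.conj_im, Complex.I_re, Complex.I_im] at h1 h2
  apply Complex.ext
  · simp only [Complex.star_def, Complex.conj_re]
    linarith
  · simp only [Complex.star_def, Complex.conj_im]
    linarith

/-- A copy of `Pol N` carrying the semi-inner product `(x | y) = h (x* y)` of the Haar state. -/
def PreL2 (N : ℕ) : Type := Pol N

instance (N : ℕ) : AddCommGroup (PreL2 N) := inferInstanceAs (AddCommGroup (Pol N))

instance (N : ℕ) : Module ℂ (PreL2 N) := inferInstanceAs (Module ℂ (Pol N))

/-- The identity map from `Pol N` to its copy `PreL2 N`. -/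
def toPreL2 (N : ℕ) : Pol N ≃ₗ[ℂ] PreL2 N := LinearEquiv.refl ℂ (Pol N)

/-- The semi-inner product `(x | y) = h (x* y)`. -/
abbrev preL2Core (N : ℕ) : PreInnerProductSpace.Core ℂ (PreL2 N) where
  inner x y := (haar N).toFun (star ((toPreL2 N).symm x) * (toPreL2 N).symm y)
  conj_inner_symm x y := (haar N).conj_symm _ _
  re_inner_nonneg x := (Complex.nonneg_iff.1 ((haar N).nonneg _)).1
  add_left x y z := by rw [map_add, star_add, add_mul, map_add]
  smul_left x y r := by
    rw [map_smul, star_smul, smul_mul_assoc, map_smul, smul_eq_mul]; rfl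

instance (N : ℕ) : SeminormedAddCommGroup (PreL2 N) :=
  InnerProductSpace.Core.toSeminormedAddCommGroup (c := preL2Core N)

instance (N : ℕ) : InnerProductSpace ℂ (PreL2 N) := InnerProductSpace.ofCore (preL2Core N)

/-- The Hilbert space of the GNS representation of the Haar state. -/
abbrev L2 (N : ℕ) : Type := UniformSpace.Completion (PreL2 N)

/-- The canonical map `Pol N → L2 N`. -/
def toL2 (N : ℕ) : Pol N →ₗ[ℂ] L2 N :=
  (UniformSpace.Completion.toComplL (𝕜 := ℂ) (E := PreL2 N)).toLinearMap ∘ₗ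
    (toPreL2 N).toLinearMap

theorem inner_toL2 {N : ℕ} (x y : Pol N) :
    inner ℂ (toL2 N x) (toL2 N y) = (haar N).toFun (star x * y) :=
  UniformSpace.Completion.inner_coe (toPreL2 N x) (toPreL2 N y)

/-! ### Irreducible corepresentations -/

/-- Indices of the canonical basis `e_{a₁} ⊗ ⋯ ⊗ e_{aₖ}` of `H₁^{⊗ k}`, where `H₁ = ℂ^N`. -/
abbrev Word (N k : ℕ) : Type := Fin k → Fin N

/-- `B(H₁^{⊗ k})`, in the canonical basis. -/
abbrev Mat (N k : ℕ) : Type := Matrix (Word N k) (Word N k) ℂ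

/-- `H_k ⊆ H₁^{⊗ k}`: the vectors killed by all the maps `id ⊗ t* ⊗ id` contracting two
neighbouring legs, where `t = ∑ s, e_s ⊗ e_s`. -/
def Hsub (N k : ℕ) : Submodule ℂ (EuclideanSpace ℂ (Word N k)) where
  carrier := {v | ∀ i j : Fin k, (j : ℕ) = i + 1 → ∀ c : Word N k,
    ∑ s, v (Function.update (Function.update c i s) j s) = 0}
  add_mem' := by
    intro v w hv hw i j hij c
    simp only [PiLp.add_apply, Finset.sum_add_distrib, hv i j hij c, hw i j hij c, add_zero]
  zero_mem' := by
    intro i j _ c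
    simp
  smul_mem' := by
    intro r v hv i j hij c
    simp only [PiLp.smul_apply, ← Finset.smul_sum, hv i j hij c, smul_zero]

/-- The dimension `d_k = dim H_k`. -/
def qdim (N k : ℕ) : ℕ := Module.finrank ℂ (Hsub N k)

/-- The Jones-Wenzl projection `P_k`: the orthogonal projection of `H₁^{⊗ k}` onto `H_k`. -/
def jw (N k : ℕ) : Mat N k :=
  fun a b => (Hsub N k).starProjection (EuclideanSpace.single b 1) a

/-- `B(H_k) ⊆ B(H₁^{⊗ k})`, as the corner cut out by `P_k`. -/
def endH (N k : ℕ) : Submodule ℂ (Mat N k) where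
  carrier := {X | jw N k * X * jw N k = X}
  add_mem' := by
    intro X Y hX hY
    simp only [Set.mem_ofPred_eq, mul_add, add_mul] at *
    rw [hX, hY]
  zero_mem' := by simp
  smul_mem' := by
    intro r X hX
    simp only [Set.mem_ofPred_eq] at *
    rw [mul_smul_comm, smul_mul_assoc, hX]

/-- `u_k(X) = (id ⊗ Tr)(u^{⊗ k} (1 ⊗ X)) = ∑ X_{ba} u_{a₁b₁} ⋯ u_{aₖbₖ}`; for `X ∈ B(H_k)` this is
the coefficient `u_k(X)` of the irreducible corepresentation `u_k` on `H_k`. -/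
def coeff (N k : ℕ) : Mat N k →ₗ[ℂ] Pol N where
  toFun X := ∑ a, ∑ b, X b a • (List.ofFn fun i => u (a i) (b i)).prod
  map_add' X Y := by simp only [Matrix.add_apply, add_smul, Finset.sum_add_distrib]
  map_smul' r X := by
    simp only [Matrix.smul_apply, smul_eq_mul, mul_smul, Finset.smul_sum, RingHom.id_apply]

/-- The irreducible character `χ_k = u_k(id)`. -/
def chi (N k : ℕ) : Pol N := coeff N k (jw N k)

/-- The subspace `p_n H = u_n(B(H_n))` of `H`. -/
def coeffSpace (N n : ℕ) : Submodule ℂ (L2 N) := (endH N n).map (toL2 N ∘ₗ coeff N n)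

instance (N n : ℕ) : FiniteDimensional ℂ (coeffSpace N n) := by
  unfold coeffSpace; infer_instance

/-- The orthogonal projection `p_n` of `H` onto `u_n(B(H_n))`. -/
def proj (N n : ℕ) : L2 N →L[ℂ] L2 N := (coeffSpace N n).starProjection

/-! ### The spaces `B(H_k)°°`, the rotation, and the Gram matrix -/

/-- `Tr₁ ⊗ id` (the partial trace over the first leg); it is only used for `k ≥ 1`. -/
def trLeft (N : ℕ) : ∀ k : ℕ, Mat N k → Mat N (k - 1)
  | 0, _ => 0
  | _ + 1, X => fun a b => ∑ s, X (Fin.cons s a) (Fin.cons s b)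

/-- `id ⊗ Tr₁` (the partial trace over the last leg); it is only used for `k ≥ 1`. -/
def trRight (N : ℕ) : ∀ k : ℕ, Mat N k → Mat N (k - 1)
  | 0, _ => 0
  | _ + 1, X => fun a b =>
      ∑ s, X (Fin.snoc (α := fun _ => Fin N) a s) (Fin.snoc (α := fun _ => Fin N) b s)

/-- `B(H_k)°°`, for `k ≥ 1`: the `X ∈ B(H_k)` with `(Tr₁ ⊗ id)(X) = 0 = (id ⊗ Tr₁)(X)`. -/
def endHcc (N k : ℕ) : Set (Mat N k) :=
  {X | X ∈ endH N k ∧ trLeft N k X = 0 ∧ trRight N k X = 0}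

/-- The rotation `ρ(X) = (P_k ⊗ t*) (id₁ ⊗ X ⊗ id₁) (t ⊗ P_k)`, for `k ≥ 1`. The `(a, b)` entry of
`(id_k ⊗ t*) (id₁ ⊗ X ⊗ id₁) (t ⊗ id_k)` is the entry of `X` with row `(a₂, …, aₖ, bₖ)` and column
`(a₁, b₁, …, bₖ₋₁)`. -/
def rot (N : ℕ) : ∀ k : ℕ, Mat N k → Mat N k
  | 0, X => X
  | k + 1, X => jw N (k + 1) *
      Matrix.of (fun a b : Word N (k + 1) =>
        X (Fin.snoc (α := fun _ => Fin N) (Fin.tail a) (b (Fin.last k)))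
          (Fin.cons (a 0) (Fin.init b))) *
      jw N (k + 1)

/-- `x_{i,j} = p_{i+k+j}(χ_i x χ_j)` for `x = u_k(X)`. -/
def shift (N k : ℕ) (X : Mat N k) (i j : ℕ) : L2 N :=
  proj N (i + k + j) (toL2 N (chi N i * coeff N k X * chi N j))

/-- The entry `G_{n;i,p} = (x_{i,n-k-i} | x_{p,n-k-p})` of the `n`-th block of the Gram matrix of
`x = u_k(X)`, for `0 ≤ i, p ≤ n - k`. -/
def gram (N k : ℕ) (X : Mat N k) (n i p : ℕ) : ℂ :=
  inner ℂ (shift N k X i (n - k - i)) (shift N k X p (n - k - p))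

/-- `A^n_p`. -/
def coefA (N k n p : ℕ) : ℝ :=
  (qdim N (p + k) * qdim N (p + k - 1) : ℝ) / (qdim N n * qdim N (n - 1))

/-- `B^n_p`, for `p ≥ 1`. -/
def coefB (N k : ℕ) (μ : ℂ) (n p : ℕ) : ℝ :=
  2 * (-1) ^ k * μ.re * ((qdim N (p + k - 1) * qdim N (p - 1) : ℝ) / (qdim N n * qdim N (n - 1)))

/-- `C^n_p`, for `p ≥ 2`. -/
def coefC (N n p : ℕ) : ℝ :=
  -((qdim N (p - 1) * qdim N (p - 2) : ℝ) / (qdim N n * qdim N (n - 1)))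

end FreeOrth

end

noncomputable section

namespace FreeOrth

open scoped TensorProduct ComplexOrder InnerProductSpace

/-! ### Temperley-Lieb operators on functions of sequences -/

/-! Write `X_p` for `id_p ⊗ X ⊗ id`, `t_l` and `t*_l` for insertion and contraction of `t` at the
legs `l, l + 1`.

The Gram entry is a trace. The product `χ_i x χ_j` is the coefficient of `P_i ⊗ X ⊗ P_j`, the
projection `p_n` compresses by `P_n`, and `P_n` absorbs `P_i` and `P_j`; the orthogonality relations
then give `G_{n;i,p} = Tr(X*_i P_n X_p P_n) / d_n` (`exists_gram_eq`). For `i < n - k` the factor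
`X*_i` avoids the last leg, so only the partial trace of `P_n X_p P_n` over that leg matters. The
theorem reduces to writing this partial trace as a combination of `P_{n-1} X_q P_{n-1}` with `q = p,
p - 1, p - 2` (`IsRotationEigen.cap_compress_cup`).

Put `m = n - 1`. The partial trace is `t*_m P_{m+1} X_p P_{m+1} t_m`, and Wenzl's recursion has the
one-sided form `t*_m P_{m+1} = P_m ∑_l (-1)^{m+l} (d_l / d_m) t*_l`, together with its mirror image
(`cap_mul_wenzl_succ`, `wenzl_succ_mul_cup`). A contraction inside `X` is zero, and one that slides
past `X` is killed by the other projection unless it is the last one. So on each side only the pairs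
at the two borders of `X` survive, plus one term with the last contraction. In the surviving
diagrams `X` is shifted by straightening a zigzag, or rotated by one leg in one of the two
directions; diagrams closing a leg of `X` on itself are partial traces, hence zero. One rotation
gives `μ`. The other is its inverse and gives the conjugate of `μ`, because rotation permutes matrix
entries and so forces `|μ| = 1` for `X ≠ 0` (`isRotationEigen`). Their sum is the factor `2 Re μ`.

Two inputs remain. The orthogonal projection onto `H_n` is the one given by Wenzl's recursion
(`jw_spec`). The orthogonality relations rest on the fact that fixed vectors of `u^{⊗ 2n}` are
spanned by noncrossing pairings (`ofList_mem_noncrossing`): `P_n` on the last `n` legs kills every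
such pairing except the nested one (`wenzl_noncrossing`), so the Haar state on coefficients of `u_n`
is known up to a scalar, which unitarity fixes.

Operators act on functions of infinite sequences: legs further to the right are implicit, and
diagrams with different numbers of legs compose without any identification of types. -/

/-- Linear operators on the functions of sequences in `Fin N`; a function of the first `k` entries
is an element of `H₁^{⊗ k}`. -/
abbrev Op (N : ℕ) : Type := Module.End ℂ ((ℕ → Fin N) → ℂ)

/-- Insertion of the pair `s, s` at the positions `i, i + 1`. -/
def insPair {N : ℕ} (i : ℕ) (s : Fin N) (w : ℕ → Fin N) : ℕ → Fin N := fun m =>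
  if m < i then w m else if m < i + 2 then s else w (m - 2)

/-- Deletion of the entries at the positions `i, i + 1`. -/
def delPair {N : ℕ} (i : ℕ) (w : ℕ → Fin N) : ℕ → Fin N := fun m =>
  if m < i then w m else w (m + 2)

/-- The contraction `id ⊗ t* ⊗ id` of the legs `i, i + 1`. -/
def cap (N i : ℕ) : Op N where
  toFun v := fun w => ∑ s, v (insPair i s w)
  map_add' v v' := by ext w; simp [Finset.sum_add_distrib]
  map_smul' r v := by ext w; simp [Finset.mul_sum]

/-- The insertion `id ⊗ t ⊗ id` of `t` at the legs `i, i + 1`. -/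
def cup (N i : ℕ) : Op N where
  toFun v := fun w => if w i = w (i + 1) then v (delPair i w) else 0
  map_add' v v' := by ext w; simp only [Pi.add_apply]; split_ifs <;> simp
  map_smul' r v := by ext w; simp

theorem cap_apply {N : ℕ} (i : ℕ) (v : (ℕ → Fin N) → ℂ) (w : ℕ → Fin N) :
    cap N i v w = ∑ s, v (insPair i s w) := rfl

theorem cup_apply {N : ℕ} (i : ℕ) (v : (ℕ → Fin N) → ℂ) (w : ℕ → Fin N) :
    cup N i v w = if w i = w (i + 1) then v (delPair i w) else 0 := rfl

theorem cap_mul_cup_self (N i : ℕ) : cap N i * cup N i = (N : ℂ) • 1 := by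
  ext v w
  have h1 : ∀ s : Fin N, delPair i (insPair i s w) = w := by
    intro s; funext m; simp only [delPair, insPair]; split_ifs <;> first | rfl | omega
  have h2 : ∀ s : Fin N, insPair i s w i = insPair i s w (i + 1) := by
    intro s; simp [insPair]
  simp [cap_apply, cup_apply, h1, h2]

/-- Zigzag (conjugate) equation: the contraction of one leg of `t` with a neighbouring leg
transports that leg unchanged. The mirror image follows. -/
theorem cap_succ_mul_cup (N i : ℕ) : cap N (i + 1) * cup N i = 1 := by
  ext v w
  have h1 : delPair i (insPair (i + 1) (w i) w) = w := by
    funext m; simp only [delPair, insPair]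
    split_ifs <;> first | rfl | omega | (congr 1; omega)
  have h2 : ∀ s : Fin N, insPair (i + 1) s w i = w i := by intro s; simp [insPair]
  have h3 : ∀ s : Fin N, insPair (i + 1) s w (i + 1) = s := by intro s; simp [insPair]
  simp [cap_apply, cup_apply, h1, h2, h3]

theorem cap_mul_cup_succ (N i : ℕ) : cap N i * cup N (i + 1) = 1 := by
  ext v w
  have h1 : delPair (i + 1) (insPair i (w i) w) = w := by
    funext m; simp only [delPair, insPair]
    split_ifs <;> first | rfl | omega | (congr 1; omega)
  have h2 : ∀ s : Fin N, insPair i s w (i + 1) = s := by intro s; simp [insPair]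
  have h3 : ∀ s : Fin N, insPair i s w (i + 1 + 1) = w i := by
    intro s; simp only [insPair]; rw [if_neg (by omega), if_neg (by omega)]; rfl
  simp [cap_apply, cup_apply, h1, h2, h3]

/-- Disjoint pairs commute; the shift by two accounts for the legs that the left pair has removed or
added. The next three lemmas are the other cases. -/
theorem cap_mul_cup_far {N i j : ℕ} (h : i ≤ j) :
    cap N i * cup N (j + 2) = cup N j * cap N i := by
  ext v w
  have h1 : ∀ s, delPair (j + 2) (insPair i s w) = insPair i s (delPair j w) := by
    intro s; funext m; simp only [delPair, insPair]
    split_ifs <;> first | rfl | omega | (congr 1; omega)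
  have h2 : ∀ s : Fin N, insPair i s w (j + 2) = w j := by
    intro s; simp only [insPair]; split_ifs <;> first | omega | rfl
  have h3 : ∀ s : Fin N, insPair i s w (j + 2 + 1) = w (j + 1) := by
    intro s; simp only [insPair]; split_ifs <;> first | omega | rfl
  simp only [Module.End.mul_apply, cap_apply, cup_apply, h1, h2, h3]
  split_ifs <;> simp

theorem cap_far_mul_cup {N i j : ℕ} (h : i ≤ j) :
    cap N (j + 2) * cup N i = cup N i * cap N j := by
  ext v w
  have h1 : ∀ s, delPair i (insPair (j + 2) s w) = insPair j s (delPair i w) := by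
    intro s; funext m; simp only [delPair, insPair]
    split_ifs <;> first | rfl | omega | (congr 1; omega)
  have h2 : ∀ s : Fin N, insPair (j + 2) s w i = w i := by
    intro s; simp only [insPair]; split_ifs <;> omega
  have h3 : ∀ s : Fin N, insPair (j + 2) s w (i + 1) = w (i + 1) := by
    intro s; simp only [insPair]; split_ifs <;> omega
  simp only [Module.End.mul_apply, cap_apply, cup_apply, h1, h2, h3]
  split_ifs <;> simp

theorem cap_mul_cap {N i j : ℕ} (h : i ≤ j) : cap N i * cap N (j + 2) = cap N j * cap N i := by
  ext v w
  have h1 : ∀ s t : Fin N, insPair (j + 2) t (insPair i s w) = insPair i s (insPair j t w) := by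
    intro s t; funext m; simp only [insPair]
    split_ifs <;> first | rfl | omega
  simp only [Module.End.mul_apply, cap_apply, h1]
  rw [Finset.sum_comm]

theorem cup_mul_cup {N i j : ℕ} (h : i ≤ j) : cup N (j + 2) * cup N i = cup N i * cup N j := by
  ext v w
  have h1 : delPair i (delPair (j + 2) w) = delPair j (delPair i w) := by
    funext m; simp only [delPair]
    split_ifs <;> first | rfl | omega
  have h2 : delPair (j + 2) w i = w i := by
    simp only [delPair]; split_ifs <;> omega
  have h3 : delPair (j + 2) w (i + 1) = w (i + 1) := by
    simp only [delPair]; split_ifs <;> omega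
  have h4 : delPair i w j = w (j + 2) := by
    simp only [delPair]; split_ifs <;> omega
  have h5 : delPair i w (j + 1) = w (j + 2 + 1) := by
    simp only [delPair]; split_ifs <;> first | omega | rfl
  simp only [Module.End.mul_apply, cup_apply, h1, h2, h3, h4, h5]
  split_ifs <;> rfl

/-! ### Operators on finitely many legs -/

/-- The entries `p, …, p + k - 1` of a sequence. -/
def window {N : ℕ} (k p : ℕ) (w : ℕ → Fin N) : Word N k := fun i => w (p + i)

/-- Replacement of the entries `p, …, p + k - 1` of a sequence. -/
def overwrite {N k : ℕ} (p : ℕ) (b : Word N k) (w : ℕ → Fin N) : ℕ → Fin N := fun m =>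
  if h : p ≤ m ∧ m < p + k then b ⟨m - p, by omega⟩ else w m

theorem overwrite_of_lt {N k p m : ℕ} (b : Word N k) (w : ℕ → Fin N) (h : m < p) :
    overwrite p b w m = w m := dif_neg (by omega)

theorem overwrite_of_ge {N k p m : ℕ} (b : Word N k) (w : ℕ → Fin N) (h : p + k ≤ m) :
    overwrite p b w m = w m := dif_neg (by omega)

theorem overwrite_add {N k p : ℕ} (b : Word N k) (w : ℕ → Fin N) (i : Fin k) :
    overwrite p b w (p + i) = b i := by
  rw [overwrite, dif_pos (by omega)]
  congr 1; ext; simp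

theorem window_overwrite {N k : ℕ} (p : ℕ) (b : Word N k) (w : ℕ → Fin N) :
    window k p (overwrite p b w) = b := funext fun i => overwrite_add b w i

/-- A sequence equals `overwrite p b w` if it has the right entries. -/
theorem eq_overwrite {N k p : ℕ} {b : Word N k} {w z : ℕ → Fin N} (h1 : ∀ i : Fin k, z (p + i) = b i)
    (h2 : ∀ m, m < p ∨ p + k ≤ m → z m = w m) : z = overwrite p b w := by
  funext m
  by_cases h : p ≤ m ∧ m < p + k
  · rw [overwrite, dif_pos h, ← h1]
    congr 1; simp; omega
  · rw [overwrite, dif_neg h]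
    exact h2 m (by omega)

theorem overwrite_window {N k : ℕ} (p : ℕ) (w : ℕ → Fin N) :
    overwrite p (window k p w) w = w :=
  (eq_overwrite (fun _ => rfl) fun _ _ => rfl).symm

theorem overwrite_overwrite {N k : ℕ} (p : ℕ) (b c : Word N k) (w : ℕ → Fin N) :
    overwrite p b (overwrite p c w) = overwrite p b w := by
  refine eq_overwrite (overwrite_add b _) fun m hm => ?_
  rcases hm with h | h
  · rw [overwrite_of_lt _ _ h, overwrite_of_lt _ _ h]
  · rw [overwrite_of_ge _ _ h, overwrite_of_ge _ _ h]

/-- The operator `id_p ⊗ M ⊗ id`. -/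
def place {N k : ℕ} (p : ℕ) (M : Mat N k) : Op N where
  toFun v := fun w => ∑ b, M (window k p w) b * v (overwrite p b w)
  map_add' v v' := by ext w; simp [Finset.sum_add_distrib, mul_add]
  map_smul' r v := by
    ext w; simp only [Pi.smul_apply, smul_eq_mul, Finset.mul_sum, RingHom.id_apply]
    exact Finset.sum_congr rfl fun _ _ => by ring

theorem place_apply {N k : ℕ} (p : ℕ) (M : Mat N k) (v : (ℕ → Fin N) → ℂ) (w : ℕ → Fin N) :
    place p M v w = ∑ b, M (window k p w) b * v (overwrite p b w) := rfl

theorem place_mul {N k : ℕ} (p : ℕ) (A B : Mat N k) :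
    place p (A * B) = place p A * place p B := by
  ext v w
  simp only [Module.End.mul_apply, place_apply, Matrix.mul_apply, window_overwrite,
    overwrite_overwrite, Finset.mul_sum, Finset.sum_mul]
  rw [Finset.sum_comm]
  simp only [mul_assoc]

theorem place_one {N k : ℕ} (p : ℕ) : place p (1 : Mat N k) = 1 := by
  ext v w
  simp [place_apply, Matrix.one_apply, overwrite_window]

theorem place_add {N k : ℕ} (p : ℕ) (A B : Mat N k) : place p (A + B) = place p A + place p B := by
  ext v w
  simp [place_apply, add_mul, Finset.sum_add_distrib]

theorem place_smul {N k : ℕ} (p : ℕ) (r : ℂ) (A : Mat N k) : place p (r • A) = r • place p A := by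
  ext v w
  simp [place_apply, Finset.mul_sum, mul_assoc]

theorem place_zero {N k : ℕ} (p : ℕ) : place p (0 : Mat N k) = 0 := by
  ext v w
  simp [place_apply]

theorem place_sub {N k : ℕ} (p : ℕ) (A B : Mat N k) : place p (A - B) = place p A - place p B := by
  ext v w
  simp [place_apply, sub_mul, Finset.sum_sub_distrib]

/-- A function of the first `k` entries. -/
def extend {N k : ℕ} (f : Word N k → ℂ) : (ℕ → Fin N) → ℂ := fun w => f (window k 0 w)

theorem place_extend {N k : ℕ} (A : Mat N k) (f : Word N k → ℂ) :
    place 0 A (extend f) = extend (A.mulVec f) := by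
  ext w
  simp [place_apply, extend, window_overwrite, Matrix.mulVec, dotProduct]

theorem extend_injective {N k : ℕ} (hN : 0 < N) : Function.Injective (extend (N := N) (k := k)) := by
  intro f g h
  funext b
  have := congrFun h (overwrite 0 b fun _ => ⟨0, hN⟩)
  simpa [extend, window_overwrite] using this

/-- Transfers identities from diagrams back to matrices. Positivity of `N` provides a sequence
extending a given word. -/
theorem place_injective {N k : ℕ} (hN : 0 < N) :
    Function.Injective (place (N := N) (k := k) 0) := by
  intro A B h
  ext a b
  have h1 := congrArg (fun O : Op N => O (extend (Pi.single b 1))) h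
  simp only [place_extend] at h1
  simpa using congrFun (extend_injective hN h1) a

/-! ### Sliding contractions and insertions past matrices -/

theorem cap_mul_place_right {N k p i : ℕ} (h : p + k ≤ i) (M : Mat N k) :
    cap N i * place p M = place p M * cap N i := by
  ext v w
  have h1 : ∀ s, window k p (insPair i s w) = window k p w := by
    intro s; funext j; simp only [window, insPair]; rw [if_pos (by omega)]
  have h2 : ∀ s (b : Word N k), overwrite p b (insPair i s w) = insPair i s (overwrite p b w) := by
    intro s b
    symm
    refine eq_overwrite (fun j => ?_) fun m hm => ?_
    · simp only [insPair]; rw [if_pos (by omega), overwrite_add]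
    · simp only [insPair]
      split_ifs
      · rcases hm with h | h
        · rw [overwrite_of_lt _ _ h]
        · rw [overwrite_of_ge _ _ h]
      · rfl
      · rw [overwrite_of_ge _ _ (by omega)]
  simp only [Module.End.mul_apply, cap_apply, place_apply, h1, h2, Finset.mul_sum]
  rw [Finset.sum_comm]

theorem cap_mul_place_left {N k p i : ℕ} (h : i ≤ p) (M : Mat N k) :
    cap N i * place (p + 2) M = place p M * cap N i := by
  ext v w
  have h1 : ∀ s, window k (p + 2) (insPair i s w) = window k p w := by
    intro s; funext j; simp only [window, insPair]; rw [if_neg (by omega), if_neg (by omega)]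
    congr 1; omega
  have h2 : ∀ s (b : Word N k),
      overwrite (p + 2) b (insPair i s w) = insPair i s (overwrite p b w) := by
    intro s b
    symm
    refine eq_overwrite (fun j => ?_) fun m hm => ?_
    · simp only [insPair]; rw [if_neg (by omega), if_neg (by omega),
        show p + 2 + (j : ℕ) - 2 = p + j by omega, overwrite_add]
    · simp only [insPair]
      split_ifs
      · rw [overwrite_of_lt _ _ (by omega)]
      · rfl
      · rcases hm with h | h
        · rw [overwrite_of_lt _ _ (by omega)]
        · rw [overwrite_of_ge _ _ (by omega)]
  simp only [Module.End.mul_apply, cap_apply, place_apply, h1, h2, Finset.mul_sum]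
  rw [Finset.sum_comm]

theorem cup_mul_place_right {N k p i : ℕ} (h : p + k ≤ i) (M : Mat N k) :
    cup N i * place p M = place p M * cup N i := by
  ext v w
  have h1 : window k p (delPair i w) = window k p w := by
    funext j; simp only [window, delPair]; rw [if_pos (by omega)]
  have h2 : ∀ (b : Word N k), overwrite p b (delPair i w) = delPair i (overwrite p b w) := by
    intro b
    symm
    refine eq_overwrite (fun j => ?_) fun m hm => ?_
    · simp only [delPair]; rw [if_pos (by omega), overwrite_add]
    · simp only [delPair]
      split_ifs
      · rcases hm with h | h
        · rw [overwrite_of_lt _ _ h]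
        · rw [overwrite_of_ge _ _ h]
      · rw [overwrite_of_ge _ _ (by omega)]
  have h3 : ∀ b : Word N k, overwrite p b w i = w i := fun b => overwrite_of_ge _ _ h
  have h4 : ∀ b : Word N k, overwrite p b w (i + 1) = w (i + 1) :=
    fun b => overwrite_of_ge _ _ (by omega)
  simp only [Module.End.mul_apply, cup_apply, place_apply, h1, h2, h3, h4]
  split_ifs <;> simp

theorem cup_mul_place_left {N k p i : ℕ} (h : i ≤ p) (M : Mat N k) :
    cup N i * place p M = place (p + 2) M * cup N i := by
  ext v w
  have h1 : window k p (delPair i w) = window k (p + 2) w := by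
    funext j; simp only [window, delPair]; rw [if_neg (by omega)]
    congr 1; omega
  have h2 : ∀ (b : Word N k),
      overwrite p b (delPair i w) = delPair i (overwrite (p + 2) b w) := by
    intro b
    symm
    refine eq_overwrite (fun j => ?_) fun m hm => ?_
    · simp only [delPair]; rw [if_neg (by omega),
        show p + (j : ℕ) + 2 = p + 2 + j by omega, overwrite_add]
    · simp only [delPair]
      split_ifs
      · rw [overwrite_of_lt _ _ (by omega)]
      · rcases hm with h | h
        · rw [overwrite_of_lt _ _ (by omega)]
        · rw [overwrite_of_ge _ _ (by omega)]
  have h3 : ∀ b : Word N k, overwrite (p + 2) b w i = w i :=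
    fun b => overwrite_of_lt _ _ (by omega)
  have h4 : ∀ b : Word N k, overwrite (p + 2) b w (i + 1) = w (i + 1) :=
    fun b => overwrite_of_lt _ _ (by omega)
  simp only [Module.End.mul_apply, cup_apply, place_apply, h1, h2, h3, h4]
  split_ifs <;> simp

/-- The tensor product of matrices. -/
def tensor {N k l : ℕ} (A : Mat N k) (B : Mat N l) : Mat N (k + l) := fun a b =>
  A (fun i => a (Fin.castAdd l i)) (fun i => b (Fin.castAdd l i)) *
    B (fun i => a (Fin.natAdd k i)) (fun i => b (Fin.natAdd k i))

theorem sum_append {N k l : ℕ} {M : Type*} [AddCommMonoid M] (f : Word N (k + l) → M) :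
    ∑ c, f c = ∑ a : Word N k, ∑ b : Word N l, f (Fin.append a b) := by
  rw [← Fintype.sum_prod_type', ← (Fin.appendEquiv k l).sum_comp]
  rfl

theorem tensor_append {N k l : ℕ} (A : Mat N k) (B : Mat N l) (a c : Word N k) (b d : Word N l) :
    tensor A B (Fin.append a b) (Fin.append c d) = A a c * B b d := by
  simp [tensor]

theorem tensor_conjTranspose {N k l : ℕ} (A : Mat N k) (B : Mat N l) :
    (tensor A B).conjTranspose = tensor A.conjTranspose B.conjTranspose := by
  ext a b
  simp [tensor, Matrix.conjTranspose_apply]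

theorem place_tensor {N k l : ℕ} (p : ℕ) (A : Mat N k) (B : Mat N l) :
    place p (tensor A B) = place p A * place (p + k) B := by
  ext v w
  have h1 : window (k + l) p w = Fin.append (window k p w) (window l (p + k) w) := by
    funext i
    refine Fin.addCases (fun j => ?_) (fun j => ?_) i <;> simp [window, add_assoc]
  have h2 : ∀ a : Word N k, window l (p + k) (overwrite p a w) = window l (p + k) w := by
    intro a; funext j; exact overwrite_of_ge _ _ (by omega)
  have h3 : ∀ (a : Word N k) (b : Word N l),
      overwrite (p + k) b (overwrite p a w) = overwrite p (Fin.append a b) w := by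
    intro a b
    refine eq_overwrite (fun i => ?_) fun m hm => ?_
    · refine Fin.addCases (fun j => ?_) (fun j => ?_) i
      · rw [Fin.append_left, Fin.val_castAdd, overwrite_of_lt _ _ (by omega), overwrite_add]
      · rw [Fin.append_right, Fin.val_natAdd, ← add_assoc, overwrite_add]
    · rcases hm with h | h
      · rw [overwrite_of_lt _ _ (by omega), overwrite_of_lt _ _ (by omega)]
      · rw [overwrite_of_ge _ _ (by omega), overwrite_of_ge _ _ (by omega)]
  simp only [Module.End.mul_apply, place_apply, sum_append, h1, tensor_append, h2, h3,
    Finset.mul_sum, mul_assoc]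

/-- The operator `t t*` on two legs. -/
def cupCap (N : ℕ) : Mat N 2 := fun a b => if a 0 = a 1 ∧ b 0 = b 1 then 1 else 0

theorem place_cupCap (N p : ℕ) : place p (cupCap N) = cup N p * cap N p := by
  ext v w
  simp only [Module.End.mul_apply, place_apply, cap_apply, cup_apply, cupCap]
  rw [← (finTwoArrowEquiv (Fin N)).symm.sum_comp, Fintype.sum_prod_type]
  have h1 : ∀ s : Fin N, overwrite p ![s, s] w = insPair p s (delPair p w) := by
    intro s
    symm
    refine eq_overwrite (fun i => ?_) fun m hm => ?_
    · fin_cases i <;> simp [insPair]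
    · simp only [insPair, delPair]
      split_ifs <;> first | rfl | omega | (congr 1; omega)
  by_cases h : w p = w (p + 1)
  · simp [window, h, h1]
  · simp [window, h]

/-! ### Partial traces and rotation as diagrams -/

theorem sum_snoc {N k : ℕ} {M : Type*} [AddCommMonoid M] (f : Word N (k + 1) → M) :
    ∑ c, f c = ∑ b : Word N k, ∑ s, f (Fin.snoc (α := fun _ => Fin N) b s) := by
  rw [← (Fin.snocEquiv fun _ : Fin (k + 1) => Fin N).sum_comp, Fintype.sum_prod_type,
    Finset.sum_comm]
  rfl

theorem sum_cons {N k : ℕ} {M : Type*} [AddCommMonoid M] (f : Word N (k + 1) → M) :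
    ∑ c, f c = ∑ s, ∑ b : Word N k, f (Fin.cons (α := fun _ => Fin N) s b) := by
  rw [← (Fin.consEquiv fun _ : Fin (k + 1) => Fin N).sum_comp, Fintype.sum_prod_type]
  rfl

/-- The insertion creates a pair of legs, `A` acts on the first of them as its last leg, and the
contraction closes the loop. -/
theorem cap_place_cup_right {N k : ℕ} (p : ℕ) (A : Mat N (k + 1)) :
    cap N (p + k) * place p A * cup N (p + k) = place p (trRight N (k + 1) A) := by
  ext v w
  have h1 : ∀ s, window (k + 1) p (insPair (p + k) s w)
      = Fin.snoc (α := fun _ => Fin N) (window k p w) s := by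
    intro s; funext i
    refine Fin.lastCases ?_ (fun j => ?_) i
    · simp [window, insPair]
    · simp [window, insPair]
  have h2 : ∀ s t (b : Word N k), overwrite p (Fin.snoc (α := fun _ => Fin N) b t : Word N (k + 1))
      (insPair (p + k) s w) (p + k) = t := by
    intro s t b
    have := overwrite_add (p := p) (Fin.snoc (α := fun _ => Fin N) b t : Word N (k + 1))
      (insPair (p + k) s w) (Fin.last k)
    simpa using this
  have h3 : ∀ s (b : Word N (k + 1)), overwrite p b (insPair (p + k) s w) (p + k + 1) = s := by
    intro s b
    rw [overwrite_of_ge _ _ (by omega)]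
    simp [insPair]
  have h4 : ∀ s (b : Word N k), delPair (p + k)
      (overwrite p (Fin.snoc (α := fun _ => Fin N) b s : Word N (k + 1)) (insPair (p + k) s w))
      = overwrite p b w := by
    intro s b
    refine eq_overwrite (fun i => ?_) fun m hm => ?_
    · have := overwrite_add (p := p) (Fin.snoc (α := fun _ => Fin N) b s : Word N (k + 1))
        (insPair (p + k) s w) i.castSucc
      rw [Fin.snoc_castSucc] at this
      rw [← this, delPair, if_pos (by omega)]
      rfl
    · rcases hm with h | h
      · rw [delPair, if_pos (by omega), overwrite_of_lt _ _ h, insPair, if_pos (by omega)]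
      · rw [delPair, if_neg (by omega), overwrite_of_ge _ _ (by omega), insPair,
          if_neg (by omega), if_neg (by omega)]
        rfl
  change _ = ∑ b : Word N k, (∑ s, A (Fin.snoc (α := fun _ => Fin N) (window k p w) s)
    (Fin.snoc (α := fun _ => Fin N) b s)) * v (overwrite p b w)
  simp only [Module.End.mul_apply, place_apply, cap_apply, cup_apply, h1, Finset.sum_mul]
  simp only [sum_snoc, h2, h3, mul_ite, mul_zero]
  rw [Finset.sum_comm]
  simp [h4]

theorem cap_place_cup_left {N k : ℕ} (p : ℕ) (A : Mat N (k + 1)) :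
    cap N p * place (p + 1) A * cup N p = place p (trLeft N (k + 1) A) := by
  ext v w
  have h1 : ∀ s, window (k + 1) (p + 1) (insPair p s w)
      = Fin.cons (α := fun _ => Fin N) s (window k p w) := by
    intro s; funext i
    refine Fin.cases ?_ (fun j => ?_) i
    · simp [window, insPair]
    · simp only [window, insPair, Fin.val_succ, Fin.cons_succ]
      rw [if_neg (by omega), if_neg (by omega)]
      congr 1; omega
  have h2 : ∀ s (b : Word N (k + 1)), overwrite (p + 1) b (insPair p s w) p = s := by
    intro s b
    rw [overwrite_of_lt _ _ (by omega)]
    simp [insPair]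
  have h3 : ∀ s (b : Word N (k + 1)), overwrite (p + 1) b (insPair p s w) (p + 1) = b 0 := by
    intro s b
    exact overwrite_add (p := p + 1) b (insPair p s w) 0
  have h4 : ∀ s (b : Word N k), delPair p
      (overwrite (p + 1) (Fin.cons (α := fun _ => Fin N) s b : Word N (k + 1)) (insPair p s w))
      = overwrite p b w := by
    intro s b
    refine eq_overwrite (fun i => ?_) fun m hm => ?_
    · have := overwrite_add (p := p + 1) (Fin.cons (α := fun _ => Fin N) s b : Word N (k + 1))
        (insPair p s w) i.succ
      rw [Fin.cons_succ] at this
      rw [← this, delPair, if_neg (by omega)]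
      congr 1; simp; omega
    · rcases hm with h | h
      · rw [delPair, if_pos (by omega), overwrite_of_lt _ _ (by omega), insPair,
          if_pos (by omega)]
      · rw [delPair, if_neg (by omega), overwrite_of_ge _ _ (by omega), insPair,
          if_neg (by omega), if_neg (by omega)]
        rfl
  change _ = ∑ b : Word N k, (∑ s, A (Fin.cons (α := fun _ => Fin N) s (window k p w))
    (Fin.cons (α := fun _ => Fin N) s b)) * v (overwrite p b w)
  simp only [Module.End.mul_apply, place_apply, cap_apply, cup_apply, h1, Finset.sum_mul]
  rw [Finset.sum_comm (γ := Word N k)]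
  simp only [sum_cons, h2, h3, mul_ite, mul_zero]
  simp [h4]

/-- The rotation without the projections onto `H_k`. -/
def rawRot {N k : ℕ} (X : Mat N (k + 1)) : Mat N (k + 1) :=
  Matrix.of (fun a b : Word N (k + 1) =>
    X (Fin.snoc (α := fun _ => Fin N) (Fin.tail a) (b (Fin.last k))) (Fin.cons (a 0) (Fin.init b)))

theorem rot_eq {N k : ℕ} (X : Mat N (k + 1)) :
    rot N (k + 1) X = jw N (k + 1) * rawRot X * jw N (k + 1) := rfl

/-- The pair inserted in front turns the first input leg of `X` into an output leg, and the
contraction behind turns its last output leg into an input leg. -/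
theorem cap_place_cup_rot {N k : ℕ} (p : ℕ) (X : Mat N (k + 1)) :
    cap N (p + (k + 1)) * place (p + 1) X * cup N p = place p (rawRot X) := by
  ext v w
  have h1 : ∀ s, window (k + 1) (p + 1) (insPair (p + (k + 1)) s w)
      = Fin.snoc (α := fun _ => Fin N) (Fin.tail (window (k + 1) p w)) s := by
    intro s; funext i
    refine Fin.lastCases ?_ (fun j => ?_) i
    · simp only [window, insPair, Fin.val_last, Fin.snoc_last]
      rw [if_neg (by omega), if_pos (by omega)]
    · simp only [window, insPair, Fin.val_castSucc, Fin.snoc_castSucc, Fin.tail, Fin.val_succ]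
      rw [if_pos (by omega)]
      congr 1; omega
  have h2 : ∀ s (b : Word N (k + 1)),
      overwrite (p + 1) b (insPair (p + (k + 1)) s w) p = w p := by
    intro s b
    rw [overwrite_of_lt _ _ (by omega)]
    simp [insPair]
  have h3 : ∀ s (b : Word N (k + 1)),
      overwrite (p + 1) b (insPair (p + (k + 1)) s w) (p + 1) = b 0 := by
    intro s b
    exact overwrite_add (p := p + 1) b (insPair (p + (k + 1)) s w) 0
  have h4 : ∀ s (x : Fin N) (c : Word N k), delPair p (overwrite (p + 1)
      (Fin.cons (α := fun _ => Fin N) x c : Word N (k + 1)) (insPair (p + (k + 1)) s w))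
      = overwrite p (Fin.snoc (α := fun _ => Fin N) c s : Word N (k + 1)) w := by
    intro s x c
    refine eq_overwrite (fun i => ?_) fun m hm => ?_
    · refine Fin.lastCases ?_ (fun j => ?_) i
      · rw [Fin.val_last, delPair, if_neg (by omega), overwrite_of_ge _ _ (by omega), insPair,
          if_neg (by omega), if_pos (by omega), Fin.snoc_last]
      · have := overwrite_add (p := p + 1) (Fin.cons (α := fun _ => Fin N) x c : Word N (k + 1))
          (insPair (p + (k + 1)) s w) j.succ
        rw [Fin.cons_succ] at this
        rw [Fin.snoc_castSucc, ← this, delPair, if_neg (by simp)]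
        congr 1; simp; omega
    · rcases hm with h | h
      · rw [delPair, if_pos (by omega), overwrite_of_lt _ _ (by omega), insPair,
          if_pos (by omega)]
      · rw [delPair, if_neg (by omega), overwrite_of_ge _ _ (by omega), insPair,
          if_neg (by omega), if_neg (by omega)]
        rfl
  have h5 : window (k + 1) p w 0 = w p := rfl
  have h6 : ∀ s, ∑ c, X (Fin.snoc (α := fun _ => Fin N) (Fin.tail (window (k + 1) p w)) s) c *
      (if w p = c 0 then v (delPair p (overwrite (p + 1) c (insPair (p + (k + 1)) s w))) else 0)
      = ∑ c : Word N k, rawRot X (window (k + 1) p w) (Fin.snoc (α := fun _ => Fin N) c s) *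
        v (overwrite p (Fin.snoc (α := fun _ => Fin N) c s : Word N (k + 1)) w) := by
    intro s
    rw [sum_cons, Finset.sum_comm]
    simp [h4, rawRot, h5]
  simp only [Module.End.mul_apply, place_apply, cap_apply, cup_apply, h1, h2, h3, h6]
  rw [Finset.sum_comm, sum_snoc]

theorem trace_trRight {N k : ℕ} (A : Mat N (k + 1)) : (trRight N (k + 1) A).trace = A.trace := by
  simp only [Matrix.trace, Matrix.diag, sum_snoc (N := N) (k := k), trRight]
  rfl

/-! ### Jones-Wenzl projections -/

/-- The Chebyshev sequence `1, N, N² - 1, …`. -/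
def cheb (N : ℕ) : ℕ → ℤ
  | 0 => 1
  | 1 => N
  | n + 2 => N * cheb N (n + 1) - cheb N n

/-- Monotonicity is carried along the induction: `N c - c' ≥ 2 c - c' ≥ c` as soon as `0 ≤ c' ≤ c`.
-/
theorem cheb_pos {N : ℕ} (hN : 2 ≤ N) (n : ℕ) : 0 < cheb N n ∧ cheb N n ≤ cheb N (n + 1) := by
  have hN' : (2 : ℤ) ≤ N := by exact_mod_cast hN
  induction n with
  | zero => simp only [cheb]; omega
  | succ n ih =>
    refine ⟨by omega, ?_⟩
    rw [show cheb N (n + 1 + 1) = N * cheb N (n + 1) - cheb N n from rfl]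
    have := mul_le_mul_of_nonneg_right hN' (show 0 ≤ cheb N (n + 1) by omega)
    linarith [ih.1, ih.2]

/-- The Chebyshev sequence as a sequence of complex numbers. -/
def chebC (N n : ℕ) : ℂ := cheb N n

theorem chebC_ne_zero {N : ℕ} (hN : 2 ≤ N) (n : ℕ) : chebC N n ≠ 0 := by
  rw [chebC]; exact_mod_cast (cheb_pos hN n).1.ne'

theorem chebC_zero (N : ℕ) : chebC N 0 = 1 := by simp [chebC, cheb]

theorem chebC_one (N : ℕ) : chebC N 1 = N := by simp [chebC, cheb]

theorem chebC_add_two (N n : ℕ) : chebC N (n + 2) = N * chebC N (n + 1) - chebC N n := by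
  simp [chebC, cheb]

/-- The Jones-Wenzl projection on the legs `p, …, p + n - 1`, by Wenzl's recursion. -/
def wenzl (N p : ℕ) : ℕ → Op N
  | 0 => 1
  | 1 => 1
  | n + 2 => wenzl N p (n + 1) - (chebC N n / chebC N (n + 1)) •
      (wenzl N p (n + 1) * cup N (p + n) * cap N (p + n) * wenzl N p (n + 1))

theorem wenzl_zero (N p : ℕ) : wenzl N p 0 = 1 := rfl

theorem wenzl_one (N p : ℕ) : wenzl N p 1 = 1 := rfl

theorem wenzl_add_two (N p n : ℕ) : wenzl N p (n + 2) = wenzl N p (n + 1) -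
    (chebC N n / chebC N (n + 1)) •
      (wenzl N p (n + 1) * cup N (p + n) * cap N (p + n) * wenzl N p (n + 1)) := rfl

theorem cap_mul_wenzl_right {N p n i : ℕ} (h : p + n ≤ i) :
    cap N i * wenzl N p n = wenzl N p n * cap N i := by
  induction n using Nat.twoStepInduction generalizing i with
  | zero => simp [wenzl_zero]
  | one => simp [wenzl_one]
  | more n _ ih =>
    obtain ⟨i, rfl⟩ : ∃ j, i = j + 2 := ⟨i - 2, by omega⟩
    have h1 := cap_far_mul_cup (N := N) (show p + n ≤ i by omega)
    have h2 := cap_mul_cap (N := N) (show p + n ≤ i by omega)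
    rw [wenzl_add_two, mul_sub, sub_mul, ih (by omega), mul_smul_comm, smul_mul_assoc]
    congr 2
    calc cap N (i + 2) * (wenzl N p (n + 1) * cup N (p + n) * cap N (p + n) * wenzl N p (n + 1))
        = (cap N (i + 2) * wenzl N p (n + 1)) * cup N (p + n) * cap N (p + n) *
            wenzl N p (n + 1) := by simp only [mul_assoc]
      _ = wenzl N p (n + 1) * (cap N (i + 2) * cup N (p + n)) * cap N (p + n) *
            wenzl N p (n + 1) := by rw [ih (by omega)]; simp only [mul_assoc]
      _ = wenzl N p (n + 1) * cup N (p + n) * (cap N i * cap N (p + n)) *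
            wenzl N p (n + 1) := by rw [h1]; simp only [mul_assoc]
      _ = wenzl N p (n + 1) * cup N (p + n) * cap N (p + n) * (cap N (i + 2) *
            wenzl N p (n + 1)) := by rw [← h2]; simp only [mul_assoc]
      _ = _ := by rw [ih (by omega)]; simp only [mul_assoc]

theorem cup_mul_wenzl_right {N p n i : ℕ} (h : p + n ≤ i) :
    cup N i * wenzl N p n = wenzl N p n * cup N i := by
  induction n using Nat.twoStepInduction generalizing i with
  | zero => simp [wenzl_zero]
  | one => simp [wenzl_one]
  | more n _ ih =>
    obtain ⟨i, rfl⟩ : ∃ j, i = j + 2 := ⟨i - 2, by omega⟩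
    have h1 := cup_mul_cup (N := N) (show p + n ≤ i by omega)
    have h2 := cap_mul_cup_far (N := N) (show p + n ≤ i by omega)
    rw [wenzl_add_two, mul_sub, sub_mul, ih (by omega), mul_smul_comm, smul_mul_assoc]
    congr 2
    calc cup N (i + 2) * (wenzl N p (n + 1) * cup N (p + n) * cap N (p + n) * wenzl N p (n + 1))
        = (cup N (i + 2) * wenzl N p (n + 1)) * cup N (p + n) * cap N (p + n) *
            wenzl N p (n + 1) := by simp only [mul_assoc]
      _ = wenzl N p (n + 1) * (cup N (i + 2) * cup N (p + n)) * cap N (p + n) *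
            wenzl N p (n + 1) := by rw [ih (by omega)]; simp only [mul_assoc]
      _ = wenzl N p (n + 1) * cup N (p + n) * (cup N i * cap N (p + n)) *
            wenzl N p (n + 1) := by rw [h1]; simp only [mul_assoc]
      _ = wenzl N p (n + 1) * cup N (p + n) * cap N (p + n) * (cup N (i + 2) *
            wenzl N p (n + 1)) := by rw [← h2]; simp only [mul_assoc]
      _ = _ := by rw [ih (by omega)]; simp only [mul_assoc]

theorem cup_mul_wenzl_left {N p n i : ℕ} (h : i ≤ p) :
    cup N i * wenzl N p n = wenzl N (p + 2) n * cup N i := by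
  induction n using Nat.twoStepInduction with
  | zero => simp [wenzl_zero]
  | one => simp [wenzl_one]
  | more n _ ih =>
    have h1 := cup_mul_cup (N := N) (show i ≤ p + n by omega)
    have h2 := cap_far_mul_cup (N := N) (show i ≤ p + n by omega)
    have e : p + 2 + n = p + n + 2 := by omega
    rw [wenzl_add_two, wenzl_add_two, mul_sub, sub_mul, ih, mul_smul_comm, smul_mul_assoc, e]
    congr 2
    calc cup N i * (wenzl N p (n + 1) * cup N (p + n) * cap N (p + n) * wenzl N p (n + 1))
        = (cup N i * wenzl N p (n + 1)) * cup N (p + n) * cap N (p + n) *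
            wenzl N p (n + 1) := by simp only [mul_assoc]
      _ = wenzl N (p + 2) (n + 1) * (cup N i * cup N (p + n)) * cap N (p + n) *
            wenzl N p (n + 1) := by rw [ih]; simp only [mul_assoc]
      _ = wenzl N (p + 2) (n + 1) * cup N (p + n + 2) * (cup N i * cap N (p + n)) *
            wenzl N p (n + 1) := by rw [← h1]; simp only [mul_assoc]
      _ = wenzl N (p + 2) (n + 1) * cup N (p + n + 2) * cap N (p + n + 2) * (cup N i *
            wenzl N p (n + 1)) := by rw [← h2]; simp only [mul_assoc]
      _ = _ := by rw [ih]; simp only [mul_assoc]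

/-- Vectors killed by all contractions are fixed by the Jones-Wenzl projection. -/
theorem wenzl_apply_of_cap {N p n : ℕ} {v : (ℕ → Fin N) → ℂ}
    (h : ∀ i, i + 2 ≤ n → cap N (p + i) v = 0) : wenzl N p n v = v := by
  induction n using Nat.twoStepInduction with
  | zero => rfl
  | one => rfl
  | more n _ ih =>
    have h1 := ih fun i hi => h i (by omega)
    rw [wenzl_add_two]
    simp only [LinearMap.sub_apply, LinearMap.smul_apply, Module.End.mul_apply, h1,
      h n le_rfl, map_zero, smul_zero, sub_zero]

theorem wenzl_mul_of_cap {N p n : ℕ} {A : Op N}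
    (h : ∀ i, i + 2 ≤ n → cap N (p + i) * A = 0) : wenzl N p n * A = A :=
  LinearMap.ext fun v => wenzl_apply_of_cap fun i hi => LinearMap.congr_fun (h i hi) v

/-- Inductively `A` absorbs the smaller projection, and the correction term in Wenzl's recursion
then starts with `A` times an insertion. With `wenzl_mul_of_cap`, this is the source of all
absorption rules between nested projections. -/
theorem mul_wenzl_of_cup {N p n : ℕ} {A : Op N}
    (h : ∀ i, i + 2 ≤ n → A * cup N (p + i) = 0) : A * wenzl N p n = A := by
  induction n using Nat.twoStepInduction with
  | zero => rw [wenzl_zero, mul_one]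
  | one => rw [wenzl_one, mul_one]
  | more n _ ih =>
    have h1 := ih fun i hi => h i (by omega)
    rw [wenzl_add_two, mul_sub, mul_smul_comm, h1]
    simp only [← mul_assoc]
    rw [h1, h n le_rfl]
    simp

/-- The coefficients of the one-sided recursion. -/
def wcoef (N m l : ℕ) : ℂ := (-1) ^ (m + l) * (chebC N l / chebC N m)

theorem wcoef_self {N : ℕ} (hN : 2 ≤ N) (m : ℕ) : wcoef N m m = 1 := by
  rw [wcoef, div_self (chebC_ne_zero hN m), mul_one, Even.neg_one_pow ⟨m, rfl⟩]

theorem wcoef_succ {N : ℕ} (hN : 2 ≤ N) (m l : ℕ) :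
    wcoef N (m + 1) l = -(chebC N m / chebC N (m + 1)) * wcoef N m l := by
  have h0 := chebC_ne_zero hN m
  have h1 := chebC_ne_zero hN (m + 1)
  rw [wcoef, wcoef, show m + 1 + l = m + l + 1 by omega, pow_succ]
  field_simp

theorem sum_wcoef_succ {N : ℕ} (hN : 2 ≤ N) (m : ℕ) (f : ℕ → Op N) :
    ∑ l ∈ Finset.range (m + 1 + 1), wcoef N (m + 1) l • f l = f (m + 1) -
      (chebC N m / chebC N (m + 1)) • ∑ l ∈ Finset.range (m + 1), wcoef N m l • f l := by
  rw [Finset.sum_range_succ, wcoef_self hN, one_smul, Finset.smul_sum, add_comm, sub_eq_add_neg,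
    ← Finset.sum_neg_distrib]
  congr 1
  refine Finset.sum_congr rfl fun l _ => ?_
  rw [wcoef_succ hN, smul_smul, ← neg_smul, neg_mul]

/-- The fundamental properties of the Jones-Wenzl projections. -/
theorem wenzl_aux {N : ℕ} (hN : 2 ≤ N) (p n : ℕ) :
    wenzl N p n * wenzl N p n = wenzl N p n ∧
    wenzl N p (n + 1) * wenzl N p (n + 1) = wenzl N p (n + 1) ∧
    wenzl N p n * wenzl N p (n + 1) = wenzl N p (n + 1) ∧
    wenzl N p (n + 1) * wenzl N p n = wenzl N p (n + 1) ∧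
    (∀ i, i + 2 ≤ n + 1 → cap N (p + i) * wenzl N p (n + 1) = 0) ∧
    (∀ i, i + 2 ≤ n + 1 → wenzl N p (n + 1) * cup N (p + i) = 0) ∧
    cap N (p + n) * wenzl N p (n + 1) * cup N (p + n)
      = (chebC N (n + 1) / chebC N n) • wenzl N p n := by
  induction n with
  | zero =>
    refine ⟨by simp [wenzl], by simp [wenzl], by simp [wenzl], by simp [wenzl], by simp, by simp, ?_⟩
    simp [wenzl, cap_mul_cup_self, chebC_zero, chebC_one]
  | succ n ih =>
    obtain ⟨e0, e1, l, r, c, c', t⟩ := ih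
    set P := wenzl N p n with hP
    set Q := wenzl N p (n + 1) with hQ
    set a := cap N (p + n) with ha
    set b := cup N (p + n) with hb
    have hd0 := chebC_ne_zero hN n
    have hd1 := chebC_ne_zero hN (n + 1)
    have hR : wenzl N p (n + 1 + 1) = Q - (chebC N n / chebC N (n + 1)) • (Q * b * a * Q) := rfl
    have hQR : Q * wenzl N p (n + 1 + 1) = wenzl N p (n + 1 + 1) := by
      rw [hR, mul_sub, mul_smul_comm, e1]
      simp only [← mul_assoc, e1]
    have hRQ : wenzl N p (n + 1 + 1) * Q = wenzl N p (n + 1 + 1) := by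
      rw [hR, sub_mul, smul_mul_assoc, e1]
      simp only [mul_assoc, e1]
    have hPa : P * a = a * P := (cap_mul_wenzl_right le_rfl).symm
    have hbP : b * P = P * b := cup_mul_wenzl_right le_rfl
    -- The coefficient `d_n / d_{n+1}` in the recursion is the inverse of the factor produced by the
    -- partial trace of the previous projection, so the two terms cancel.
    have haR : a * wenzl N p (n + 1 + 1) = 0 := by
      have h1 : a * (Q * b * a * Q) = (a * Q * b) * a * Q := by simp only [mul_assoc]
      rw [hR, mul_sub, mul_smul_comm, h1, t, smul_mul_assoc, smul_mul_assoc, hPa, mul_assoc a, l,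
        smul_smul, div_mul_div_cancel₀ hd1, div_self hd0, one_smul, sub_self]
    have hRb : wenzl N p (n + 1 + 1) * b = 0 := by
      have h1 : (Q * b * a * Q) * b = Q * b * (a * Q * b) := by simp only [mul_assoc]
      rw [hR, sub_mul, smul_mul_assoc, h1, t, mul_smul_comm, mul_assoc Q, hbP, ← mul_assoc Q, r,
        smul_smul, div_mul_div_cancel₀ hd1, div_self hd0, one_smul, sub_self]
    have hcap : ∀ i, i + 2 ≤ n + 1 + 1 → cap N (p + i) * wenzl N p (n + 1 + 1) = 0 := by
      intro i hi
      rcases Nat.lt_or_ge i n with h | h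
      · rw [← hQR, ← mul_assoc, c i (by omega), zero_mul]
      · obtain rfl : i = n := by omega
        exact haR
    have hcup : ∀ i, i + 2 ≤ n + 1 + 1 → wenzl N p (n + 1 + 1) * cup N (p + i) = 0 := by
      intro i hi
      rcases Nat.lt_or_ge i n with h | h
      · rw [← hRQ, mul_assoc, c' i (by omega), mul_zero]
      · obtain rfl : i = n := by omega
        exact hRb
    refine ⟨e1, wenzl_mul_of_cap hcap, hQR, hRQ, hcap, hcup, ?_⟩
    have h2 : cap N (p + (n + 1)) * Q = Q * cap N (p + (n + 1)) := cap_mul_wenzl_right le_rfl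
    have h3 : cup N (p + (n + 1)) * Q = Q * cup N (p + (n + 1)) := cup_mul_wenzl_right le_rfl
    have h4 : cap N (p + (n + 1)) * b = 1 := cap_succ_mul_cup N (p + n)
    have h5 : a * cup N (p + (n + 1)) = 1 := cap_mul_cup_succ N (p + n)
    -- Closing the new last leg of the correction term straightens two zigzags and returns `Q`,
    -- while the main term gives a loop `N`. The total `N - d_n / d_{n+1}` is `d_{n+2} / d_{n+1}`.
    have h6 : cap N (p + (n + 1)) * (Q * b * a * Q) * cup N (p + (n + 1)) = Q := by
      calc _ = (cap N (p + (n + 1)) * Q) * b * a * (Q * cup N (p + (n + 1))) := by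
            simp only [mul_assoc]
        _ = Q * (cap N (p + (n + 1)) * b) * (a * cup N (p + (n + 1))) * Q := by
            rw [h2, ← h3]; simp only [mul_assoc]
        _ = Q := by rw [h4, h5, mul_one, mul_one, e1]
    rw [hR, mul_sub, sub_mul, h2, mul_assoc Q, cap_mul_cup_self, mul_smul_comm, mul_smul_comm,
      smul_mul_assoc, h6, mul_one, chebC_add_two, sub_div, mul_div_cancel_right₀ _ hd1]
    exact (sub_smul _ _ _).symm

theorem wenzl_mul_self {N : ℕ} (hN : 2 ≤ N) (p n : ℕ) : wenzl N p n * wenzl N p n = wenzl N p n := (wenzl_aux hN p n).1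

theorem cap_mul_wenzl {N : ℕ} (hN : 2 ≤ N) {p n i : ℕ} (h : i + 2 ≤ n) : cap N (p + i) * wenzl N p n = 0 := by
  obtain ⟨n, rfl⟩ : ∃ m, n = m + 1 := ⟨n - 1, by omega⟩
  exact (wenzl_aux hN p n).2.2.2.2.1 i h

theorem wenzl_mul_cup {N : ℕ} (hN : 2 ≤ N) {p n i : ℕ} (h : i + 2 ≤ n) : wenzl N p n * cup N (p + i) = 0 := by
  obtain ⟨n, rfl⟩ : ∃ m, n = m + 1 := ⟨n - 1, by omega⟩
  exact (wenzl_aux hN p n).2.2.2.2.2.1 i h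

theorem cap_wenzl_cup {N : ℕ} (hN : 2 ≤ N) (p n : ℕ) : cap N (p + n) * wenzl N p (n + 1) * cup N (p + n)
    = (chebC N (n + 1) / chebC N n) • wenzl N p n := (wenzl_aux hN p n).2.2.2.2.2.2

theorem wenzl_mul_wenzl {N : ℕ} (hN : 2 ≤ N) {p n q m : ℕ} (h : p ≤ q) (h' : q + m ≤ p + n) :
    wenzl N p n * wenzl N q m = wenzl N p n := by
  refine mul_wenzl_of_cup fun i hi => ?_
  have := wenzl_mul_cup hN (p := p) (n := n) (i := q + i - p) (by omega)
  rwa [show p + (q + i - p) = q + i by omega] at this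

theorem wenzl_mul_wenzl' {N : ℕ} (hN : 2 ≤ N) {p n q m : ℕ} (h : p ≤ q) (h' : q + m ≤ p + n) :
    wenzl N q m * wenzl N p n = wenzl N p n := by
  refine wenzl_mul_of_cap fun i hi => ?_
  have := cap_mul_wenzl hN (p := p) (n := n) (i := q + i - p) (by omega)
  rwa [show p + (q + i - p) = q + i by omega] at this

/-- One-sided Wenzl recursion. Contracting the last leg straightens the insertion in the correction
term, leaving `P_{m+1}` times the same expression one degree lower; by induction this begins with
`P_m`, which `P_{m+1}` absorbs. Only single contractions remain to the right of the projection. -/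
theorem cap_mul_wenzl_succ {N : ℕ} (hN : 2 ≤ N) (m : ℕ) :
    cap N m * wenzl N 0 (m + 1)
      = wenzl N 0 m * ∑ l ∈ Finset.range (m + 1), wcoef N m l • cap N l := by
  induction m with
  | zero => simp [wenzl, wcoef, chebC_zero]
  | succ m ih =>
    have h2 : cap N (m + 1) * wenzl N 0 (m + 1) = wenzl N 0 (m + 1) * cap N (m + 1) :=
      cap_mul_wenzl_right (by omega)
    have h3 : wenzl N 0 (m + 1) * wenzl N 0 m = wenzl N 0 (m + 1) :=
      wenzl_mul_wenzl hN le_rfl (by omega)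
    have h4 : cap N (m + 1) * (wenzl N 0 (m + 1) * cup N m * cap N m * wenzl N 0 (m + 1))
        = wenzl N 0 (m + 1) * ∑ l ∈ Finset.range (m + 1), wcoef N m l • cap N l := by
      calc _ = (cap N (m + 1) * wenzl N 0 (m + 1)) * cup N m * (cap N m * wenzl N 0 (m + 1)) := by
            simp only [mul_assoc]
        _ = wenzl N 0 (m + 1) * (cap N (m + 1) * cup N m) * (cap N m * wenzl N 0 (m + 1)) := by
            rw [h2]; simp only [mul_assoc]
        _ = _ := by rw [cap_succ_mul_cup, mul_one, ih, ← mul_assoc, h3]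
    rw [wenzl_add_two, zero_add, mul_sub, mul_smul_comm, h4, h2, sum_wcoef_succ hN, mul_sub,
      mul_smul_comm]

theorem wenzl_succ_mul_cup {N : ℕ} (hN : 2 ≤ N) (m : ℕ) :
    wenzl N 0 (m + 1) * cup N m
      = (∑ l ∈ Finset.range (m + 1), wcoef N m l • cup N l) * wenzl N 0 m := by
  induction m with
  | zero => simp [wenzl, wcoef, chebC_zero]
  | succ m ih =>
    have h2 : wenzl N 0 (m + 1) * cup N (m + 1) = cup N (m + 1) * wenzl N 0 (m + 1) :=
      (cup_mul_wenzl_right (by omega)).symm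
    have h3 : wenzl N 0 m * wenzl N 0 (m + 1) = wenzl N 0 (m + 1) :=
      wenzl_mul_wenzl' hN le_rfl (by omega)
    have h4 : wenzl N 0 (m + 1) * cup N m * cap N m * wenzl N 0 (m + 1) * cup N (m + 1)
        = (∑ l ∈ Finset.range (m + 1), wcoef N m l • cup N l) * wenzl N 0 (m + 1) := by
      calc _ = wenzl N 0 (m + 1) * cup N m * cap N m * (wenzl N 0 (m + 1) * cup N (m + 1)) := by
            simp only [mul_assoc]
        _ = wenzl N 0 (m + 1) * cup N m * (cap N m * cup N (m + 1)) * wenzl N 0 (m + 1) := by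
            rw [h2]; simp only [mul_assoc]
        _ = _ := by rw [cap_mul_cup_succ, mul_one, ih, mul_assoc, h3]
    rw [wenzl_add_two, zero_add, sub_mul, smul_mul_assoc, h4, h2, sum_wcoef_succ hN, sub_mul,
      smul_mul_assoc]

/-! ### Partial traces of compressions -/

/-- All neighbouring contractions of `X` vanish cyclically, and the one-step rotations of `X` in
the two directions are `μ X` and `ν X`. -/
structure IsRotationEigen {N k : ℕ} (X : Mat N (k + 1)) (μ ν : ℂ) : Prop where
  cap_mul : ∀ p i, i + 2 ≤ k + 1 → cap N (p + i) * place p X = 0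
  mul_cup : ∀ p i, i + 2 ≤ k + 1 → place p X * cup N (p + i) = 0
  left : ∀ p, cap N p * place (p + 1) X * cup N p = 0
  right : ∀ p, cap N (p + k) * place p X * cup N (p + k) = 0
  rotate : ∀ p, cap N (p + (k + 1)) * place (p + 1) X * cup N p = μ • place p X
  rotate' : ∀ p, cap N p * place (p + 1) X * cup N (p + (k + 1)) = ν • place p X

theorem sum_range_ite_succ_eq {M : Type*} [AddCommMonoid M] (n p : ℕ) (f : ℕ → M) :
    ∑ l ∈ Finset.range n, (if l + 1 = p then f l else 0)
      = if 0 < p ∧ p ≤ n then f (p - 1) else 0 := by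
  cases p with
  | zero => simp
  | succ p => simp

namespace IsRotationEigen

variable {N k : ℕ} {X : Mat N (k + 1)} {μ ν : ℂ}

/-- The contraction at `p` joins the first output leg of `X` to the leg on its left. An insertion at
`l` with `l + 1 < p` or `l > p + k + 1` slides out to the left and is killed by `wenzl N 0 m`; one
inside `X` is killed by `X`; at `l = p` it forms the left partial trace. What remains is the zigzag
at `l = p - 1`, which shifts `X`, and the backward rotation at `l = p + k + 1`. -/
theorem left_term (hN : 2 ≤ N) (h : IsRotationEigen X μ ν) {m p l : ℕ} (hp : p + k + 1 ≤ m)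
    (hl : l ≤ m) : wenzl N 0 m * (cap N p * place (p + 1) X * cup N l) =
      (if l + 1 = p then wenzl N 0 m * place (p - 1) X else 0) +
      (if l = p + k + 1 then ν • (wenzl N 0 m * place p X) else 0) := by
  have kill : ∀ i, i + 2 ≤ m → wenzl N 0 m * cup N i = 0 := by
    intro i hi
    have := wenzl_mul_cup hN (p := 0) hi
    rwa [zero_add] at this
  rcases lt_trichotomy (l + 1) p with h1 | h1 | h1
  · obtain ⟨p, rfl⟩ : ∃ q, p = q + 2 := ⟨p - 2, by omega⟩
    rw [if_neg (by omega), if_neg (by omega), add_zero, mul_assoc, show p + 2 + 1 = p + 1 + 2 by omega,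
      ← cup_mul_place_left (by omega), ← mul_assoc (cap N _), cap_far_mul_cup (by omega)]
    simp only [← mul_assoc]
    rw [kill l (by omega)]
    simp
  · subst h1
    rw [if_pos rfl, if_neg (by omega), add_zero, mul_assoc (cap N _), show l + 1 + 1 = l + 2 by omega,
      ← cup_mul_place_left le_rfl, ← mul_assoc (cap N _), cap_succ_mul_cup, one_mul]
    rfl
  rw [if_neg (by omega), zero_add]
  rcases lt_trichotomy l (p + k + 1) with h2 | h2 | h2
  · rw [if_neg (by omega)]
    rcases Nat.lt_or_ge p l with h3 | h3
    · obtain ⟨i, rfl⟩ := Nat.exists_eq_add_of_le h3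
      rw [mul_assoc (cap N _), h.mul_cup (p + 1) i (by omega), mul_zero, mul_zero]
    · obtain rfl : l = p := by omega
      rw [h.left, mul_zero]
  · subst h2
    rw [if_pos rfl, add_assoc, h.rotate', mul_smul_comm]
  · obtain ⟨j, rfl⟩ : ∃ j, l = j + 2 := ⟨l - 2, by omega⟩
    rw [if_neg (by omega), mul_assoc (cap N _), ← cup_mul_place_right (by omega),
      ← mul_assoc (cap N _), cap_mul_cup_far (by omega)]
    simp only [← mul_assoc]
    rw [kill j (by omega)]
    simp

/-- Same analysis for the contraction joining the last output leg of `X` to the leg on its right.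
The roles are exchanged: the insertion on the left of `X` now produces the rotation, the one on the
right the zigzag. -/
theorem right_term (hN : 2 ≤ N) (h : IsRotationEigen X μ ν) {m p l : ℕ} (hp : p + k ≤ m)
    (hl : l ≤ m) : wenzl N 0 m * (cap N (p + k) * place p X * cup N l) =
      (if l + 1 = p then μ • (wenzl N 0 m * place (p - 1) X) else 0) +
      (if l = p + k + 1 then wenzl N 0 m * place p X else 0) := by
  have kill : ∀ i, i + 2 ≤ m → wenzl N 0 m * cup N i = 0 := by
    intro i hi
    have := wenzl_mul_cup hN (p := 0) hi
    rwa [zero_add] at this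
  rcases lt_trichotomy (l + 1) p with h1 | h1 | h1
  · obtain ⟨p, rfl⟩ : ∃ q, p = q + 2 := ⟨p - 2, by omega⟩
    rw [if_neg (by omega), if_neg (by omega), add_zero, mul_assoc (cap N _),
      ← cup_mul_place_left (by omega), ← mul_assoc (cap N _), show p + 2 + k = p + k + 2 by omega,
      cap_far_mul_cup (by omega)]
    simp only [← mul_assoc]
    rw [kill l (by omega)]
    simp
  · subst h1
    rw [if_pos rfl, if_neg (by omega), add_zero, show l + 1 + k = l + (k + 1) by omega, h.rotate,
      mul_smul_comm]
    rfl
  rw [if_neg (by omega), zero_add]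
  rcases lt_trichotomy l (p + k + 1) with h2 | h2 | h2
  · rw [if_neg (by omega)]
    rcases Nat.lt_or_ge l (p + k) with h3 | h3
    · obtain ⟨i, rfl⟩ := Nat.exists_eq_add_of_le (show p ≤ l by omega)
      rw [mul_assoc (cap N _), h.mul_cup p i (by omega), mul_zero, mul_zero]
    · obtain rfl : l = p + k := by omega
      rw [h.right, mul_zero]
  · subst h2
    rw [if_pos rfl, mul_assoc (cap N _), ← cup_mul_place_right (by omega),
      ← mul_assoc (cap N _), cap_mul_cup_succ, one_mul]
  · obtain ⟨j, rfl⟩ : ∃ j, l = j + 2 := ⟨l - 2, by omega⟩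
    rw [if_neg (by omega), mul_assoc (cap N _), ← cup_mul_place_right (by omega),
      ← mul_assoc (cap N _), cap_mul_cup_far (by omega)]
    simp only [← mul_assoc]
    rw [kill j (by omega)]
    simp

theorem left_sum (hN : 2 ≤ N) (h : IsRotationEigen X μ ν) {m p : ℕ} (hp : p + k + 1 ≤ m) :
    wenzl N 0 m * (cap N p * place (p + 1) X * (wenzl N 0 (m + 1) * cup N m)) =
      (if 0 < p then wcoef N m (p - 1) • (wenzl N 0 m * place (p - 1) X * wenzl N 0 m) else 0) +
      (wcoef N m (p + k + 1) * ν) • (wenzl N 0 m * place p X * wenzl N 0 m) := by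
  have h1 : ∀ l ∈ Finset.range (m + 1),
      wcoef N m l • (wenzl N 0 m * (cap N p * place (p + 1) X * cup N l)) =
      (if l + 1 = p then wcoef N m l • (wenzl N 0 m * place (p - 1) X) else 0) +
      (if l = p + k + 1 then (wcoef N m l * ν) • (wenzl N 0 m * place p X) else 0) := by
    intro l hl
    rw [h.left_term hN hp (by simpa [Nat.lt_succ_iff] using hl), smul_add]
    congr 1
    · split_ifs <;> simp
    · split_ifs <;> simp [mul_smul]
  rw [wenzl_succ_mul_cup hN, ← mul_assoc (cap N p * _), ← mul_assoc (wenzl N 0 m), Finset.mul_sum,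
    Finset.mul_sum]
  simp only [mul_smul_comm]
  rw [Finset.sum_congr rfl h1, Finset.sum_add_distrib, sum_range_ite_succ_eq, Finset.sum_ite_eq',
    add_mul]
  congr 1
  · by_cases h0 : 0 < p
    · rw [if_pos ⟨h0, by omega⟩, if_pos h0, smul_mul_assoc]
    · rw [if_neg (by omega), if_neg h0, zero_mul]
  · rw [if_pos (by simp; omega), smul_mul_assoc]

theorem right_sum (hN : 2 ≤ N) (h : IsRotationEigen X μ ν) {m p : ℕ} (hp : p + k ≤ m) :
    wenzl N 0 m * (cap N (p + k) * place p X * (wenzl N 0 (m + 1) * cup N m)) =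
      (if 0 < p then
        (wcoef N m (p - 1) * μ) • (wenzl N 0 m * place (p - 1) X * wenzl N 0 m) else 0) +
      (if p + k < m then
        wcoef N m (p + k + 1) • (wenzl N 0 m * place p X * wenzl N 0 m) else 0) := by
  have h1 : ∀ l ∈ Finset.range (m + 1),
      wcoef N m l • (wenzl N 0 m * (cap N (p + k) * place p X * cup N l)) =
      (if l + 1 = p then (wcoef N m l * μ) • (wenzl N 0 m * place (p - 1) X) else 0) +
      (if l = p + k + 1 then wcoef N m l • (wenzl N 0 m * place p X) else 0) := by
    intro l hl
    rw [h.right_term hN hp (by simpa [Nat.lt_succ_iff] using hl), smul_add]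
    congr 1
    · split_ifs <;> simp [mul_smul]
    · split_ifs <;> simp
  rw [wenzl_succ_mul_cup hN, ← mul_assoc (cap N _ * _), ← mul_assoc (wenzl N 0 m), Finset.mul_sum,
    Finset.mul_sum]
  simp only [mul_smul_comm]
  rw [Finset.sum_congr rfl h1, Finset.sum_add_distrib, sum_range_ite_succ_eq, Finset.sum_ite_eq',
    add_mul]
  congr 1
  · by_cases h0 : 0 < p
    · rw [if_pos ⟨h0, by omega⟩, if_pos h0, smul_mul_assoc]
    · rw [if_neg (by omega), if_neg h0, zero_mul]
  -- The insertion at `p + k + 1` belongs to the sum exactly when `X` does not reach the last leg.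
  -- This is one source of the condition `p < n - k` on the diagonal term.
  · by_cases h0 : p + k < m
    · rw [if_pos (by simp; omega), if_pos h0, smul_mul_assoc]
    · rw [if_neg (by simp; omega), if_neg h0, zero_mul]

/-- Only three terms of the one-sided recursion survive in the partial trace. -/
theorem term_eq (hN : 2 ≤ N) (h : IsRotationEigen X μ ν) {m p l : ℕ} (hp : p + k ≤ m)
    (hl : l ≤ m) :
    wenzl N 0 m * (cap N l * place p X * (wenzl N 0 (m + 1) * cup N m)) =
      (if l + 1 = p then
        wenzl N 0 m * (cap N (p - 1) * place p X * (wenzl N 0 (m + 1) * cup N m)) else 0) +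
      (if l = p + k then
        wenzl N 0 m * (cap N (p + k) * place p X * (wenzl N 0 (m + 1) * cup N m)) else 0) +
      (if l = m then if p + k < m then
        (chebC N (m + 1) / chebC N m) • (wenzl N 0 m * place p X * wenzl N 0 m) else 0 else 0) := by
  have kill : ∀ i, i + 2 ≤ m + 1 → cap N i * (wenzl N 0 (m + 1) * cup N m) = 0 := by
    intro i hi
    have := cap_mul_wenzl hN (p := 0) hi
    rw [zero_add] at this
    rw [← mul_assoc, this, zero_mul]
  -- A contraction away from `X` slides past it and meets `wenzl N 0 (m + 1)`, which kills it unless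
  -- `l = m`; a contraction inside `X` is zero.
  rcases lt_trichotomy (l + 1) p with h1 | h1 | h1
  · obtain ⟨p, rfl⟩ : ∃ q, p = q + 2 := ⟨p - 2, by omega⟩
    rw [if_neg (by omega), if_neg (by omega), if_neg (by omega), cap_mul_place_left (by omega),
      mul_assoc (place _ _), kill l (by omega)]
    simp
  · subst h1
    rw [if_pos rfl, if_neg (by omega), if_neg (by omega), add_zero, add_zero]
    rfl
  rw [if_neg (by omega), zero_add]
  rcases lt_trichotomy l (p + k) with h2 | h2 | h2
  · obtain ⟨i, rfl⟩ := Nat.exists_eq_add_of_le (show p ≤ l by omega)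
    rw [if_neg (by omega), if_neg (by omega), h.cap_mul p i (by omega)]
    simp
  · subst h2
    rw [if_pos rfl]
    -- If `X` reaches the last leg, the contraction at its right border is also the last one; the
    -- condition `p + k < m` in the third term prevents counting it twice.
    by_cases h3 : p + k = m
    · rw [if_pos h3, if_neg (by omega), add_zero]
    · rw [if_neg h3, add_zero]
  · rw [if_neg (by omega), zero_add, cap_mul_place_right (by omega), mul_assoc (place _ _)]
    by_cases h3 : l = m
    · subst h3
      have := cap_wenzl_cup hN 0 l
      rw [zero_add] at this
      rw [if_pos rfl, if_pos h2, ← mul_assoc (cap N _), this, mul_smul_comm, mul_smul_comm,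
        mul_assoc]
    · rw [if_neg h3, kill l (by omega), mul_zero, mul_zero]

theorem cap_compress_cup_aux (hN : 2 ≤ N) (h : IsRotationEigen X μ ν) {m p : ℕ} (hp : p + k ≤ m) :
    cap N m * (wenzl N 0 (m + 1) * place p X * wenzl N 0 (m + 1)) * cup N m =
      (if 0 < p then wcoef N m (p - 1) •
        (wenzl N 0 m * (cap N (p - 1) * place p X * (wenzl N 0 (m + 1) * cup N m))) else 0) +
      wcoef N m (p + k) •
        (wenzl N 0 m * (cap N (p + k) * place p X * (wenzl N 0 (m + 1) * cup N m))) +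
      (if p + k < m then
        (chebC N (m + 1) / chebC N m) • (wenzl N 0 m * place p X * wenzl N 0 m) else 0) := by
  have h0 : cap N m * (wenzl N 0 (m + 1) * place p X * wenzl N 0 (m + 1)) * cup N m
      = (cap N m * wenzl N 0 (m + 1)) * (place p X * (wenzl N 0 (m + 1) * cup N m)) := by
    simp only [mul_assoc]
  rw [h0, cap_mul_wenzl_succ hN, mul_assoc, Finset.sum_mul, Finset.mul_sum]
  simp only [smul_mul_assoc, mul_smul_comm]
  have h1 : ∀ l ∈ Finset.range (m + 1), wcoef N m l •
      (wenzl N 0 m * (cap N l * (place p X * (wenzl N 0 (m + 1) * cup N m)))) =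
      (if l + 1 = p then wcoef N m l •
        (wenzl N 0 m * (cap N (p - 1) * place p X * (wenzl N 0 (m + 1) * cup N m))) else 0) +
      (if l = p + k then wcoef N m l •
        (wenzl N 0 m * (cap N (p + k) * place p X * (wenzl N 0 (m + 1) * cup N m))) else 0) +
      (if l = m then wcoef N m l • (if p + k < m then
        (chebC N (m + 1) / chebC N m) • (wenzl N 0 m * place p X * wenzl N 0 m) else 0) else 0) := by
    intro l hl
    rw [← mul_assoc (cap N l), h.term_eq hN hp (by simpa [Nat.lt_succ_iff] using hl), smul_add, smul_add]
    simp only [smul_ite, smul_zero]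
  rw [Finset.sum_congr rfl h1, Finset.sum_add_distrib, Finset.sum_add_distrib,
    sum_range_ite_succ_eq, Finset.sum_ite_eq', Finset.sum_ite_eq',
    if_pos (show p + k ∈ Finset.range (m + 1) by simp; omega),
    if_pos (show m ∈ Finset.range (m + 1) by simp), wcoef_self hN, one_smul]
  congr 2
  by_cases h0 : 0 < p
  · rw [if_pos ⟨h0, by omega⟩, if_pos h0]
  · rw [if_neg (by omega), if_neg h0]

/-- The partial trace over the last leg of the compression of `1 ⊗ X ⊗ 1`. -/
theorem cap_compress_cup (hN : 2 ≤ N) (h : IsRotationEigen X μ ν) {m p : ℕ} (hp : p + k ≤ m) :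
    cap N m * (wenzl N 0 (m + 1) * place p X * wenzl N 0 (m + 1)) * cup N m =
      (chebC N (m + 1) / chebC N m) • (
      (if p + k < m then (1 - chebC N (p + k + 1) * chebC N (p + k) /
        (chebC N (m + 1) * chebC N m)) • (wenzl N 0 m * place p X * wenzl N 0 m) else 0) +
      (if 0 < p then ((μ + ν) * (-1) ^ (k + 1) * (chebC N (p + k) * chebC N (p - 1) /
        (chebC N (m + 1) * chebC N m))) •
          (wenzl N 0 m * place (p - 1) X * wenzl N 0 m) else 0) +
      (if 1 < p then (-(chebC N (p - 1) * chebC N (p - 2) /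
        (chebC N (m + 1) * chebC N m))) •
          (wenzl N 0 m * place (p - 2) X * wenzl N 0 m) else 0)) := by
  have d0 := chebC_ne_zero hN m
  have d1 := chebC_ne_zero hN (m + 1)
  -- Consecutive coefficients have opposite signs: this is the minus sign in front of `A` and in
  -- `C`.
  have s1 : ∀ l, wcoef N m (l + 1) * wcoef N m l
      = -(chebC N (l + 1) * chebC N l / (chebC N m * chebC N m)) := by
    intro l
    have : ((-1 : ℂ) ^ (m + (l + 1))) * (-1) ^ (m + l) = -1 := by
      rw [← pow_add, show m + (l + 1) + (m + l) = 2 * (m + l) + 1 by ring, pow_succ, pow_mul]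
      simp
    rw [wcoef, wcoef, mul_mul_mul_comm, this]
    field_simp
  -- The two contractions producing a rotation lie at distance `k + 1`, the number of legs of `X`,
  -- whence the sign in `B`.
  have s2 : ∀ l, wcoef N m (l + k + 1) * wcoef N m l
      = (-1) ^ (k + 1) * (chebC N (l + k + 1) * chebC N l / (chebC N m * chebC N m)) := by
    intro l
    have : ((-1 : ℂ) ^ (m + (l + k + 1))) * (-1) ^ (m + l) = (-1) ^ (k + 1) := by
      rw [← pow_add, show m + (l + k + 1) + (m + l) = 2 * (m + l) + (k + 1) by ring, pow_add, pow_mul]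
      simp
    rw [wcoef, wcoef, mul_mul_mul_comm, this]
    field_simp
  rw [h.cap_compress_cup_aux hN hp, h.right_sum hN hp]
  rcases p with _ | p
  · simp only [lt_irrefl, if_false, not_lt_zero, zero_add, add_zero]
    split_ifs with h3
    · rw [smul_smul, ← add_smul, smul_smul]
      congr 1
      rw [mul_comm, s1]
      field_simp
      ring
    · simp
  · rw [if_pos (Nat.succ_pos p), if_pos (Nat.succ_pos p), if_pos (Nat.succ_pos p),
      Nat.add_sub_cancel, h.left_sum hN (show p + k + 1 ≤ m by omega)]
    set F0 := wenzl N 0 m * place (p + 1) X * wenzl N 0 m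
    set F1 := wenzl N 0 m * place p X * wenzl N 0 m
    -- Both rotations land at the same position with the same coefficient, so the eigenvalues add
    -- up.
    have hB : (wcoef N m p * (wcoef N m (p + k + 1) * ν)) • F1 +
        (wcoef N m (p + 1 + k) * (wcoef N m p * μ)) • F1
        = (chebC N (m + 1) / chebC N m) • ((μ + ν) * (-1) ^ (k + 1) *
          (chebC N (p + 1 + k) * chebC N p / (chebC N (m + 1) * chebC N m))) • F1 := by
      rw [← add_smul, smul_smul]
      congr 1
      rw [show p + 1 + k = p + k + 1 by omega]
      linear_combination (norm := skip) (μ + ν) * s2 p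
      field_simp
      ring
    have hA : (if p + 1 + k < m then (wcoef N m (p + 1 + k) * wcoef N m (p + 1 + k + 1)) • F0
        else 0) + (if p + 1 + k < m then (chebC N (m + 1) / chebC N m) • F0 else 0)
        = (chebC N (m + 1) / chebC N m) • (if p + 1 + k < m then
          (1 - chebC N (p + 1 + k + 1) * chebC N (p + 1 + k) /
          (chebC N (m + 1) * chebC N m)) • F0 else 0) := by
      split_ifs
      · rw [← add_smul, smul_smul]
        congr 1
        rw [mul_comm (wcoef _ _ _), s1]
        field_simp
        ring
      · simp
    have hC : (if 0 < p then (wcoef N m p * wcoef N m (p - 1)) •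
          (wenzl N 0 m * place (p - 1) X * wenzl N 0 m) else 0)
        = (chebC N (m + 1) / chebC N m) • (if 1 < p + 1 then (-(chebC N p *
          chebC N (p + 1 - 2) / (chebC N (m + 1) * chebC N m))) •
          (wenzl N 0 m * place (p + 1 - 2) X * wenzl N 0 m) else 0) := by
      rcases p with _ | p
      · simp
      · rw [if_pos (by omega), if_pos (by omega), smul_smul]
        rw [show p + 1 + 1 - 2 = p by omega, Nat.add_sub_cancel, s1]
        congr 1
        field_simp
    simp only [smul_add] at hA hB hC ⊢
    rw [← hA, ← hB, ← hC]
    simp only [smul_ite, smul_zero, smul_smul]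
    abel

end IsRotationEigen

/-! ### Tensor powers of the fundamental corepresentation -/

/-- The tensor power `u^{⊗ k}`, as a matrix over `Pol N`. -/
def uPow (N k : ℕ) : Matrix (Word N k) (Word N k) (Pol N) := fun a b =>
  (List.ofFn fun i => u (a i) (b i)).prod

theorem coeff_apply {N k : ℕ} (X : Mat N k) : coeff N k X = ∑ a, ∑ b, X b a • uPow N k a b := rfl

theorem uPow_append {N k l : ℕ} (a b : Word N k) (c d : Word N l) :
    uPow N (k + l) (Fin.append a c) (Fin.append b d) = uPow N k a b * uPow N l c d := by
  rw [uPow, uPow, uPow, ← List.prod_append, ← List.ofFn_fin_append]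
  congr 2
  funext i
  refine Fin.addCases (fun j => ?_) (fun j => ?_) i <;> simp

/-- Turns a product in the algebra, in particular `χ_i x χ_j`, into a single coefficient of a tensor
power of `u`. -/
theorem coeff_tensor {N k l : ℕ} (A : Mat N k) (B : Mat N l) :
    coeff N (k + l) (tensor A B) = coeff N k A * coeff N l B := by
  simp only [coeff_apply, sum_append, tensor_append, uPow_append, Finset.sum_mul_sum,
    smul_mul_smul_comm]

/-- A scalar matrix as a matrix over `Pol N`. -/
def scalarMat {N k : ℕ} (A : Mat N k) : Matrix (Word N k) (Word N k) (Pol N) :=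
  (algebraMap ℂ (Pol N)).mapMatrix A

/-- `A` is an intertwiner of `u^{⊗ k}`. -/
def Intertwines {N k : ℕ} (A : Mat N k) : Prop := Commute (scalarMat A) (uPow N k)

theorem scalarMat_mul_apply {N k : ℕ} (A : Mat N k) (a b : Word N k) :
    (scalarMat A * uPow N k) a b = ∑ c, A a c • uPow N k c b := by
  simp [Matrix.mul_apply, scalarMat, Algebra.smul_def]

theorem mul_scalarMat_apply {N k : ℕ} (A : Mat N k) (a b : Word N k) :
    (uPow N k * scalarMat A) a b = ∑ c, A c b • uPow N k a c := by
  simp [Matrix.mul_apply, scalarMat, Algebra.smul_def, Algebra.commutes]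

theorem intertwines_iff {N k : ℕ} {A : Mat N k} : Intertwines A ↔
    ∀ a b, ∑ c, A a c • uPow N k c b = ∑ c, A c b • uPow N k a c := by
  rw [Intertwines, commute_iff_eq, ← Matrix.ext_iff]
  simp only [scalarMat_mul_apply, mul_scalarMat_apply]

namespace Intertwines

variable {N k l : ℕ}

theorem one : Intertwines (1 : Mat N k) := by
  rw [Intertwines, scalarMat, map_one]
  exact Commute.one_left _

theorem mul {A B : Mat N k} (hA : Intertwines A) (hB : Intertwines B) : Intertwines (A * B) := by
  rw [Intertwines, scalarMat, map_mul]
  exact Commute.mul_left hA hB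

theorem sub {A B : Mat N k} (hA : Intertwines A) (hB : Intertwines B) : Intertwines (A - B) := by
  rw [Intertwines, scalarMat, map_sub]
  exact Commute.sub_left hA hB

theorem smul (r : ℂ) {A : Mat N k} (hA : Intertwines A) : Intertwines (r • A) := by
  rw [intertwines_iff] at *
  intro a b
  simp only [Matrix.smul_apply, smul_assoc, ← Finset.smul_sum, hA]

theorem tensor {A : Mat N k} {B : Mat N l} (hA : Intertwines A) (hB : Intertwines B) :
    Intertwines (tensor A B) := by
  rw [intertwines_iff] at *
  intro a b
  rw [← Fin.append_castAdd_natAdd (f := a), ← Fin.append_castAdd_natAdd (f := b)]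
  simp only [sum_append, tensor_append, uPow_append, ← smul_mul_smul_comm, ← Finset.sum_mul_sum]
  rw [hA, hB]

/-- The row relations say that `t*` is an intertwiner, the column relations that `t` is one; here
both are used for `t t*`. -/
theorem cupCap : Intertwines (cupCap N) := by
  rw [intertwines_iff]
  intro a b
  have h1 : ∀ f : Word N 2 → Pol N, ∑ c, f c = ∑ s, ∑ t, f ![s, t] := by
    intro f
    rw [← (finTwoArrowEquiv (Fin N)).symm.sum_comp, Fintype.sum_prod_type]
    rfl
  have h2 : ∀ c d : Word N 2, uPow N 2 c d = u (c 0) (d 0) * u (c 1) (d 1) := by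
    intro c d
    simp [uPow, List.ofFn_succ]
  simp only [h1, h2, FreeOrth.cupCap, Matrix.cons_val_zero, Matrix.cons_val_one]
  by_cases ha : a 0 = a 1
  · by_cases hb : b 0 = b 1
    · simp [ha, hb, u_row, u_col]
    · simp [ha, hb, u_col]
  · by_cases hb : b 0 = b 1
    · simp [ha, hb, u_row]
    · simp [ha, hb]

end Intertwines

/-! ### Identification of the projections onto `H_k` -/

theorem cupCap_isHermitian (N : ℕ) : (cupCap N).conjTranspose = cupCap N := by
  ext a b
  simp only [Matrix.conjTranspose_apply, cupCap, and_comm]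
  split_ifs <;> simp

/-- The Jones-Wenzl projections are given by Hermitian intertwiners. -/
theorem exists_wenzl_matrix (N n : ℕ) : ∃ J : Mat N n, J.conjTranspose = J ∧ Intertwines J ∧
    ∀ p, place p J = wenzl N p n := by
  induction n using Nat.twoStepInduction with
  | zero => exact ⟨1, by simp, Intertwines.one, fun p => by rw [place_one, wenzl_zero]⟩
  | one => exact ⟨1, by simp, Intertwines.one, fun p => by rw [place_one, wenzl_one]⟩
  | more n _ ih =>
    obtain ⟨J, hJ, hJ', hp⟩ := ih
    let A : Mat N (n + 1 + 1) := tensor J (1 : Mat N 1)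
    let T : Mat N (n + 2) := tensor (1 : Mat N n) (cupCap N)
    have hA : A.conjTranspose = A :=
      (tensor_conjTranspose J (1 : Mat N 1)).trans (by rw [hJ, Matrix.conjTranspose_one])
    have hT : T.conjTranspose = T :=
      (tensor_conjTranspose (1 : Mat N n) (cupCap N)).trans
        (by rw [cupCap_isHermitian, Matrix.conjTranspose_one])
    have iA : Intertwines A := Intertwines.tensor hJ' Intertwines.one
    have iT : Intertwines T := Intertwines.tensor Intertwines.one Intertwines.cupCap
    have pA : ∀ p, place p A = wenzl N p (n + 1) := by
      intro p
      have := place_tensor p J (1 : Mat N 1)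
      rwa [place_one, mul_one, hp] at this
    have pT : ∀ p, place p T = cup N (p + n) * cap N (p + n) := by
      intro p
      have := place_tensor p (1 : Mat N n) (cupCap N)
      rwa [place_one, one_mul, place_cupCap] at this
    refine ⟨A - (chebC N n / chebC N (n + 1)) • (A * T * A), ?_,
      iA.sub (((iA.mul iT).mul iA).smul _), fun p => ?_⟩
    · have hr : star (chebC N n / chebC N (n + 1)) = chebC N n / chebC N (n + 1) := by
        simp [chebC]
      rw [Matrix.conjTranspose_sub, Matrix.conjTranspose_smul, Matrix.conjTranspose_mul,
        Matrix.conjTranspose_mul, hA, hT, hr, mul_assoc]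
    · rw [place_sub, place_smul, place_mul, place_mul, pA, pT, wenzl_add_two]
      simp only [mul_assoc]

/-- Dictionary between the coordinates defining `H_k`, where two entries of a word are overwritten,
and the contractions `cap`, where two entries are inserted. -/
theorem mem_Hsub_iff {N k : ℕ} (hN : 0 < N) {f : EuclideanSpace ℂ (Word N k)} :
    f ∈ Hsub N k ↔ ∀ i, i + 2 ≤ k → cap N i (extend f.ofLp) = 0 := by
  have key : ∀ (i j : Fin k) (_ : (j : ℕ) = i + 1) (c : Word N k) (w : ℕ → Fin N) (s : Fin N),
      (∀ m : Fin k, m ≠ i → m ≠ j → c m = insPair i s w m) →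
      window k 0 (insPair i s w) = Function.update (Function.update c i s) j s := by
    intro i j hij c w s h
    funext m
    have hji : j ≠ i := fun h => by rw [h] at hij; omega
    by_cases hj : m = j
    · subst hj
      simp [window, insPair, hij]
    · by_cases hi : m = i
      · subst hi
        simp [window, insPair, Ne.symm hji]
      · simp only [Function.update_of_ne hj, Function.update_of_ne hi, h m hi hj, window, zero_add]
  constructor
  · intro hf i hi
    ext w
    have := hf ⟨i, by omega⟩ ⟨i + 1, by omega⟩ rfl (window k 0 (insPair i ⟨0, hN⟩ w))
    rw [cap_apply]
    simp only [extend, Pi.zero_apply]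
    rw [← this]
    refine Finset.sum_congr rfl fun s _ => ?_
    rw [key ⟨i, by omega⟩ ⟨i + 1, by omega⟩ rfl (window k 0 (insPair i ⟨0, hN⟩ w)) w s]
    intro m h1 h2
    rw [ne_eq, Fin.ext_iff] at h1 h2
    simp only [window, insPair, zero_add]
    split_ifs
    · rfl
    · exfalso; simp only at h1 h2; omega
    · rfl
  · intro hf i j hij c
    -- The contraction of the legs `i, j` ignores these two entries of `c`; they are deleted here,
    -- and `insPair` puts the summation index in their place.
    have h0 := congrFun (hf i (by omega)) (delPair i (overwrite 0 c fun _ => ⟨0, hN⟩))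
    rw [cap_apply] at h0
    simp only [extend, Pi.zero_apply] at h0
    rw [← h0]
    refine Finset.sum_congr rfl fun s _ => ?_
    rw [key i j hij c]
    intro m h1 h2
    rw [ne_eq, Fin.ext_iff] at h1 h2
    have h3 := overwrite_add (p := 0) c (fun _ => ⟨0, hN⟩) m
    rw [← h3, zero_add]
    simp only [insPair, delPair]
    split_ifs <;> first | rfl | omega | (congr 1; omega)

/-- The matrix from Wenzl's recursion has range in `H_n`, since all contractions kill it, fixes
`H_n`, since each correction term begins by contracting, and is Hermitian. These properties
characterise the orthogonal projection. -/
theorem jw_spec {N : ℕ} (hN : 2 ≤ N) (n : ℕ) : (jw N n).conjTranspose = jw N n ∧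
    Intertwines (jw N n) ∧ ∀ p, place p (jw N n) = wenzl N p n := by
  obtain ⟨J, h1, h2, h3⟩ := exists_wenzl_matrix N n
  suffices h : jw N n = J by rw [h]; exact ⟨h1, h2, h3⟩
  have hN0 : 0 < N := by omega
  have h4 : ∀ f : Word N n → ℂ, extend (J.mulVec f) = wenzl N 0 n (extend f) := by
    intro f
    rw [← h3, place_extend]
  have hmem : ∀ f : EuclideanSpace ℂ (Word N n), WithLp.toLp 2 (J.mulVec f.ofLp) ∈ Hsub N n := by
    intro f
    rw [mem_Hsub_iff hN0]
    intro i hi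
    have := cap_mul_wenzl hN (p := 0) hi
    rw [zero_add] at this
    rw [h4]
    exact LinearMap.congr_fun this _
  have hfix : ∀ f ∈ Hsub N n, J.mulVec f.ofLp = f.ofLp := by
    intro f hf
    refine extend_injective hN0 ?_
    rw [h4]
    refine wenzl_apply_of_cap fun i hi => ?_
    rw [zero_add]
    exact (mem_Hsub_iff hN0).1 hf i hi
  ext a b
  have h5 : (Hsub N n).starProjection (EuclideanSpace.single b 1)
      = WithLp.toLp 2 (J.mulVec (EuclideanSpace.single b (1 : ℂ)).ofLp) := by
    refine Submodule.eq_starProjection_of_mem_of_inner_eq_zero (hmem _) fun w hw => ?_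
    rw [inner_sub_left, EuclideanSpace.inner_eq_star_dotProduct,
      EuclideanSpace.inner_eq_star_dotProduct, Matrix.star_mulVec, h1, dotProduct_comm,
      dotProduct_comm w.ofLp, ← Matrix.dotProduct_mulVec, hfix w hw, sub_self]
  rw [jw, h5]
  simp

theorem place_jw {N : ℕ} (hN : 2 ≤ N) (p n : ℕ) : place p (jw N n) = wenzl N p n :=
  (jw_spec hN n).2.2 p

theorem jw_conjTranspose {N : ℕ} (hN : 2 ≤ N) (n : ℕ) : (jw N n).conjTranspose = jw N n :=
  (jw_spec hN n).1

theorem jw_intertwines {N : ℕ} (hN : 2 ≤ N) (n : ℕ) : Intertwines (jw N n) :=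
  (jw_spec hN n).2.1

theorem jw_mul_self {N : ℕ} (hN : 2 ≤ N) (n : ℕ) : jw N n * jw N n = jw N n := by
  refine place_injective (by omega) ?_
  rw [place_mul, place_jw hN, wenzl_mul_self hN]

theorem trace_jw (N n : ℕ) : (jw N n).trace = qdim N n := by
  let b := (EuclideanSpace.basisFun (Word N n) ℂ).toBasis
  let f : EuclideanSpace ℂ (Word N n) →ₗ[ℂ] EuclideanSpace ℂ (Word N n) :=
    (Hsub N n).starProjection.toLinearMap
  have h1 : LinearMap.toMatrix b b f = jw N n := by
    ext a c
    simp [LinearMap.toMatrix_apply, b, f, jw]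
  have h2 : LinearMap.IsProj (Hsub N n) f :=
    ⟨fun x => Submodule.starProjection_apply_mem _ x,
      fun x hx => Submodule.starProjection_eq_self_iff.2 hx⟩
  rw [← h1, ← LinearMap.trace_eq_matrix_trace, h2.trace]
  rfl

/-- Tracing out one leg of `P_{n+1}` gives `(d_{n+1} / d_n) P_n` for the Chebyshev numbers, so the
ratios of successive traces telescope from `d_0 = 1`. -/
theorem qdim_eq {N : ℕ} (hN : 2 ≤ N) (n : ℕ) : (qdim N n : ℂ) = chebC N n := by
  induction n with
  | zero =>
    rw [← trace_jw, chebC_zero]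
    have : jw N 0 = 1 := place_injective (by omega) (by rw [place_jw hN, place_one, wenzl_zero])
    rw [this, Matrix.trace_one]
    simp
  | succ n ih =>
    have d0 := chebC_ne_zero hN n
    have h1 : trRight N (n + 1) (jw N (n + 1)) = (chebC N (n + 1) / chebC N n) • jw N n := by
      refine place_injective (k := n) (by omega) ?_
      have := cap_place_cup_right 0 (jw N (n + 1))
      rw [place_smul, place_jw hN, ← cap_wenzl_cup hN, ← place_jw hN]
      exact this.symm
    rw [← trace_jw, ← trace_trRight, h1, Matrix.trace_smul, trace_jw, ih, smul_eq_mul,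
      div_mul_cancel₀ _ d0]

/-! ### The rotation on `B(H_k)°°` -/

theorem mem_endH_iff {N k : ℕ} {X : Mat N k} : X ∈ endH N k ↔ jw N k * X * jw N k = X := Iff.rfl

theorem cap_mul_place_of_mem {N k : ℕ} (hN : 2 ≤ N) {X : Mat N k} (hX : X ∈ endH N k) (p : ℕ)
    {i : ℕ} (hi : i + 2 ≤ k) : cap N (p + i) * place p X = 0 := by
  rw [← mem_endH_iff.1 hX, place_mul, place_mul, place_jw hN, ← mul_assoc, ← mul_assoc,
    cap_mul_wenzl hN hi, zero_mul, zero_mul]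

theorem place_mul_cup_of_mem {N k : ℕ} (hN : 2 ≤ N) {X : Mat N k} (hX : X ∈ endH N k) (p : ℕ)
    {i : ℕ} (hi : i + 2 ≤ k) : place p X * cup N (p + i) = 0 := by
  rw [← mem_endH_iff.1 hX, place_mul, place_mul, place_jw hN, mul_assoc, wenzl_mul_cup hN hi,
    mul_zero]

/-- The rotation preserves the Hilbert-Schmidt norm. -/
theorem sum_rawRot {N k : ℕ} (X : Mat N (k + 1)) :
    ∑ x : Word N (k + 1) × Word N (k + 1), star (rawRot X x.1 x.2) * rawRot X x.1 x.2
      = ∑ x : Word N (k + 1) × Word N (k + 1), star (X x.1 x.2) * X x.1 x.2 := by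
  let g : Word N (k + 1) × Word N (k + 1) → Word N (k + 1) × Word N (k + 1) := fun x =>
    (Fin.snoc (α := fun _ => Fin N) (Fin.tail x.1) (x.2 (Fin.last k)),
      Fin.cons (x.1 0) (Fin.init x.2))
  have hg : Function.Injective g := by
    rintro ⟨a, b⟩ ⟨a', b'⟩ h
    simp only [g, Prod.mk.injEq] at h
    obtain ⟨h1, h2⟩ := h
    have h3 := congrFun h1 (Fin.last k)
    have h4 := congrArg Fin.init h1
    have h5 := congrFun h2 0
    have h6 := congrArg Fin.tail h2
    simp only [Fin.snoc_last, Fin.init_snoc, Fin.cons_zero, Fin.tail_cons] at h3 h4 h5 h6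
    rw [← Fin.cons_self_tail a, ← Fin.cons_self_tail a', ← Fin.snoc_init_self b,
      ← Fin.snoc_init_self b', h3, h4, h5, h6]
  have hb := Finite.injective_iff_bijective.1 hg
  exact hb.sum_comp (fun x => star (X x.1 x.2) * X x.1 x.2)

/-- An eigenvalue of an isometry of the Hilbert-Schmidt norm has modulus one. -/
theorem norm_of_rawRot_eq {N k : ℕ} {X : Mat N (k + 1)} {μ : ℂ} (h : rawRot X = μ • X)
    (hX : X ≠ 0) : star μ * μ = 1 := by
  have h1 := sum_rawRot X
  rw [h] at h1
  have h2 : ∀ x : Word N (k + 1) × Word N (k + 1),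
      star ((μ • X) x.1 x.2) * (μ • X) x.1 x.2 = (star μ * μ) * (star (X x.1 x.2) * X x.1 x.2) := by
    intro x
    rw [Matrix.smul_apply, smul_eq_mul, star_mul']
    ring
  simp only [h2, ← Finset.mul_sum] at h1
  refine (mul_eq_right₀ fun h0 => hX ?_).1 h1
  rw [Finset.sum_eq_zero_iff_of_nonneg fun x _ => star_mul_self_nonneg _] at h0
  ext a b
  simpa using h0 (a, b) (Finset.mem_univ _)

/-- The vanishing of both partial traces makes the uncompressed rotation of `X` stay in `B(H_k)`: a
contraction of neighbouring legs of the rotated matrix is either one of `X` or a partial trace of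
`X`. Hence the projections in `ρ` act trivially, `X` is an eigenvector of a genuine permutation of
entries, and the inverse rotation has the conjugate eigenvalue. -/
theorem isRotationEigen {N k : ℕ} (hN : 2 ≤ N) {X : Mat N (k + 1)} (hX : X ∈ endHcc N (k + 1))
    {μ : ℂ} (hμ : rot N (k + 1) X = μ • X) : IsRotationEigen X μ (star μ) := by
  obtain ⟨hE, hl, hr⟩ := hX
  have left : ∀ p, cap N p * place (p + 1) X * cup N p = 0 := by
    intro p
    rw [cap_place_cup_left, hl]
    exact place_zero (k := k) p
  have right : ∀ p, cap N (p + k) * place p X * cup N (p + k) = 0 := by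
    intro p
    rw [cap_place_cup_right, hr]
    exact place_zero (k := k) p
  have raw : rawRot X = μ • X := by
    rw [← hμ, rot_eq]
    have h0 := cap_place_cup_rot 0 X
    refine (place_injective (by omega) ?_).symm
    rw [place_mul, place_mul, place_jw hN, wenzl_mul_of_cap, mul_wenzl_of_cup]
    · intro i hi
      rw [← h0]
      simp only [zero_add]
      rw [mul_assoc, ← cup_mul_cup (Nat.zero_le i), ← mul_assoc,
        mul_assoc (cap N _)]
      rcases Nat.lt_or_ge i (k - 1) with h | h
      · have := place_mul_cup_of_mem hN hE 1 (i := i + 1) (by omega)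
        rw [show 1 + (i + 1) = i + 2 by omega] at this
        rw [this, mul_zero, zero_mul]
      -- The inserted pair joins the last input leg of `X` to the leg contracted with its last
      -- output leg, forming the right partial trace.
      · have := right 1
        rw [show 1 + k = k + 1 by omega] at this
        rw [show i + 2 = k + 1 by omega, ← mul_assoc, this, zero_mul]
    · intro i hi
      have hi' : i ≤ k - 1 := by omega
      rw [← h0]
      simp only [zero_add]
      rw [← mul_assoc, ← mul_assoc]
      obtain ⟨j, rfl⟩ : ∃ j, k = j + 1 := ⟨k - 1, by omega⟩
      rw [cap_mul_cap (show i ≤ j by omega), mul_assoc (cap N j)]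
      rcases i with _ | i
      -- Symmetrically, the contraction closes the first leg of `X` on itself.
      · have := left 0
        rw [zero_add] at this
        rw [mul_assoc (cap N j), this, mul_zero]
      · have := cap_mul_place_of_mem hN hE 1 (i := i) (by omega)
        rw [show 1 + i = i + 1 by omega] at this
        rw [this, mul_zero, zero_mul]
  have rotate : ∀ p, cap N (p + (k + 1)) * place (p + 1) X * cup N p = μ • place p X := by
    intro p
    rw [cap_place_cup_rot, raw, place_smul]
  refine ⟨fun p i hi => cap_mul_place_of_mem hN hE p hi,
    fun p i hi => place_mul_cup_of_mem hN hE p hi, left, right, rotate, fun p => ?_⟩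
  -- For `X = 0` the scalar `μ` is arbitrary, but both sides vanish.
  by_cases h0 : X = 0
  · rw [h0, place_zero, place_zero]
    simp
  -- Rotating back undoes the rotation: `μ X` is replaced by the rotated diagram, and the two
  -- resulting zigzags are straightened.
  have h1 : μ • (cap N p * place (p + 1) X * cup N (p + (k + 1))) = place p X := by
    have h2 := rotate (p + 1)
    calc μ • (cap N p * place (p + 1) X * cup N (p + (k + 1)))
        = cap N p * (μ • place (p + 1) X) * cup N (p + (k + 1)) := by
          rw [mul_smul_comm, smul_mul_assoc]
      _ = (cap N p * cap N (p + k + 2)) * place (p + 1 + 1) X *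
            (cup N (p + 1) * cup N (p + k + 1)) := by
          rw [← h2, show p + 1 + (k + 1) = p + k + 2 by omega]; simp only [mul_assoc]; rfl
      _ = cap N (p + k) * (cap N p * place (p + 2) X) *
            (cup N (p + k + 1 + 2) * cup N (p + 1)) := by
          rw [cap_mul_cap (by omega), ← cup_mul_cup (by omega)]; simp only [mul_assoc]
      _ = cap N (p + k) * place p X * (cap N p * cup N (p + k + 1 + 2)) * cup N (p + 1) := by
          rw [cap_mul_place_left le_rfl]; simp only [mul_assoc]
      _ = cap N (p + k) * (place p X * cup N (p + k + 1)) * (cap N p * cup N (p + 1)) := by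
          rw [cap_mul_cup_far (by omega)]; simp only [mul_assoc]
      _ = place p X := by
          rw [cap_mul_cup_succ, mul_one, ← cup_mul_place_right (by omega), ← mul_assoc,
            cap_mul_cup_succ, one_mul]
  rw [← h1, smul_smul, norm_of_rawRot_eq raw h0, one_smul]

/-! ### Functionals on `Pol N` and fixed vectors -/

/-- A Hermitian kernel on words which is compatible with contractions. -/
structure IsContractive {N : ℕ} (q : List (Fin N) → List (Fin N) → ℂ) : Prop where
  zero : ∀ a b, a.length ≠ b.length → q a b = 0
  conj : ∀ a b, star (q a b) = q b a
  contract : ∀ {a₁ a₂ b₁ b₂ : List (Fin N)} (r r' : Fin N), a₁.length = b₁.length →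
    a₂.length = b₂.length → ∑ s, q (a₁ ++ r :: r' :: a₂) (b₁ ++ s :: s :: b₂)
      = if r = r' then q (a₁ ++ a₂) (b₁ ++ b₂) else 0

/-- A functional on the free algebra is prescribed on monomials by `q`. Compatibility with
contractions says that it respects the row relations placed between any two monomials; taking
conjugates gives the column relations, so it descends to the quotient. -/
theorem IsContractive.exists_functional {N : ℕ} {q : List (Fin N) → List (Fin N) → ℂ}
    (hq : IsContractive q) :
    ∃ φ : Pol N →ₗ[ℂ] ℂ, ∀ a b, φ (lcoef a b) = q a b := by
  let m : FreeMonoid (Fin N × Fin N) →* FreeAlgebra ℂ (Fin N × Fin N) :=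
    FreeMonoid.lift (FreeAlgebra.ι ℂ)
  let g : FreeAlgebra ℂ (Fin N × Fin N) →ₗ[ℂ] ℂ :=
    (FreeAlgebra.basisFreeMonoid ℂ (Fin N × Fin N)).constr ℂ
      (fun w => q (w.toList.map Prod.fst) (w.toList.map Prod.snd))
  have hg : ∀ w : List (Fin N × Fin N), g (m (FreeMonoid.ofList w))
      = q (w.map Prod.fst) (w.map Prod.snd) := by
    intro w
    rw [← basisFreeMonoid_eq]
    simp [g]
  have ext_mono : ∀ f f' : FreeAlgebra ℂ (Fin N × Fin N) →ₗ[ℂ] ℂ,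
      (∀ w, f (m (FreeMonoid.ofList w)) = f' (m (FreeMonoid.ofList w))) → f = f' := by
    intro f f' h
    refine (FreeAlgebra.basisFreeMonoid ℂ (Fin N × Fin N)).ext fun w => ?_
    rw [basisFreeMonoid_eq]
    exact h w.toList
  have hgen : ∀ p : Fin N × Fin N, FreeAlgebra.ι ℂ p = m (FreeMonoid.ofList [p]) := by
    intro p
    simp [m]
  -- the relations are respected between monomials
  have hmono : ∀ x y, Rel N x y → ∀ c d : List (Fin N × Fin N),
      g (m (FreeMonoid.ofList c) * x * m (FreeMonoid.ofList d))
        = g (m (FreeMonoid.ofList c) * y * m (FreeMonoid.ofList d)) := by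
    intro x y h c d
    have hsplit : ∀ p p' : Fin N × Fin N,
        m (FreeMonoid.ofList c) * (FreeAlgebra.ι ℂ p * FreeAlgebra.ι ℂ p') *
          m (FreeMonoid.ofList d) = m (FreeMonoid.ofList (c ++ p :: p' :: d)) := by
      intro p p'
      rw [hgen, hgen, ← map_mul, ← map_mul, ← map_mul]
      exact congrArg (fun w => m (FreeMonoid.ofList w))
        (by simp : (c ++ ([p] ++ [p'])) ++ d = c ++ p :: p' :: d)
    have h0 : g (m (FreeMonoid.ofList c) * 1 * m (FreeMonoid.ofList d))
        = q (c.map Prod.fst ++ d.map Prod.fst) (c.map Prod.snd ++ d.map Prod.snd) := by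
      rw [mul_one, ← map_mul, ← FreeMonoid.ofList_append, hg]
      simp
    cases h with
    | row i j =>
      rw [Finset.mul_sum, Finset.sum_mul, map_sum]
      simp only [hsplit, hg, List.map_append, List.map_cons]
      rw [hq.contract i j (by simp) (by simp)]
      split_ifs
      · rw [h0]
      · simp
    | col i j =>
      rw [Finset.mul_sum, Finset.sum_mul, map_sum]
      simp only [hsplit, hg, List.map_append, List.map_cons]
      have := congrArg star (hq.contract (a₁ := c.map Prod.snd) (a₂ := d.map Prod.snd)
        (b₁ := c.map Prod.fst) (b₂ := d.map Prod.fst) i j (by simp) (by simp))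
      simp only [star_sum, hq.conj] at this
      rw [this]
      split_ifs
      · rw [h0, hq.conj]
      · simp
  have hall : ∀ x y, Rel N x y → ∀ c d, g (c * x * d) = g (c * y * d) := by
    intro x y h
    have h1 : ∀ c : List (Fin N × Fin N), ∀ d,
        g (m (FreeMonoid.ofList c) * x * d) = g (m (FreeMonoid.ofList c) * y * d) := by
      intro c d
      have := ext_mono (g ∘ₗ LinearMap.mulLeft ℂ (m (FreeMonoid.ofList c) * x))
        (g ∘ₗ LinearMap.mulLeft ℂ (m (FreeMonoid.ofList c) * y)) (fun w => hmono x y h c w)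
      exact LinearMap.congr_fun this d
    intro c d
    have := ext_mono (g ∘ₗ LinearMap.mulRight ℂ (x * d)) (g ∘ₗ LinearMap.mulRight ℂ (y * d))
      (fun w => by simpa [mul_assoc] using h1 w d)
    simpa [mul_assoc] using LinearMap.congr_fun this c
  have hrel : ∀ x y, RingQuot.Rel (Rel N) x y → ∀ c d, g (c * x * d) = g (c * y * d) := by
    intro x y h
    induction h with
    | of h => exact hall _ _ h
    | add_left _ ih =>
      intro c d
      simp only [mul_add, add_mul, map_add, ih c d]
    | @mul_left _ _ z _ ih =>
      intro c d
      have := ih c (z * d)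
      simpa only [mul_assoc] using this
    | @mul_right z _ _ _ ih =>
      intro c d
      have := ih (c * z) d
      simpa only [mul_assoc] using this
  have heq : ∀ x y, Relation.EqvGen (RingQuot.Rel (Rel N)) x y → g x = g y := by
    intro x y h
    induction h with
    | rel x y h => simpa using hrel x y h 1 1
    | refl => rfl
    | symm _ _ _ ih => exact ih.symm
    | trans _ _ _ _ _ ih ih' => exact ih.trans ih'
  have hsurj : Function.Surjective (polMk N).toLinearMap := polMk_surjective N
  have hker : LinearMap.ker (polMk N).toLinearMap ≤ LinearMap.ker g := by
    intro x hx
    rw [LinearMap.mem_ker] at hx ⊢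
    rw [← map_zero g]
    exact heq x 0 (mk_eq_mk (by rw [map_zero]; exact hx))
  refine ⟨(LinearMap.ker (polMk N).toLinearMap).liftQ g hker ∘ₗ
    ((polMk N).toLinearMap.quotKerEquivOfSurjective hsurj).symm.toLinearMap, fun a b => ?_⟩
  by_cases hl : a.length = b.length
  · have h1 : lcoef a b = (polMk N).toLinearMap (m (FreeMonoid.ofList (a.zip b))) := by
      rw [AlgHom.toLinearMap_apply, mk_monomial, List.map_fst_zip hl.le, List.map_snd_zip hl.ge]
    have h2 : ((polMk N).toLinearMap.quotKerEquivOfSurjective hsurj).symm (lcoef a b)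
        = Submodule.Quotient.mk (m (FreeMonoid.ofList (a.zip b))) := by
      rw [LinearEquiv.symm_apply_eq, h1]
      rfl
    rw [LinearMap.comp_apply, LinearEquiv.coe_coe, h2, Submodule.liftQ_apply, hg,
      List.map_fst_zip hl.le, List.map_snd_zip hl.ge]
  · rw [lcoef_of_ne hl, map_zero, hq.zero _ _ hl]

/-- Insertion of `t` at the positions `i, i + 1` of the words. -/
def listCup {N : ℕ} (i : ℕ) (v : List (Fin N) → ℂ) (w : List (Fin N)) : ℂ :=
  match w.drop i with
  | s :: t :: c => if s = t then v (w.take i ++ c) else 0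
  | _ => 0

theorem listCup_append {N i : ℕ} (v : List (Fin N) → ℂ) {a : List (Fin N)} (h : a.length = i)
    (s t : Fin N) (c : List (Fin N)) :
    listCup i v (a ++ s :: t :: c) = if s = t then v (a ++ c) else 0 := by
  simp only [listCup, List.drop_left' h, List.take_left' h]

/-- Contraction of the positions `i, i + 1` of the words. -/
def listCap {N : ℕ} (i : ℕ) (v : List (Fin N) → ℂ) (w : List (Fin N)) : ℂ :=
  ∑ s, v (w.take i ++ s :: s :: w.drop i)

theorem listCap_append {N i : ℕ} (v : List (Fin N) → ℂ) {a : List (Fin N)} (h : a.length = i)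
    (c : List (Fin N)) : listCap i v (a ++ c) = ∑ s, v (a ++ s :: s :: c) := by
  simp only [listCap, List.drop_left' h, List.take_left' h]

/-- A family of spaces of functions of words which is stable under contractions and insertions
of `t`. -/
structure IsTLStable {N : ℕ} (F : ℕ → Submodule ℂ (List (Fin N) → ℂ)) : Prop where
  congr : ∀ {k v w}, (∀ a ∈ words N k, v a = w a) → v ∈ F k → w ∈ F k
  one : (fun _ => 1) ∈ F 0
  cup : ∀ {i j v}, v ∈ F (i + j) → listCup i v ∈ F (i + (j + 2))
  cap : ∀ {i j v}, v ∈ F (i + (j + 2)) → listCap i v ∈ F (i + j)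

/-- `q` is, in each degree, the matrix of the orthogonal projection onto `F k`. -/
structure IsProjKernel {N : ℕ} (F : ℕ → Submodule ℂ (List (Fin N) → ℂ))
    (q : List (Fin N) → List (Fin N) → ℂ) : Prop where
  zero : ∀ a b, a.length ≠ b.length → q a b = 0
  mem : ∀ k, ∀ c ∈ words N k, (fun b => q b c) ∈ F k
  conj : ∀ a b, star (q a b) = q b a
  absorb : ∀ k v, v ∈ F k → ∀ a ∈ words N k, ∑ b ∈ words N k, q a b * v b = v a

namespace IsTLStable

variable {N : ℕ} {F : ℕ → Submodule ℂ (List (Fin N) → ℂ)}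

theorem exists_proj (hF : IsTLStable F) (k : ℕ) : ∃ q : List (Fin N) → List (Fin N) → ℂ,
    (∀ c ∈ words N k, (fun b => q b c) ∈ F k) ∧
    (∀ a ∈ words N k, ∀ b ∈ words N k, star (q a b) = q b a) ∧
    (∀ v, v ∈ F k → ∀ a ∈ words N k, ∑ b ∈ words N k, q a b * v b = v a) := by
  classical
  let ex : EuclideanSpace ℂ (words N k) →ₗ[ℂ] (List (Fin N) → ℂ) :=
    { toFun := fun v a => if h : a ∈ words N k then v ⟨a, h⟩ else 0
      map_add' := by
        intro v w; ext a
        simp only [PiLp.add_apply, Pi.add_apply]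
        split_ifs <;> simp
      map_smul' := by
        intro r v; ext a
        simp }
  have hex : ∀ v (a : List (Fin N)) (h : a ∈ words N k), ex v a = v ⟨a, h⟩ := fun v a h => dif_pos h
  let G : Submodule ℂ (EuclideanSpace ℂ (words N k)) := (F k).comap ex
  let e : List (Fin N) → EuclideanSpace ℂ (words N k) := fun b =>
    if h : b ∈ words N k then EuclideanSpace.single ⟨b, h⟩ 1 else 0
  have he : ∀ (v : EuclideanSpace ℂ (words N k)) (a : List (Fin N)) (h : a ∈ words N k),
      inner ℂ (e a) v = v ⟨a, h⟩ := by
    intro v a h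
    simp [e, h, EuclideanSpace.inner_single_left]
  refine ⟨fun a b => inner ℂ (e a) (G.starProjection (e b)), ?_, ?_, ?_⟩
  · intro c hc
    have h1 : ex (G.starProjection (e c)) ∈ F k := Submodule.starProjection_apply_mem G (e c)
    exact hF.congr (fun a ha => (hex _ a ha).trans (he _ a ha).symm) h1
  · intro a _ b _
    change (starRingEnd ℂ) _ = _
    rw [inner_conj_symm, Submodule.inner_starProjection_left_eq_right]
  · intro v hv a ha
    let w : EuclideanSpace ℂ (words N k) := WithLp.toLp 2 fun b => v b.1
    have hw : w ∈ G := hF.congr (fun a ha => (hex w a ha).symm) hv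
    have hws : w = ∑ b : words N k, v b.1 • e b.1 := by
      ext a
      simp [w, e, Finset.sum_apply, Pi.single_apply]
    have h1 : G.starProjection w = w := Submodule.starProjection_eq_self_iff.2 hw
    have h2 : inner ℂ (e a) (G.starProjection w) = v a := by rw [h1, he _ _ ha]
    rw [← h2]
    conv_rhs => rw [hws]
    rw [map_sum, inner_sum, ← Finset.sum_coe_sort]
    refine Finset.sum_congr rfl fun b _ => ?_
    rw [map_smul, inner_smul_right, mul_comm]

theorem exists_isProjKernel (hF : IsTLStable F) : ∃ q, IsProjKernel F q := by
  choose q h1 h2 h3 using hF.exists_proj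
  have key : ∀ k, ∀ a ∈ words N k, ∀ b ∈ words N k,
      (if a.length = b.length then q a.length a b else 0) = q k a b := by
    intro k a ha b hb
    rw [mem_words] at ha hb
    rw [if_pos (ha.trans hb.symm), ha]
  refine ⟨fun a b => if a.length = b.length then q a.length a b else 0, ?_, ?_, ?_, ?_⟩
  · intro a b h
    simp [h]
  · intro k c hc
    exact hF.congr (fun a ha => (key k a ha c hc).symm) (h1 k c hc)
  · intro a b
    by_cases h : a.length = b.length
    · simp only [h, if_true]
      exact h2 _ a (mem_words.2 h) b (mem_words.2 rfl)
    · simp [h, Ne.symm h]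
  · intro k v hv a ha
    rw [← h3 k v hv a ha]
    exact Finset.sum_congr rfl fun b hb => by rw [key k a ha b hb]

/-- Insertion and contraction of `t` are adjoint. Absorbing an inserted column of `q` and absorbing
a contracted one evaluate the same double sum, which yields the two sides of the contraction rule.
-/
theorem isContractive (hF : IsTLStable F) {q : List (Fin N) → List (Fin N) → ℂ}
    (hq : IsProjKernel F q) : IsContractive q := by
  refine ⟨hq.zero, hq.conj, ?_⟩
  intro a₁ a₂ b₁ b₂ r r' h₁ h₂
  obtain ⟨i, hi⟩ : ∃ i, a₁.length = i := ⟨_, rfl⟩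
  obtain ⟨j, hj⟩ : ∃ j, a₂.length = j := ⟨_, rfl⟩
  have hb₁ : b₁.length = i := h₁ ▸ hi
  have hb₂ : b₂.length = j := h₂ ▸ hj
  have mw : ∀ {k} {w : List (Fin N)}, w ∈ words N k → w.length = k := fun h => mem_words.1 h
  have hA : a₁ ++ r :: r' :: a₂ ∈ words N (i + (j + 2)) := by
    rw [mem_words]; simp [hi, hj]
  have hB : b₁ ++ b₂ ∈ words N (i + j) := by rw [mem_words]; simp [hb₁, hb₂]
  set A := a₁ ++ r :: r' :: a₂ with hAdef
  set B := b₁ ++ b₂ with hBdef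
  have E1 := hq.absorb _ _ (hF.cup (hq.mem _ B hB)) A hA
  rw [listCup_append _ hi, IsKernel.sum_words_two] at E1
  have E2 := congrArg star (hq.absorb _ _ (hF.cap (hq.mem _ A hA)) B hB)
  rw [hBdef, listCap_append _ hb₁, sum_words_add] at E2
  simp only [star_sum, hq.conj, star_mul'] at E2
  rw [← E2, ← E1]
  refine Finset.sum_congr rfl fun c₁ hc₁ => ?_
  simp only [listCup_append _ (mw hc₁), mul_ite, mul_zero]
  have h3 : ∀ s : Fin N, ∑ t, ∑ c₂ ∈ words N j,
      (if s = t then q A (c₁ ++ s :: t :: c₂) * q (c₁ ++ c₂) B else 0)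
      = ∑ c₂ ∈ words N j, q A (c₁ ++ s :: s :: c₂) * q (c₁ ++ c₂) B := by
    intro s
    rw [Finset.sum_comm]
    simp
  simp only [h3]
  rw [Finset.sum_comm]
  refine Finset.sum_congr rfl fun c₂ hc₂ => ?_
  rw [listCap_append _ (mw hc₁), star_sum, Finset.mul_sum]
  refine Finset.sum_congr rfl fun s _ => ?_
  rw [hq.conj, mul_comm]

/-- A family of spaces which is stable under contractions and insertions of `t` contains the fixed
vectors of the tensor powers of `u`. -/
theorem mem_of_isFixed (hF : IsTLStable F) {k : ℕ} {v : List (Fin N) → ℂ} (hv : IsFixed k v) :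
    v ∈ F k := by
  obtain ⟨q, hq⟩ := hF.exists_isProjKernel
  obtain ⟨φ, hφ⟩ := (hF.isContractive hq).exists_functional
  have hone : φ 1 = 1 := by
    have h1 := hq.absorb 0 _ hF.one [] (by simp [mem_words])
    rw [sum_words_zero, mul_one] at h1
    rw [← lcoef_nil, hφ, h1]
  refine hF.congr (v := ∑ b ∈ words N k, v b • fun a => q a b) (fun a ha => ?_)
    (Submodule.sum_mem _ fun b hb => Submodule.smul_mem _ _ (hq.mem k b hb))
  -- Applied to the equations of a fixed vector, the functional whose values are the entries of the
  -- projection says that this projection fixes `v`.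
  have := congrArg φ (hv a ha)
  simp only [map_sum, map_smul, hφ, hone, smul_eq_mul, mul_one] at this
  simpa [Finset.sum_apply] using this

end IsTLStable

/-! ### Noncrossing pairings -/

/-- The span of the noncrossing pairings of `m` points, as functions of the first `m` entries of
sequences. -/
def noncrossing (N : ℕ) : ℕ → Submodule ℂ ((ℕ → Fin N) → ℂ)
  | 0 => Submodule.span ℂ {fun _ => 1}
  | 1 => ⊥
  | m + 2 => ⨆ i : Fin (m + 1), (noncrossing N m).map (cup N i)

theorem noncrossing_add_two_le {N m : ℕ} {S : Submodule ℂ ((ℕ → Fin N) → ℂ)}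
    (h : ∀ i ≤ m, ∀ w ∈ noncrossing N m, cup N i w ∈ S) : noncrossing N (m + 2) ≤ S := by
  rw [noncrossing, iSup_le_iff]
  intro i
  rw [Submodule.map_le_iff_le_comap]
  exact fun w hw => h i (by omega) w hw

theorem cup_mem_noncrossing {N m i : ℕ} (hi : i ≤ m) {w : (ℕ → Fin N) → ℂ}
    (hw : w ∈ noncrossing N m) : cup N i w ∈ noncrossing N (m + 2) := by
  rw [noncrossing]
  exact Submodule.mem_iSup_of_mem (⟨i, by omega⟩ : Fin (m + 1)) (Submodule.mem_map_of_mem hw)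

/-- A contraction meeting an inserted pair gives a loop or a zigzag; otherwise it commutes with the
insertion and acts on a smaller pairing. -/
theorem cap_mem_noncrossing {N : ℕ} (m : ℕ) : ∀ {i : ℕ}, i ≤ m → ∀ {v : (ℕ → Fin N) → ℂ},
    v ∈ noncrossing N (m + 2) → cap N i v ∈ noncrossing N m := by
  induction m using Nat.strong_induction_on with
  | _ m ih =>
    intro i hi v hv
    suffices h : noncrossing N (m + 2) ≤ (noncrossing N m).comap (cap N i) from h hv
    refine noncrossing_add_two_le fun j hj w hw => ?_
    rw [Submodule.mem_comap, ← Module.End.mul_apply]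
    rcases lt_trichotomy i j with h1 | h1 | h1
    · rcases Nat.eq_or_lt_of_le h1 with h2 | h2
      · rw [← h2, Nat.succ_eq_add_one, cap_mul_cup_succ]
        exact hw
      · obtain ⟨j, rfl⟩ : ∃ l, j = l + 2 := ⟨j - 2, by omega⟩
        obtain ⟨m, rfl⟩ : ∃ l, m = l + 2 := ⟨m - 2, by omega⟩
        rw [cap_mul_cup_far (by omega), Module.End.mul_apply]
        exact cup_mem_noncrossing (by omega) (ih m (by omega) (by omega) hw)
    · rw [h1, cap_mul_cup_self]
      exact Submodule.smul_mem _ _ hw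
    · rcases Nat.eq_or_lt_of_le h1 with h2 | h2
      · rw [← h2, Nat.succ_eq_add_one, cap_succ_mul_cup]
        exact hw
      · obtain ⟨i, rfl⟩ : ∃ l, i = l + 2 := ⟨i - 2, by omega⟩
        obtain ⟨m, rfl⟩ : ∃ l, m = l + 2 := ⟨m - 2, by omega⟩
        rw [cap_far_mul_cup (by omega), Module.End.mul_apply]
        exact cup_mem_noncrossing (by omega) (ih m (by omega) (by omega) hw)

/-- A function of words of length `m` as a function of sequences. -/
def ofList (N m : ℕ) : (List (Fin N) → ℂ) →ₗ[ℂ] ((ℕ → Fin N) → ℂ) where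
  toFun v := fun w => v ((List.range m).map w)
  map_add' _ _ := rfl
  map_smul' _ _ := rfl

theorem ofList_apply {N m : ℕ} (v : List (Fin N) → ℂ) (w : ℕ → Fin N) :
    ofList N m v w = v ((List.range m).map w) := rfl

theorem map_range_add_two {N : ℕ} (i j : ℕ) (w : ℕ → Fin N) :
    (List.range (i + (j + 2))).map w = (List.range i).map w ++
      w i :: w (i + 1) :: (List.range j).map fun l => w (i + 2 + l) := by
  rw [List.range_add, List.map_append, List.map_map, List.range_succ_eq_map, List.range_succ_eq_map]
  simp only [List.map_cons, List.map_map, add_zero, Function.comp_def, Nat.succ_eq_add_one, zero_add]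
  congr 3
  refine List.map_congr_left fun l _ => ?_
  congr 1; omega

theorem isTLStable_noncrossing (N : ℕ) :
    IsTLStable fun m => (noncrossing N m).comap (ofList N m) := by
  refine ⟨fun {k v w} h hv => ?_, ?_, fun {i j v} hv => ?_, fun {i j v} hv => ?_⟩
  · have : ofList N k w = ofList N k v := by
      ext z
      exact (h _ (mem_words.2 (by simp))).symm
    rw [Submodule.mem_comap, this]
    exact hv
  · exact Submodule.subset_span rfl
  · have : ofList N (i + (j + 2)) (listCup i v) = cup N i (ofList N (i + j) v) := by
      ext w
      rw [ofList_apply, map_range_add_two, listCup_append _ (by simp), cup_apply, ofList_apply]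
      congr 2
      rw [List.range_add, List.map_append, List.map_map]
      congr 1
      · refine List.map_congr_left fun l hl => ?_
        rw [delPair, if_pos (by simpa using hl)]
      · refine List.map_congr_left fun l _ => ?_
        rw [Function.comp_apply, delPair, if_neg (by omega)]
        congr 1; omega
    rw [Submodule.mem_comap, this]
    exact cup_mem_noncrossing (Nat.le_add_right i j) hv
  · have : ofList N (i + j) (listCap i v) = cap N i (ofList N (i + (j + 2)) v) := by
      ext w
      rw [ofList_apply, List.range_add, List.map_append, listCap_append _ (by simp), cap_apply]
      refine Finset.sum_congr rfl fun s _ => ?_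
      rw [ofList_apply, map_range_add_two, List.map_map]
      congr 2
      · refine List.map_congr_left fun l hl => ?_
        rw [insPair, if_pos (by simpa using hl)]
      · simp only [insPair]
        rw [if_neg (by omega), if_pos (by omega), if_neg (by omega), if_pos (by omega)]
        congr 2
        refine List.map_congr_left fun l _ => ?_
        rw [Function.comp_apply, if_neg (by omega), if_neg (by omega)]
        congr 1; omega
    rw [Submodule.mem_comap, this]
    exact cap_mem_noncrossing (i + j) (Nat.le_add_right i j) hv

theorem ofList_mem_noncrossing {N k : ℕ} {v : List (Fin N) → ℂ} (hv : IsFixed k v) :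
    ofList N k v ∈ noncrossing N k :=
  (isTLStable_noncrossing N).mem_of_isFixed hv

/-! ### Compression of noncrossing pairings -/

/-- The nested pairing of `2 n` points. -/
def rainbow (N : ℕ) : ℕ → (ℕ → Fin N) → ℂ
  | 0 => fun _ => 1
  | n + 1 => cup N n (rainbow N n)

/-- With fewer points on the left than on the right, some pair of a noncrossing pairing joins two
neighbours on the right, and the projection kills it. -/
theorem wenzl_noncrossing_of_lt {N : ℕ} (hN : 2 ≤ N) (M : ℕ) : ∀ {r n : ℕ}, r + n = M → r < n →
    ∀ {v : (ℕ → Fin N) → ℂ}, v ∈ noncrossing N M → wenzl N r n v = 0 := by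
  induction M using Nat.strong_induction_on with
  | _ M ih =>
    intro r n hM hr v hv
    match M, hM, hv with
    | 0, hM, _ => omega
    | 1, _, hv => rw [(Submodule.mem_bot ℂ).1 hv, map_zero]
    | M + 2, hM, hv =>
      suffices h : noncrossing N (M + 2) ≤ LinearMap.ker (wenzl N r n) from h hv
      refine noncrossing_add_two_le fun i hi w hw => ?_
      rw [LinearMap.mem_ker, ← Module.End.mul_apply]
      rcases lt_trichotomy (i + 1) r with h1 | h1 | h1
      · obtain ⟨r, rfl⟩ : ∃ l, r = l + 2 := ⟨r - 2, by omega⟩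
        rw [← cup_mul_wenzl_left (by omega), Module.End.mul_apply,
          ih M (by omega) (by omega) (by omega) hw, map_zero]
      · subst h1
        -- The pair straddles the boundary. The projection on the last `n - 1` legs is split off and
        -- slides past it, leaving `r - 1` points against `n - 1`.
        rw [← wenzl_mul_wenzl hN (p := i + 1) (n := n) (q := i + 2) (m := n - 1) (by omega)
          (by omega), mul_assoc, ← cup_mul_wenzl_left le_rfl, Module.End.mul_apply,
          Module.End.mul_apply, ih M (by omega) (by omega) (by omega) hw, map_zero, map_zero]
      · obtain ⟨j, rfl⟩ := Nat.exists_eq_add_of_le (show r ≤ i by omega)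
        rw [wenzl_mul_cup hN (by omega), LinearMap.zero_apply]

/-- With equally many points on both sides, the only noncrossing pairing without a pair inside the
right half is the nested one. -/
theorem wenzl_noncrossing {N : ℕ} (hN : 2 ≤ N) (n : ℕ) {v : (ℕ → Fin N) → ℂ}
    (hv : v ∈ noncrossing N (n + n)) : ∃ c : ℂ, wenzl N n n v = c • wenzl N n n (rainbow N n) := by
  suffices h : noncrossing N (n + n) ≤
      (Submodule.span ℂ {wenzl N n n (rainbow N n)}).comap (wenzl N n n) by
    obtain ⟨c, hc⟩ := Submodule.mem_span_singleton.1 (h hv)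
    exact ⟨c, hc.symm⟩
  clear hv v
  induction n with
  | zero =>
    rw [noncrossing, Submodule.span_le, Set.singleton_subset_iff]
    exact Submodule.subset_span rfl
  | succ n ih =>
    rw [show n + 1 + (n + 1) = n + n + 2 by omega]
    refine noncrossing_add_two_le fun i hi w hw => ?_
    rw [Submodule.mem_comap, ← Module.End.mul_apply]
    rcases lt_trichotomy i n with h1 | h1 | h1
    · obtain ⟨m, rfl⟩ : ∃ l, n = l + 1 := ⟨n - 1, by omega⟩
      rw [← cup_mul_wenzl_left (show i ≤ m by omega), Module.End.mul_apply,
        wenzl_noncrossing_of_lt hN _ (by omega) (by omega) hw, map_zero]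
      exact Submodule.zero_mem _
    · subst h1
      -- The projection on the last `i` legs slides through the innermost pair, so the induction
      -- hypothesis applies to what that pair encloses.
      have key : ∀ z, (wenzl N (i + 1) (i + 1) * cup N i) z
          = (wenzl N (i + 1) (i + 1) * cup N i) (wenzl N i i z) := by
        intro z
        rw [← Module.End.mul_apply, mul_assoc, cup_mul_wenzl_left le_rfl, ← mul_assoc,
          wenzl_mul_wenzl hN (by omega) (by omega)]
      obtain ⟨c, hc⟩ := Submodule.mem_span_singleton.1 (ih hw)
      refine Submodule.mem_span_singleton.2 ⟨c, ?_⟩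
      rw [key w, ← hc, map_smul, ← key]
      rfl
    · obtain ⟨j, rfl⟩ := Nat.exists_eq_add_of_le (show n + 1 ≤ i by omega)
      rw [wenzl_mul_cup hN (by omega), LinearMap.zero_apply]
      exact Submodule.zero_mem _

theorem rainbow_apply {N : ℕ} (n : ℕ) (w : ℕ → Fin N) :
    rainbow N n w = if ∀ i < n, w (n - 1 - i) = w (n + i) then 1 else 0 := by
  induction n generalizing w with
  | zero => simp [rainbow]
  | succ n ih =>
    rw [rainbow, cup_apply, ih, ← ite_and]
    refine if_congr ⟨fun h i hi => ?_, fun h => ⟨?_, fun i hi => ?_⟩⟩ rfl rfl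
    · rcases i with _ | i
      · simpa using h.1
      · have := h.2 i (by omega)
        rw [delPair, delPair, if_pos (by omega), if_neg (by omega)] at this
        rw [show n + 1 - 1 - (i + 1) = n - 1 - i by omega, this]
        congr 1; omega
    · simpa using h 0 (by omega)
    · have := h (i + 1) (by omega)
      rw [delPair, delPair, if_pos (by omega), if_neg (by omega)]
      rw [show n + 1 - 1 - (i + 1) = n - 1 - i by omega] at this
      rw [this]
      congr 1; omega

/-! ### Orthogonality relations -/

theorem uPow_eq_lcoef {N k : ℕ} (a b : Word N k) :
    uPow N k a b = lcoef (List.ofFn a) (List.ofFn b) := by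
  induction k with
  | zero => simp [uPow]
  | succ k ih =>
    have := ih (Fin.tail a) (Fin.tail b)
    simp only [uPow, Fin.tail] at this ⊢
    rw [List.ofFn_succ, List.ofFn_succ, List.ofFn_succ, lcoef_cons, List.prod_cons, this]
    rfl

theorem sum_words_eq {N k : ℕ} {M : Type*} [AddCommMonoid M] (f : List (Fin N) → M) :
    ∑ w ∈ words N k, f w = ∑ a : Word N k, f (List.ofFn a) := by
  induction k generalizing f with
  | zero => simp [sum_words_zero]
  | succ k ih =>
    rw [sum_words_succ, sum_cons]
    refine Finset.sum_congr rfl fun s _ => ?_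
    rw [ih]
    simp

theorem star_uPow_mul {N k l : ℕ} (a b : Word N k) (c d : Word N l) :
    star (uPow N k a b) * uPow N l c d = lcoef ((List.ofFn a).reverse ++ List.ofFn c)
      ((List.ofFn b).reverse ++ List.ofFn d) := by
  rw [uPow_eq_lcoef, uPow_eq_lcoef, star_lcoef, lcoef_append (by simp)]

theorem uPow_unitary {N k : ℕ} (b d : Word N k) :
    ∑ a, star (uPow N k a b) * uPow N k a d = if b = d then 1 else 0 := by
  have := lcoef_unitary' (N := N) (k := k) (a := List.ofFn b) (c := List.ofFn d)
    (mem_words.2 (by simp)) (mem_words.2 (by simp))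
  rw [sum_words_eq] at this
  simp only [uPow_eq_lcoef, this, List.ofFn_inj]

/-- Right invariance of the Haar state, read on the coproduct of a coefficient. -/
theorem isFixed_haar {N k : ℕ} {c : List (Fin N)} (hc : c ∈ words N k) :
    IsFixed k (fun b => (haar N).toFun (lcoef b c)) := by
  intro a ha
  have := (haar N).right_inv (lcoef a c)
  simpa [comul_lcoef ha hc, map_sum] using this

theorem map_range_overwrite {N n : ℕ} (a c : Word N n) (z : ℕ → Fin N) :
    (List.range (n + n)).map (overwrite n c (overwrite 0 a z)) = List.ofFn a ++ List.ofFn c := by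
  rw [List.range_add, List.map_append, List.map_map]
  congr 1
  · refine List.ext_getElem (by simp) fun i h1 h2 => ?_
    have h : i < n := by simpa using h2
    have := overwrite_add (p := 0) a z ⟨i, h⟩
    rw [zero_add] at this
    simp only [List.getElem_map, List.getElem_range, List.getElem_ofFn, overwrite_of_lt _ _ h, this]
  · refine List.ext_getElem (by simp) fun i h1 h2 => ?_
    have h : i < n := by simpa using h2
    have := overwrite_add (p := n) c (overwrite 0 a z) ⟨i, h⟩
    simp only [List.getElem_map, List.getElem_range, List.getElem_ofFn, Function.comp_apply, this]

/-- The nested pairing reads its first half backwards. This matches the adjoint of a coefficient,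
which reverses words, so the pairing becomes the identity matrix. -/
theorem rainbow_overwrite {N n : ℕ} (a c : Word N n) (z : ℕ → Fin N) :
    rainbow N n (overwrite n c (overwrite 0 (fun i => a i.rev) z)) = if c = a then 1 else 0 := by
  rw [rainbow_apply]
  have h1 : ∀ i : Fin n, overwrite n c (overwrite 0 (fun i => a i.rev) z) (n - 1 - i) = a i := by
    intro i
    have := overwrite_add (p := 0) (fun i => a (Fin.rev i)) z i.rev
    rw [zero_add, Fin.rev_rev, Fin.val_rev] at this
    rw [overwrite_of_lt _ _ (by omega), ← this]
    congr 1; omega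
  refine if_congr ⟨fun h => funext fun i => ?_, fun h i hi => ?_⟩ rfl rfl
  · have := h i i.2
    rw [h1, overwrite_add] at this
    exact this.symm
  · subst h
    exact (h1 ⟨i, hi⟩).trans (overwrite_add c _ ⟨i, hi⟩).symm

/-- For fixed column indices the Haar state is a fixed vector in the row indices. Compressing its
last `n` legs by `P_n` leaves a multiple of the nested pairing. -/
theorem exists_haar_eq {N : ℕ} (hN : 2 ≤ N) {n : ℕ} (b d : Word N n) :
    ∃ r : ℂ, ∀ a c, ∑ e, jw N n c e * (haar N).toFun (star (uPow N n a b) * uPow N n e d)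
      = r * jw N n c a := by
  let B := (List.ofFn b).reverse ++ List.ofFn d
  have hB : B ∈ words N (n + n) := mem_words.2 (by simp [B])
  obtain ⟨r, hr⟩ := wenzl_noncrossing hN n (ofList_mem_noncrossing (isFixed_haar hB))
  refine ⟨r, fun a c => ?_⟩
  have h := congrFun hr
    (overwrite n c (overwrite 0 (fun i => a i.rev) fun _ => (⟨0, by omega⟩ : Fin N)))
  rw [← place_jw hN, Pi.smul_apply] at h
  simp only [place_apply, window_overwrite, overwrite_overwrite, rainbow_overwrite, ofList_apply,
    map_range_overwrite] at h
  have h1 : List.ofFn (fun i => a i.rev) = (List.ofFn a).reverse := by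
    refine List.ext_getElem (by simp) fun i h1 h2 => ?_
    simp only [List.getElem_ofFn, List.getElem_reverse, List.length_ofFn]
    congr 1
    ext
    simp; omega
  rw [h1] at h
  simpa [star_uPow_mul, B] using h

/-- The orthogonality relations. -/
theorem haar_star_coeff_mul_coeff {N : ℕ} (hN : 2 ≤ N) {n : ℕ} (Y : Mat N n) {Z : Mat N n}
    (hZ : Z ∈ endH N n) : (haar N).toFun (star (coeff N n Y) * coeff N n Z)
      = (Y.conjTranspose * Z).trace / qdim N n := by
  have hd : (qdim N n : ℂ) ≠ 0 := by rw [qdim_eq hN]; exact chebC_ne_zero hN n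
  let H : Word N n → Word N n → Word N n → Word N n → ℂ := fun a b c d =>
    (haar N).toFun (star (uPow N n a b) * uPow N n c d)
  have key : ∀ a b c d, ∑ e, jw N n c e * H a b e d
      = jw N n b d / qdim N n * jw N n c a := by
    intro a b c d
    obtain ⟨r, hr⟩ := exists_haar_eq hN b d
    -- Normalisation: in the trace over the row indices, `P_n` passes through `u^{⊗ n}` to the
    -- column side, and unitarity evaluates the remaining sum.
    have h1 : ∑ a, ∑ e, jw N n a e * H a b e d = jw N n b d := by
      have h2 : ∀ a, ∑ e, jw N n a e * H a b e d
          = ∑ e, jw N n e d * H a b a e := by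
        intro a
        have := intertwines_iff.1 (jw_intertwines hN n) a d
        have := congrArg (fun x => (haar N).toFun (star (uPow N n a b) * x)) this
        simpa only [Finset.mul_sum, mul_smul_comm, map_sum, map_smul, smul_eq_mul] using this
      simp only [h2]
      rw [Finset.sum_comm]
      have h3 : ∀ e, ∑ a, jw N n e d * H a b a e = if b = e then jw N n e d else 0 := by
        intro e
        rw [← Finset.mul_sum, ← map_sum, uPow_unitary]
        split_ifs <;> simp [(haar N).map_one]
      simp [h3]
    have h4 : jw N n b d = r * qdim N n := by
      rw [← h1, ← trace_jw, Matrix.trace, Finset.mul_sum]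
      exact Finset.sum_congr rfl fun a _ => hr a a
    rw [h4, mul_div_cancel_right₀ _ hd]
    exact hr a c
  have hZ1 : jw N n * Z = Z := by
    rw [← mem_endH_iff.1 hZ, ← mul_assoc, ← mul_assoc, jw_mul_self hN]
  have hZ2 : Z * jw N n = Z := by
    rw [← mem_endH_iff.1 hZ, mul_assoc, jw_mul_self hN]
  have h1 : (haar N).toFun (star (coeff N n Y) * coeff N n Z)
      = ∑ a, ∑ b, ∑ d, star (Y b a) * ∑ c, Z d c * H a b c d := by
    simp only [coeff_apply, star_sum, star_smul, Finset.sum_mul]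
    simp only [Finset.mul_sum, map_sum, smul_mul_smul_comm, map_smul, smul_eq_mul, H]
    refine Finset.sum_congr rfl fun a _ => Finset.sum_congr rfl fun b _ => ?_
    rw [Finset.sum_comm]
    simp only [mul_assoc]
  -- Only `Z` has to lie in `B(H_n)`, since `P_n` is needed on one side only; an arbitrary `Y` is
  -- what allows `proj_coeff` to be derived.
  have h2 : ∀ a b d, ∑ c, Z d c * H a b c d = jw N n b d / qdim N n * Z d a := by
    intro a b d
    calc ∑ c, Z d c * H a b c d
        = ∑ c, ∑ e, Z d e * (jw N n e c * H a b c d) := by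
          refine Finset.sum_congr rfl fun c _ => ?_
          conv_lhs => rw [← hZ2, Matrix.mul_apply, Finset.sum_mul]
          simp only [mul_assoc]
      _ = ∑ e, Z d e * ∑ c, jw N n e c * H a b c d := by
          rw [Finset.sum_comm]
          simp only [Finset.mul_sum]
      _ = jw N n b d / qdim N n * ∑ e, Z d e * jw N n e a := by
          simp only [key, Finset.mul_sum]
          exact Finset.sum_congr rfl fun _ _ => by ring
      _ = _ := by rw [← Matrix.mul_apply, hZ2]
  rw [h1, Matrix.trace, Finset.sum_div]
  refine Finset.sum_congr rfl fun a _ => ?_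
  rw [Matrix.diag, Matrix.mul_apply, Finset.sum_div]
  refine Finset.sum_congr rfl fun b _ => ?_
  simp only [h2, Matrix.conjTranspose_apply]
  conv_rhs => rw [← hZ1, Matrix.mul_apply, Finset.mul_sum, Finset.sum_div]
  exact Finset.sum_congr rfl fun _ _ => by ring

theorem inner_coeff {N : ℕ} (hN : 2 ≤ N) {n : ℕ} (Y : Mat N n) {Z : Mat N n} (hZ : Z ∈ endH N n) :
    inner ℂ (toL2 N (coeff N n Y)) (toL2 N (coeff N n Z))
      = (Y.conjTranspose * Z).trace / qdim N n := by
  rw [inner_toL2, haar_star_coeff_mul_coeff hN Y hZ]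

theorem jw_mul_mul_jw_mem {N : ℕ} (hN : 2 ≤ N) {n : ℕ} (W : Mat N n) :
    jw N n * W * jw N n ∈ endH N n := by
  rw [mem_endH_iff]
  have := jw_mul_self hN n
  calc jw N n * (jw N n * W * jw N n) * jw N n
      = (jw N n * jw N n) * W * (jw N n * jw N n) := by simp only [mul_assoc]
    _ = _ := by rw [this]

/-- Replacing `W` by its compression does not change `Tr(W* Z)` for `Z` in `B(H_n)`, so the
difference is orthogonal to the whole coefficient space. -/
theorem proj_coeff {N : ℕ} (hN : 2 ≤ N) {n : ℕ} (W : Mat N n) :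
    proj N n (toL2 N (coeff N n W)) = toL2 N (coeff N n (jw N n * W * jw N n)) := by
  refine Submodule.eq_starProjection_of_mem_of_inner_eq_zero
    (Submodule.mem_map_of_mem (f := toL2 N ∘ₗ coeff N n) (jw_mul_mul_jw_mem hN W)) ?_
  rintro _ ⟨Z, hZ, rfl⟩
  rw [LinearMap.comp_apply, inner_sub_left, inner_coeff hN _ hZ, inner_coeff hN _ hZ, sub_eq_zero]
  congr 1
  rw [Matrix.conjTranspose_mul, Matrix.conjTranspose_mul, jw_conjTranspose hN]
  calc (W.conjTranspose * Z).trace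
      = (W.conjTranspose * (jw N n * Z * jw N n)).trace := by rw [mem_endH_iff.1 hZ]
    _ = (W.conjTranspose * jw N n * Z * jw N n).trace := by simp only [mul_assoc]
    _ = _ := by rw [Matrix.trace_mul_comm]; simp only [mul_assoc]

/-! ### The Gram matrix as a trace -/

theorem exists_place_eq {N k i j n : ℕ} (h : i + k + j = n) (X : Mat N k) :
    ∃ S : Mat N n, place 0 S = place i X := by
  subst h
  refine ⟨tensor (tensor (1 : Mat N i) X) (1 : Mat N j), ?_⟩
  rw [place_tensor, place_tensor, place_one, place_one, one_mul, mul_one, zero_add]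

theorem exists_shift_eq {N : ℕ} (hN : 2 ≤ N) {k i j n : ℕ} (h : i + k + j = n) (X : Mat N k) :
    ∃ M : Mat N n, M ∈ endH N n ∧ shift N k X i j = toL2 N (coeff N n M) ∧
      place 0 M = wenzl N 0 n * place i X * wenzl N 0 n ∧
      place 0 M.conjTranspose = wenzl N 0 n * place i X.conjTranspose * wenzl N 0 n := by
  subst h
  have key : ∀ Y : Mat N k, place 0 (jw N (i + k + j) *
      tensor (tensor (jw N i) Y) (jw N j) * jw N (i + k + j))
      = wenzl N 0 (i + k + j) * place i Y * wenzl N 0 (i + k + j) := by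
    intro Y
    rw [place_mul, place_mul, place_tensor, place_tensor, place_jw hN, place_jw hN, place_jw hN]
    calc _ = (wenzl N 0 (i + k + j) * wenzl N 0 i) * place (0 + i) Y *
          (wenzl N (0 + (i + k)) j * wenzl N 0 (i + k + j)) := by simp only [mul_assoc]
      _ = _ := by
        rw [wenzl_mul_wenzl hN (by omega) (by omega), wenzl_mul_wenzl' hN (by omega) (by omega),
          zero_add]
  refine ⟨_, jw_mul_mul_jw_mem hN (tensor (tensor (jw N i) X) (jw N j)), ?_, key X, ?_⟩
  · rw [shift, chi, chi, ← coeff_tensor, ← coeff_tensor, proj_coeff hN]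
  · rw [Matrix.conjTranspose_mul, Matrix.conjTranspose_mul, tensor_conjTranspose,
      tensor_conjTranspose, jw_conjTranspose hN, jw_conjTranspose hN, jw_conjTranspose hN,
      ← mul_assoc]
    exact key X.conjTranspose

/-- By cyclicity of the trace, both projections of the left factor are absorbed by the right one.
The left factor becomes the bare `id ⊗ X* ⊗ id`, which does not touch the legs beyond `X*`. -/
theorem exists_gram_eq {N : ℕ} (hN : 2 ≤ N) {k n i p : ℕ} (hi : i + k ≤ n) (hp : p + k ≤ n)
    (X : Mat N k) : ∃ A : Mat N n,
      place 0 A = place i X.conjTranspose * (wenzl N 0 n * place p X * wenzl N 0 n) ∧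
      gram N k X n i p = A.trace / qdim N n := by
  obtain ⟨M, -, hM, -, hM'⟩ := exists_shift_eq hN (show i + k + (n - k - i) = n by omega) X
  obtain ⟨M', hE, hM2, hM2', -⟩ := exists_shift_eq hN (show p + k + (n - k - p) = n by omega) X
  obtain ⟨S, hS⟩ := exists_place_eq (show i + k + (n - k - i) = n by omega) X.conjTranspose
  refine ⟨S * M', by rw [place_mul, hS, hM2'], ?_⟩
  have h1 : M.conjTranspose = jw N n * S * jw N n :=
    place_injective (by omega) (by rw [place_mul, place_mul, hS, hM', place_jw hN])
  rw [gram, hM, hM2, inner_coeff hN _ hE, h1]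
  congr 1
  conv_rhs => rw [← mem_endH_iff.1 hE]
  rw [mul_assoc (jw N n), mul_assoc (jw N n), Matrix.trace_mul_comm]
  simp only [mul_assoc]

/-! ### The recursion for the Gram matrix -/

theorem gram_recursion (N : ℕ) (hN : 3 ≤ N) (k n : ℕ) (hk : 0 < k) (hkn : k < n)
    (X : Mat N k) (hX : X ∈ endHcc N k)
    (μ : ℂ) (hμ : rot N k X = μ • X)
    (i p : ℕ) (hi : i < n - k) (hp : p ≤ n - k) :
    gram N k X n i p =
      (if p < n - k then (1 - coefA N k n p : ℝ) * gram N k X (n - 1) i p else 0)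
      + (if 0 < p then
          (coefB N k μ n p : ℂ) * gram N k X (n - 1) i (p - 1) else 0)
      + (if 1 < p then
          (coefC N n p : ℂ) * gram N k X (n - 1) i (p - 2) else 0) := by
  have hN' : 2 ≤ N := by omega
  obtain ⟨k, rfl⟩ : ∃ l, k = l + 1 := ⟨k - 1, by omega⟩
  obtain ⟨m, rfl⟩ : ∃ l, n = l + 1 := ⟨n - 1, by omega⟩
  have hrot := isRotationEigen hN' hX hμ
  have d0 := chebC_ne_zero hN' m
  have d1 := chebC_ne_zero hN' (m + 1)
  obtain ⟨A, hA, hgA⟩ := exists_gram_eq hN' (n := m + 1) (i := i) (p := p)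
    (by omega) (by omega) X
  have hB : ∀ q, ∃ B : Mat N m, q + (k + 1) ≤ m →
      place 0 B = place i X.conjTranspose * (wenzl N 0 m * place q X * wenzl N 0 m) ∧
      B.trace = chebC N m * gram N (k + 1) X m i q := by
    intro q
    by_cases hq : q + (k + 1) ≤ m
    · obtain ⟨B, h1, h2⟩ := exists_gram_eq hN' (n := m) (i := i) (p := q) (by omega) hq X
      refine ⟨B, fun _ => ⟨h1, ?_⟩⟩
      rw [h2, qdim_eq hN', mul_div_cancel₀ _ d0]
    · exact ⟨0, fun h => absurd h hq⟩
  choose B hB using hB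
  have htr : trRight N (m + 1) A = (chebC N (m + 1) / chebC N m) • (
      (if p + k < m then (1 - chebC N (p + k + 1) * chebC N (p + k) /
        (chebC N (m + 1) * chebC N m)) • B p else 0) +
      (if 0 < p then ((μ + star μ) * (-1) ^ (k + 1) * (chebC N (p + k) * chebC N (p - 1) /
        (chebC N (m + 1) * chebC N m))) • B (p - 1) else 0) +
      (if 1 < p then (-(chebC N (p - 1) * chebC N (p - 2) /
        (chebC N (m + 1) * chebC N m))) • B (p - 2) else 0)) := by
    refine place_injective (k := m) (by omega) ?_
    -- Since `i < n - k`, the contraction of the last leg slides past `X*`, so the partial trace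
    -- acts on the compression of `X` alone.
    have h1 := cap_place_cup_right 0 A
    rw [zero_add, hA, ← mul_assoc, cap_mul_place_right (by omega), mul_assoc (place _ _),
      mul_assoc (place _ _), hrot.cap_compress_cup hN' (by omega)] at h1
    refine h1.symm.trans ?_
    rw [place_smul, place_add, place_add, mul_smul_comm, mul_add, mul_add]
    congr 3
    · split_ifs with h
      · rw [place_smul, (hB p (by omega)).1, mul_smul_comm]
      · rw [place_zero, mul_zero]
    · split_ifs with h
      · rw [place_smul, (hB (p - 1) (by omega)).1, mul_smul_comm]
      · rw [place_zero, mul_zero]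
    · split_ifs with h
      · rw [place_smul, (hB (p - 2) (by omega)).1, mul_smul_comm]
      · rw [place_zero, mul_zero]
  have hre : μ + star μ = 2 * (μ.re : ℂ) := by
    rw [Complex.star_def, Complex.add_conj]
    push_cast
    ring
  have hqd : ∀ l, (qdim N l : ℂ) = chebC N l := qdim_eq hN'
  -- The factor `d_{m+1} / d_m` of the partial trace cancels against the normalisations `1 / d_n`
  -- and `d_m` of the two Gram matrices.
  rw [hgA, hqd, ← trace_trRight, htr, Matrix.trace_smul, Matrix.trace_add, Matrix.trace_add,
    smul_eq_mul, mul_comm, mul_div_assoc, div_div_cancel_left' d1, ← div_eq_mul_inv, add_div,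
    add_div]
  congr 2
  · by_cases h : p + k < m
    · rw [if_pos h, if_pos (by omega), Matrix.trace_smul, (hB p (by omega)).2, smul_eq_mul]
      simp only [coefA]
      push_cast [hqd]
      rw [← add_assoc, Nat.add_sub_cancel]
      field_simp
    · rw [if_neg h, if_neg (by omega)]
      simp
  · split_ifs with h
    · rw [Matrix.trace_smul, (hB (p - 1) (by omega)).2, smul_eq_mul, hre]
      simp only [coefB]
      push_cast [hqd]
      rw [show p + (k + 1) - 1 = p + k by omega]
      field_simp
    · simp
  · split_ifs with h
    · rw [Matrix.trace_smul, (hB (p - 2) (by omega)).2, smul_eq_mul]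
      simp only [coefC]
      push_cast [hqd]
      field_simp
    · simp

end FreeOrth

end

theorem mainTheorem6 (N : ℕ) (hN : 3 ≤ N) (k n : ℕ) (hk : 0 < k) (hkn : k < n)
    (X : FreeOrth.Mat N k) (hX : X ∈ FreeOrth.endHcc N k)
    (μ : ℂ) (hμ : FreeOrth.rot N k X = μ • X)
    (i p : ℕ) (hi : i < n - k) (hp : p ≤ n - k) :
    FreeOrth.gram N k X n i p =
      (if p < n - k then (1 - FreeOrth.coefA N k n p : ℝ) * FreeOrth.gram N k X (n - 1) i p else 0)
      + (if 0 < p then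
          (FreeOrth.coefB N k μ n p : ℂ) * FreeOrth.gram N k X (n - 1) i (p - 1) else 0)
      + (if 1 < p then
          (FreeOrth.coefC N n p : ℂ) * FreeOrth.gram N k X (n - 1) i (p - 2) else 0) :=
  FreeOrth.gram_recursion N hN k n hk hkn X hX μ hμ i p hi hp
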